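/- **Conventions.** For $0\le\nu\le n$ let $B_\nu$ be the real inner product on $\mathbb C^n=\mathbb R^{2n}$, $B_\nu(z,w)=-\sum_{k\le\nu}\mathrm{Re}(\bar z_kw_k)+\sum_{k>\nu}\mathrm{Re}(\bar z_kw_k)$. Let $N\subset\mathbb C^n$ be either the unit sphere $S^{2n-1}=\{B_0(z,z)=1\}$ (put $\nu=0$, $c=1$) or, for $\nu\ge1$, the pseudo-sphere $N_\nu^{2n-1}=\{B_\nu(z,z)=-1\}$ (put $c=-1$), with the (pseudo-)Riemannian metric $g_N$ induced by $B_\nu$. Let $\tilde S^{2\ell-1}=N_1^{2\ell-1}\subset\mathbb C^\ell$ and $\check S^{4\ell-1}=N_2^{4\ell-1}\subset\mathbb C^{2\ell}=\mathbb H^\ell$, where the $a$-th quaternion is $z_{2a-1}+z_{2a}\,j$. Let $M=S^1\times N$ with the product metric $g_M=c\,d\theta^2\oplus g_N$. Define $\Xi:TM\to\mathbb C^n$ by $\Xi(\partial_\theta)=\Theta$ at $(\theta,\Theta)$ and $\Xi|_{TN}=$ inclusion. A real linear endomorphism $A$ of $\mathbb C^n$ defines the endomorphism $J=\Xi^{-1}A\,\Xi$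 of $TM$. Let $\mathbb{CP}^{n-1}$ be the space of complex lines in $\mathbb C^n$ and let $\widetilde{\mathbb{CP}}{}_\nu^{n-1}$ be its open subset of lines on which $B_\nu$ is negative. They carry the Fubini–Study metrics $$g(d\pi_vX,d\pi_vY)=c\,\frac{B_\nu(v,v)B_\nu(X,Y)-B_\nu(v,X)B_\nu(v,Y)-B_\nu(iv,X)B_\nu(iv,Y)}{B_\nu(v,v)^2},\qquad \pi(v)=[v],$$ with $\nu=0$, $c=1$ on $\mathbb{CP}^{n-1}$, and $c=-1$ on $\widetilde{\mathbb{CP}}{}_\nu^{n-1}$. A smooth map $\pi:(M,g_M)\to(N',g_{N'})$ is a pseudo-Riemannian submersion if $\pi_*$ is surjective, $g_M$ is nondegenerate on $\mathcal V=\ker\pi_*$, and $\pi_*$ is isometric on $\mathcal H=\mathcal V^\perp$. It is anti-invariant pseudo-Hermitian with respect to $J$ if $J^2=-1$, $J^*g_M=g_M$, $J$ is integrable (sections of $T^{1,0}$ are closed under the Lie bracket), and $J\mathcal V\subset\mathcal H$. If both metrics are positive definite it is called an anti-invariant Hermitian Riemannian submersion. **Statement.** In all cases below, $\Xi$ is an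 isometric isomorphism of each $(T_xM,g_M)$ with $(\mathbb C^n,B_\nu)$. (A) Let $\ell\ge3$ and let $J$ be given by multiplication by $i$ on $\mathbb C^\ell$. In each of the following cases $\pi$ is onto, its fibres are the orbits of the stated action of $S^1$, and $\dim\mathcal V=1$. 1. $\pi:S^1\times S^{2\ell-1}\to S^{2\ell-1}$ (multiplication on $S^1$, trivial action on $S^{2\ell-1}$) is an anti-invariant Hermitian Riemannian submersion. 2. $\pi:S^1\times S^{2\ell-1}\to S^1\times\mathbb{CP}^{\ell-1}$ (trivial action on $S^1$, complex multiplication on $S^{2\ell-1}$), with base metric $d\theta^2\oplus g$, is an anti-invariant Hermitian Riemannian submersion. 3. $\pi:S^1\times\tilde S^{2\ell-1}\to\tilde S^{2\ell-1}$ (multiplication on $S^1$, trivial action on $\tilde S^{2\ell-1}$) is an anti-invariant pseudo-Hermitian pseudo-Riemannian submersion. 4. $\pi:S^1\times\tilde S^{2\ell-1}\to S^1\times\widetilde{\mathbb{CP}}{}_1^{\ell-1}$ (trivial action on $S^1$, complex multiplication on $\tilde S^{2\ell-1}$), with base metric $-d\theta^2\oplus g$, is an anti-invariant pseudo-Hermitian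 pseudo-Riemannian submersion. (B) Let $\ell\ge2$ and let $J$ be given by left quaternion multiplication by $j$ on $\mathbb H^\ell=\mathbb C^{2\ell}$. In each of the following cases $\pi(\theta,\Theta)=[\Theta]$ is onto, its fibres are the orbits of the product action of $S^1\times S^1$ by complex multiplication on both factors of $M$, and $\Xi(\mathcal V_{(\theta,\Theta)})=\mathrm{Span}_{\mathbb R}\{\Theta,i\Theta\}$. 1. $\pi:S^1\times S^{4\ell-1}\to\mathbb{CP}^{2\ell-1}$ is an anti-invariant Hermitian Riemannian submersion. 2. $\pi:S^1\times\check S^{4\ell-1}\to\widetilde{\mathbb{CP}}{}_2^{2\ell-1}$ is an anti-invariant pseudo-Hermitian pseudo-Riemannian submersion. -/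

import Mathlib

open scoped Manifold ContDiff Topology Quaternion LinearAlgebra.Projectivization

noncomputable section

namespace AntiInvariant

/-! ### Pseudo-Riemannian submersions and Hermitian geometry -/

section Geometry

variable {E : Type*} [NormedAddCommGroup E] [NormedSpace ℝ E]
  {H : Type*} [TopologicalSpace H] (I : ModelWithCorners ℝ E H)
  {E' : Type*} [NormedAddCommGroup E'] [NormedSpace ℝ E']
  {H' : Type*} [TopologicalSpace H'] (I' : ModelWithCorners ℝ E' H')
  {V : Type*} [NormedAddCommGroup V] [NormedSpace ℝ V]
  (M : Type*) [TopologicalSpace M] [ChartedSpace H M]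
  (M' : Type*) [TopologicalSpace M'] [ChartedSpace H' M']

/-- A (not necessarily continuous) vector field on `M`. -/
abbrev VField := ∀ p : M, TangentSpace I p

/-- A field of real bilinear forms on the tangent spaces of `M`. -/
abbrev BilinField := ∀ p : M, LinearMap.BilinForm ℝ (TangentSpace I p)

/-- A field of endomorphisms of the tangent spaces of `M`. -/
abbrev EndField := ∀ p : M, TangentSpace I p →L[ℝ] TangentSpace I p

variable {M M'}

/-- The pullback `f^* g` of a field of bilinear forms. -/
def pullback (f : M → M') (g : BilinField I' M') : BilinField I M := fun p =>
  LinearMap.compl₁₂ (g (f p)) (mfderiv I I' f p).toLinearMap (mfderiv I I' f p).toLinearMap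

/-- The field of bilinear forms induced on `M` by a map `f` into a vector space with a fixed
bilinear form `B` (the first fundamental form). -/
def induced (f : M → V) (B : LinearMap.BilinForm ℝ V) : BilinField I M := fun p =>
  LinearMap.compl₁₂ B (mfderiv I 𝓘(ℝ, V) f p).toLinearMap (mfderiv I 𝓘(ℝ, V) f p).toLinearMap

/-- The product metric `g ⊕ g'` on `M × M'`. -/
def prodMetric (g : BilinField I M) (g' : BilinField I' M') :
    BilinField (I.prod I') (M × M') := fun p =>
  pullback (I.prod I') I Prod.fst g p + pullback (I.prod I') I' Prod.snd g' p

variable [IsManifold I 1 M] [IsManifold I' 1 M']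

/-- The vector field `X` is smooth on the set `U`. -/
def SmoothOn (X : VField I M) (U : Set M) : Prop :=
  ContMDiffOn I I.tangent ∞ (fun p => (⟨p, X p⟩ : TangentBundle I M)) U

/-- `g` is a pseudo-Riemannian metric: symmetric, nondegenerate, and smooth, i.e. `g(X, Y)` is
smooth for all locally defined smooth vector fields `X`, `Y`. -/
structure IsPseudoRiemannianMetric (g : BilinField I M) : Prop where
  symm : ∀ p X Y, g p X Y = g p Y X
  nondegenerate : ∀ p X, (∀ Y, g p X Y = 0) → X = 0
  smooth : ∀ (U : Set M), IsOpen U → ∀ X Y : VField I M, SmoothOn I X U → SmoothOn I Y U →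
    ContMDiffOn I 𝓘(ℝ, ℝ) ∞ (fun p => g p (X p) (Y p)) U

/-- A positive definite field of bilinear forms. -/
def IsPosDef (g : BilinField I M) : Prop := ∀ p X, X ≠ 0 → 0 < g p X X

/-- The vertical space `ker π_*` at `p`. -/
def vertical (π : M → M') (p : M) : Submodule ℝ (TangentSpace I p) :=
  LinearMap.ker (mfderiv I I' π p).toLinearMap

/-- The horizontal space at `p`: the `g`-orthogonal complement of the vertical space. -/
def horizontal (g : BilinField I M) (π : M → M') (p : M) : Submodule ℝ (TangentSpace I p) :=
  (vertical I I' π p).orthogonalBilin (g p)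

/-- `π : (M, gM) → (N, gN)` is a pseudo-Riemannian submersion. -/
structure IsPseudoRiemannianSubmersion (gM : BilinField I M) (gN : BilinField I' M')
    (π : M → M') : Prop where
  metric_source : IsPseudoRiemannianMetric I gM
  metric_target : IsPseudoRiemannianMetric I' gN
  smooth : ContMDiff I I' ∞ π
  submersion : ∀ p, Function.Surjective (mfderiv I I' π p)
  vertical_nondegenerate : ∀ p, ∀ X ∈ vertical I I' π p,
    (∀ Y ∈ vertical I I' π p, gM p X Y = 0) → X = 0
  isometry : ∀ p, ∀ X ∈ horizontal I I' gM π p, ∀ Y ∈ horizontal I I' gM π p,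
    gN (π p) (mfderiv I I' π p X) (mfderiv I I' π p Y) = gM p X Y

/-- `A + √-1 B` is a section over `U` of the bundle `T^{1,0}` of complex tangent vectors `Z` with
`J Z = √-1 Z`. -/
def IsType10 (J : EndField I M) (U : Set M) (A B : VField I M) : Prop :=
  ∀ p ∈ U, J p (A p) = - B p ∧ J p (B p) = A p

open VectorField in
/-- Integrability of `J`: smooth sections of `T^{1,0}` are closed under the complex Lie bracket
`[A₁ + √-1 B₁, A₂ + √-1 B₂] = ([A₁, A₂] - [B₁, B₂]) + √-1 ([A₁, B₂] + [B₁, A₂])`. -/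
def IsIntegrable (J : EndField I M) : Prop :=
  ∀ U : Set M, IsOpen U → ∀ A₁ B₁ A₂ B₂ : VField I M,
    SmoothOn I A₁ U → SmoothOn I B₁ U → SmoothOn I A₂ U → SmoothOn I B₂ U →
    IsType10 I J U A₁ B₁ → IsType10 I J U A₂ B₂ →
    IsType10 I J U (mlieBracket I A₁ A₂ - mlieBracket I B₁ B₂)
      (mlieBracket I A₁ B₂ + mlieBracket I B₁ A₂)

/-- `(M, g, J)` is a pseudo-Hermitian manifold: `J` is a smooth almost complex structure which is
integrable, and `J^* g = g`. -/
structure IsPseudoHermitian (g : BilinField I M) (J : EndField I M) : Prop where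
  metric : IsPseudoRiemannianMetric I g
  smooth : ∀ (U : Set M), IsOpen U → ∀ X : VField I M, SmoothOn I X U →
    SmoothOn I (fun p => J p (X p)) U
  sq : ∀ p X, J p (J p X) = -X
  compatible : ∀ p X Y, g p (J p X) (J p Y) = g p X Y
  integrable : IsIntegrable I J

/-- `π` is an anti-invariant (pseudo-)Hermitian pseudo-Riemannian submersion. -/
structure IsAntiInvariantPseudoHermitianSubmersion (gM : BilinField I M) (J : EndField I M)
    (gN : BilinField I' M') (π : M → M') : Prop where
  hermitian : IsPseudoHermitian I gM J
  submersion : IsPseudoRiemannianSubmersion I I' gM gN π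
  antiInvariant : ∀ p, ∀ X ∈ vertical I I' π p, J p X ∈ horizontal I I' gM π p

/-- `π` is an anti-invariant Hermitian Riemannian submersion (both metrics are Riemannian). -/
structure IsAntiInvariantHermitianSubmersion (gM : BilinField I M) (J : EndField I M)
    (gN : BilinField I' M') (π : M → M') : Prop extends
    IsAntiInvariantPseudoHermitianSubmersion I I' gM J gN π where
  posDef_source : IsPosDef I gM
  posDef_target : IsPosDef I' gN

end Geometry

/-- `π` is the projection onto the orbit space of an action `a` of `G` on `M`: it is onto and its
fibres are exactly the orbits. -/
def IsOrbitProjection {G M N : Type*} [Group G] (a : MulAction G M) (π : M → N) : Prop :=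
  Function.Surjective π ∧ ∀ x y, π x = π y ↔ ∃ g : G, a.smul g x = y

/-! ### Complex space with its indefinite inner products -/

/-- `ℂ^n`, which is also the real vector space `ℝ^{2n}`. -/
abbrev CSpace (n : ℕ) := EuclideanSpace ℂ (Fin n)

/-- The real inner product on `ℂ^n = ℝ^{2n}` in which the first `ν` complex coordinates (that is,
the first `2ν` real coordinates) carry the sign `-1` and all others the sign `+1`. -/
def form (n ν : ℕ) : LinearMap.BilinForm ℝ (CSpace n) :=
  ∑ k : Fin n, (if (k : ℕ) < ν then (-1 : ℝ) else 1) •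
    LinearMap.compl₁₂ (innerₗ ℂ)
      ((EuclideanSpace.proj k : CSpace n →L[ℂ] ℂ).restrictScalars ℝ).toLinearMap
      ((EuclideanSpace.proj k : CSpace n →L[ℂ] ℂ).restrictScalars ℝ).toLinearMap

theorem form_apply (n ν : ℕ) (z w : CSpace n) :
    form n ν z w = ∑ k : Fin n, (if (k : ℕ) < ν then (-1 : ℝ) else 1) *
      ((z k).re * (w k).re + (z k).im * (w k).im) := by
  simp only [form, LinearMap.sum_apply, LinearMap.smul_apply]
  refine Finset.sum_congr rfl fun k _ => ?_
  simp [Complex.inner, mul_comm]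

theorem form_comm (n ν : ℕ) (z w : CSpace n) : form n ν z w = form n ν w z := by
  simp only [form_apply]
  exact Finset.sum_congr rfl fun k _ => by ring

theorem contDiff_form (n ν : ℕ) :
    ContDiff ℝ ∞ (fun q : CSpace n × CSpace n => form n ν q.1 q.2) := by
  have h : ∀ k : Fin n, ContDiff ℝ ∞ (fun z : CSpace n => z k) := fun k =>
    ((EuclideanSpace.proj k : CSpace n →L[ℂ] ℂ).restrictScalars ℝ).contDiff
  have hre : ∀ k : Fin n, ContDiff ℝ ∞ (fun z : CSpace n => (z k).re) := fun k =>
    Complex.reCLM.contDiff.comp (h k)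
  have him : ∀ k : Fin n, ContDiff ℝ ∞ (fun z : CSpace n => (z k).im) := fun k =>
    Complex.imCLM.contDiff.comp (h k)
  simp only [form_apply]
  refine ContDiff.sum fun k _ => contDiff_const.mul ?_
  exact (((hre k).comp contDiff_fst).mul ((hre k).comp contDiff_snd)).add
    (((him k).comp contDiff_fst).mul ((him k).comp contDiff_snd))

theorem form_smul_smul (n ν : ℕ) (a : ℂ) (z w : CSpace n) :
    form n ν (a • z) (a • w) = Complex.normSq a * form n ν z w := by
  simp only [form_apply, Finset.mul_sum, Complex.normSq_apply]
  refine Finset.sum_congr rfl fun k _ => ?_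
  simp
  ring_nf

/-- Complex multiplication by `i` on `ℂ^n`, as a real linear map. -/
def mulI (n : ℕ) : CSpace n →L[ℝ] CSpace n :=
  (Complex.I • ContinuousLinearMap.id ℂ (CSpace n)).restrictScalars ℝ

theorem finrank_real_CSpace (n : ℕ) : Module.finrank ℝ (CSpace n) = 2 * n := by
  have h := Module.finrank_mul_finrank ℝ ℂ (CSpace n)
  rw [Complex.finrank_real_complex, finrank_euclideanSpace_fin] at h
  exact h.symm

/-! ### Quaternionic coordinates -/

/-- The identification `ℂ^{2ℓ} = ℍ^ℓ` (both being `ℝ^{4ℓ}`), in which the `a`-th quaternion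
is `z_{2a} + z_{2a+1} j`. -/
def quatEquiv (ℓ : ℕ) : CSpace (2 * ℓ) ≃ₗ[ℝ] (Fin ℓ → ℍ[ℝ]) where
  toFun z a := ⟨(z ⟨2 * a, by omega⟩).re, (z ⟨2 * a, by omega⟩).im,
    (z ⟨2 * a + 1, by omega⟩).re, (z ⟨2 * a + 1, by omega⟩).im⟩
  invFun q := WithLp.toLp 2 fun k =>
    if (k : ℕ) % 2 = 0 then ⟨(q ⟨k / 2, by omega⟩).re, (q ⟨k / 2, by omega⟩).imI⟩
    else ⟨(q ⟨k / 2, by omega⟩).imJ, (q ⟨k / 2, by omega⟩).imK⟩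
  map_add' z w := by
    funext a
    refine QuaternionAlgebra.ext ?_ ?_ ?_ ?_ <;> rfl
  map_smul' c z := by
    funext a
    refine QuaternionAlgebra.ext ?_ ?_ ?_ ?_ <;> simp <;> rfl
  left_inv z := by
    ext k
    by_cases h : (k : ℕ) % 2 = 0
    · have hk : 2 * ((k : ℕ) / 2) = k := by omega
      simp [h, hk]
    · have hk : 2 * ((k : ℕ) / 2) + 1 = k := by omega
      simp [h, hk]
  right_inv q := by
    funext a
    have h1 : (2 * (a : ℕ) + 1) / 2 = a := by omega
    ext <;> simp [h1, Nat.add_mod]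

theorem quatEquiv_apply (ℓ : ℕ) (z : CSpace (2 * ℓ)) (a : Fin ℓ) :
    quatEquiv ℓ z a = ⟨(z ⟨2 * a, by omega⟩).re, (z ⟨2 * a, by omega⟩).im,
      (z ⟨2 * a + 1, by omega⟩).re, (z ⟨2 * a + 1, by omega⟩).im⟩ := rfl

/-- The unit quaternion `i`. -/
def quatI : ℍ[ℝ] := ⟨0, 1, 0, 0⟩

/-- The unit quaternion `j`. -/
def quatJ : ℍ[ℝ] := ⟨0, 0, 1, 0⟩

/-- Left quaternion multiplication by `j` on `ℂ^{2ℓ} = ℍ^ℓ`. -/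
def mulJ (ℓ : ℕ) : CSpace (2 * ℓ) →L[ℝ] CSpace (2 * ℓ) :=
  LinearMap.toContinuousLinearMap ((quatEquiv ℓ).symm.toLinearMap ∘ₗ
    LinearMap.mulLeft ℝ (fun _ : Fin ℓ => quatJ) ∘ₗ (quatEquiv ℓ).toLinearMap)

/-- Multiplication by the complex number `i` is left multiplication by the quaternion `i`. -/
theorem quatEquiv_I_smul (ℓ : ℕ) (z : CSpace (2 * ℓ)) (a : Fin ℓ) :
    quatEquiv ℓ (Complex.I • z) a = quatI * quatEquiv ℓ z a := by
  refine QuaternionAlgebra.ext ?_ ?_ ?_ ?_ <;>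
    simp only [Quaternion.re_mul, Quaternion.imI_mul, Quaternion.imJ_mul, Quaternion.imK_mul] <;>
    simp [quatEquiv_apply, quatI]

/-! ### Spheres and pseudo-spheres -/

/-- The unit sphere `S^{2n-1}` in `ℂ^n`. -/
abbrev USphere (n : ℕ) := Metric.sphere (0 : CSpace n) 1

instance (n : ℕ) [NeZero n] : Fact (Module.finrank ℝ (CSpace n) = (2 * n - 1) + 1) :=
  ⟨by rw [finrank_real_CSpace]; have := NeZero.pos n; omega⟩

/-- The pseudo-sphere `{z ∈ ℂ^n : ⟨z, z⟩ = -1}` for the inner product `form n ν`. -/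
@[ext]
structure PseudoSphere (n ν : ℕ) where
  /-- The inclusion of the pseudo-sphere in `ℂ^n`. -/
  incl : CSpace n
  incl_spec : form n ν incl incl = -1

namespace PseudoSphere

variable {n ν : ℕ}

/-- The subspace topology. -/
instance : TopologicalSpace (PseudoSphere n ν) := TopologicalSpace.induced incl inferInstance

theorem continuous_incl : Continuous (incl : PseudoSphere n ν → CSpace n) :=
  continuous_induced_dom

/-- The tangent hyperplane `p^⊥` of the pseudo-sphere at `p`. -/
abbrev perp (p : PseudoSphere n ν) : Submodule ℝ (CSpace n) := LinearMap.ker (form n ν p.incl)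

theorem finrank_perp (p : PseudoSphere n ν) :
    Module.finrank ℝ p.perp = Module.finrank ℝ (EuclideanSpace ℝ (Fin (2 * n - 1))) := by
  have hne : form n ν p.incl ≠ 0 := by
    intro h
    have := p.incl_spec
    rw [h] at this
    norm_num at this
  have h : Module.finrank ℝ p.perp + 1 = Module.finrank ℝ (CSpace n) :=
    Module.Dual.finrank_ker_add_one_of_ne_zero (f := form n ν p.incl) hne
  rw [finrank_real_CSpace] at h
  rw [finrank_euclideanSpace_fin]
  omega

/-- A linear coordinate system on the tangent hyperplane `p^⊥`. -/
def coord (p : PseudoSphere n ν) : p.perp ≃L[ℝ] EuclideanSpace ℝ (Fin (2 * n - 1)) :=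
  ContinuousLinearEquiv.ofFinrankEq p.finrank_perp

/-- The orthogonal projection `z ↦ z + ⟨p, z⟩ p` of `ℂ^n` onto `p^⊥` (recall `⟨p, p⟩ = -1`). -/
def proj (p : PseudoSphere n ν) : CSpace n →L[ℝ] p.perp :=
  LinearMap.toContinuousLinearMap <| LinearMap.codRestrict p.perp
    (LinearMap.id + (form n ν p.incl).smulRight p.incl) fun z => by
      simp [p.incl_spec]

theorem proj_coe (p : PseudoSphere n ν) (z : CSpace n) :
    (p.proj z : CSpace n) = z + form n ν p.incl z • p.incl := rfl

/-- The point of the pseudo-sphere over `y ∈ p^⊥` is `√(1 + ⟨y, y⟩) p + y`. -/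
def lift (p : PseudoSphere n ν) (y : CSpace n) : CSpace n :=
  √(1 + form n ν y y) • p.incl + y

theorem form_lift (p : PseudoSphere n ν) (y : p.perp) (hy : 0 ≤ 1 + form n ν y y) :
    form n ν (p.lift y) (p.lift y) = -1 := by
  have h0 : form n ν p.incl y = 0 := y.2
  have h1 : form n ν y p.incl = 0 := by rw [form_comm]; exact h0
  simp only [lift, map_add, map_smul, LinearMap.add_apply, LinearMap.smul_apply, h0, h1,
    p.incl_spec, smul_eq_mul]
  have := Real.mul_self_sqrt hy
  linear_combination -this

theorem proj_lift (p : PseudoSphere n ν) (y : p.perp) : p.proj (p.lift y) = y := by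
  apply Subtype.ext
  have h0 : form n ν p.incl y = 0 := y.2
  rw [proj_coe]
  simp only [lift, map_add, map_smul, h0, p.incl_spec, smul_eq_mul]
  module

theorem form_proj (p z : PseudoSphere n ν) :
    1 + form n ν (p.proj z.incl : CSpace n) (p.proj z.incl) = form n ν p.incl z.incl ^ 2 := by
  simp only [proj_coe, map_add, map_smul, LinearMap.add_apply, LinearMap.smul_apply,
    p.incl_spec, z.incl_spec, smul_eq_mul, form_comm n ν z.incl p.incl]
  ring

theorem contDiff_quad : ContDiff ℝ ∞ (fun z : CSpace n => form n ν z z) :=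
  (contDiff_form n ν).comp (contDiff_id.prodMk contDiff_id)

open Classical in
/-- The chart of the pseudo-sphere at `p`: orthogonal projection to the tangent hyperplane `p^⊥`,
on the open set of points `z` with `⟨p, z⟩ < 0`. -/
def chart (p : PseudoSphere n ν) :
    OpenPartialHomeomorph (PseudoSphere n ν) (EuclideanSpace ℝ (Fin (2 * n - 1))) where
  toFun z := p.coord (p.proj z.incl)
  invFun x := if h : 0 ≤ 1 + form n ν (p.coord.symm x : CSpace n) (p.coord.symm x) then
    ⟨p.lift (p.coord.symm x), p.form_lift _ h⟩ else p
  source := {z | form n ν p.incl z.incl < 0}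
  target := {x | 0 < 1 + form n ν (p.coord.symm x : CSpace n) (p.coord.symm x)}
  map_source' z hz := by
    simp only [Set.mem_ofPred_eq, ContinuousLinearEquiv.symm_apply_apply, form_proj] at hz ⊢
    exact sq_pos_of_neg hz
  map_target' x hx := by
    have hx' : 0 < 1 + form n ν (p.coord.symm x : CSpace n) (p.coord.symm x) := hx
    have h0 : form n ν p.incl (p.coord.symm x) = 0 := (p.coord.symm x).2
    rw [dif_pos hx'.le]
    change form n ν p.incl (p.lift (p.coord.symm x)) < 0
    simp only [lift, map_add, map_smul, h0, p.incl_spec, smul_eq_mul]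
    have := Real.sqrt_pos.2 hx'
    linarith
  left_inv' z hz := by
    have hz' : form n ν p.incl z.incl < 0 := hz
    have hs : 1 + form n ν (p.proj z.incl : CSpace n) (p.proj z.incl) =
      (-form n ν p.incl z.incl) ^ 2 := by rw [form_proj]; ring
    have h : 0 ≤ 1 + form n ν (p.proj z.incl : CSpace n) (p.proj z.incl) := by
      rw [hs]; positivity
    simp only [ContinuousLinearEquiv.symm_apply_apply]
    rw [dif_pos h]
    apply PseudoSphere.ext
    change p.lift _ = z.incl
    rw [lift, hs, Real.sqrt_sq (by linarith), proj_coe]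
    module
  right_inv' x hx := by
    have hx' : 0 < 1 + form n ν (p.coord.symm x : CSpace n) (p.coord.symm x) := hx
    rw [dif_pos hx'.le]
    change p.coord (p.proj (p.lift _)) = x
    rw [proj_lift]
    simp
  open_source := by
    refine isOpen_lt ?_ continuous_const
    exact (contDiff_form n ν).continuous.comp (continuous_const.prodMk continuous_incl)
  open_target := by
    refine isOpen_lt continuous_const (continuous_const.add ?_)
    exact contDiff_quad.continuous.comp
      (continuous_subtype_val.comp p.coord.symm.continuous)
  continuousOn_toFun := by
    exact (p.coord.continuous.comp (p.proj.continuous.comp continuous_incl)).continuousOn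
  continuousOn_invFun := by
    rw [continuousOn_iff_continuous_domRestrict]
    have hc : Continuous fun x : EuclideanSpace ℝ (Fin (2 * n - 1)) =>
        p.lift (p.coord.symm x) := by
      have h1 : Continuous fun x : EuclideanSpace ℝ (Fin (2 * n - 1)) =>
        (p.coord.symm x : CSpace n) := continuous_subtype_val.comp p.coord.symm.continuous
      unfold lift
      exact ((Real.continuous_sqrt.comp (continuous_const.add
        (contDiff_quad.continuous.comp h1))).smul continuous_const).add h1
    refine continuous_induced_rng.2 ((hc.comp continuous_subtype_val).congr ?_)
    rintro ⟨x, hx⟩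
    have hx' : 0 < 1 + form n ν (p.coord.symm x : CSpace n) (p.coord.symm x) := hx
    change p.lift _ = incl (if h : _ then _ else _)
    rw [dif_pos hx'.le]

instance : ChartedSpace (EuclideanSpace ℝ (Fin (2 * n - 1))) (PseudoSphere n ν) where
  atlas := Set.range chart
  chartAt := chart
  mem_chart_source p := by
    change form n ν p.incl p.incl < 0
    rw [p.incl_spec]
    norm_num
  chart_mem_atlas p := ⟨p, rfl⟩

instance : IsManifold (𝓡 (2 * n - 1)) ∞ (PseudoSphere n ν) := by
  refine isManifold_of_contDiffOn _ _ _ ?_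
  rintro _ _ ⟨p, rfl⟩ ⟨q, rfl⟩
  have hs : ContDiff ℝ ∞ fun x : EuclideanSpace ℝ (Fin (2 * n - 1)) =>
      (p.coord.symm x : CSpace n) := p.perp.subtypeL.contDiff.comp p.coord.symm.contDiff
  have hl : ContDiffOn ℝ ∞ (fun x : EuclideanSpace ℝ (Fin (2 * n - 1)) =>
      q.coord (q.proj (p.lift (p.coord.symm x)))) p.chart.target := by
    refine (q.coord.contDiff.comp q.proj.contDiff).comp_contDiffOn ?_
    unfold lift
    refine ContDiffOn.add (ContDiffOn.fun_smul (f := fun x => √_) ?_ contDiffOn_const)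
      hs.contDiffOn
    refine ContDiffOn.sqrt (contDiff_const.add (contDiff_quad.comp hs)).contDiffOn ?_
    intro x hx
    exact ne_of_gt hx
  refine (hl.mono ?_).congr ?_
  · intro x hx
    exact hx.1.1
  · intro x hx
    have hx' : 0 < 1 + form n ν (p.coord.symm x : CSpace n) (p.coord.symm x) := hx.1.1
    change q.coord (q.proj (incl (p.chart.symm x))) = _
    have : p.chart.symm x = ⟨p.lift (p.coord.symm x), p.form_lift _ hx'.le⟩ := dif_pos hx'.le
    rw [this]

end PseudoSphere

/-! ### Complex projective space and its indefinite duals -/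

/-- Complex projective space `ℂP^{n-1}`, the space of complex lines in `ℂ^n`. -/
abbrev CProj (n : ℕ) := ℙ ℂ (CSpace n)

namespace CProj

variable {n : ℕ}

/-- The quotient topology. -/
instance : TopologicalSpace (CProj n) :=
  inferInstanceAs (TopologicalSpace (Quotient (projectivizationSetoid ℂ (CSpace n))))

theorem isOpenQuotientMap_mk' : IsOpenQuotientMap
    (Projectivization.mk' ℂ : {v : CSpace n // v ≠ 0} → CProj n) := by
  refine ⟨Quotient.mk_surjective, continuous_quot_mk, fun U hU => ?_⟩
  have hp : (Projectivization.mk' ℂ : {v : CSpace n // v ≠ 0} → CProj n) ⁻¹'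
      (Projectivization.mk' ℂ '' U) =
      ⋃ a : ℂˣ, (fun v : {v : CSpace n // v ≠ 0} =>
        (⟨(a : ℂ) • (v : CSpace n), smul_ne_zero a.ne_zero v.2⟩ : {v : CSpace n // v ≠ 0})) ⁻¹' U := by
    ext v
    simp only [Set.mem_preimage, Set.mem_image, Set.mem_iUnion]
    constructor
    · rintro ⟨u, hu, huv⟩
      obtain ⟨a, ha⟩ := (Projectivization.mk_eq_mk_iff ℂ (u : CSpace n) v u.2 v.2).1 huv
      exact ⟨a, by convert hu using 1; exact Subtype.ext ha⟩
    · rintro ⟨a, ha⟩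
      exact ⟨_, ha, (Projectivization.mk_eq_mk_iff ℂ _ _ _ _).2 ⟨a, rfl⟩⟩
  change IsOpen ((Projectivization.mk' ℂ : {v : CSpace n // v ≠ 0} → CProj n) ⁻¹'
      (Projectivization.mk' ℂ '' U))
  rw [hp]
  refine isOpen_iUnion fun a => hU.preimage ?_
  exact Continuous.subtype_mk (continuous_subtype_val.const_smul (a : ℂ)) _

/-- The hyperplane `v^⊥`, for the positive definite Hermitian inner product, where `v` is
a representative of the line `p`. -/
abbrev perp (p : CProj n) : Submodule ℂ (CSpace n) := (ℂ ∙ p.rep)ᗮ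

theorem finrank_perp (p : CProj n) :
    Module.finrank ℂ p.perp = Module.finrank ℂ (CSpace (n - 1)) := by
  have hn : n ≠ 0 := by
    rintro rfl
    exact p.rep_nonzero (Subsingleton.elim _ _)
  have : Fact (Module.finrank ℂ (CSpace n) = (n - 1) + 1) :=
    ⟨by rw [finrank_euclideanSpace_fin]; omega⟩
  rw [Submodule.finrank_orthogonal_span_singleton (n := n - 1) p.rep_nonzero, finrank_euclideanSpace_fin]

/-- A linear coordinate system on the hyperplane `v^⊥`. -/
def coord (p : CProj n) : p.perp ≃L[ℂ] CSpace (n - 1) :=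
  ContinuousLinearEquiv.ofFinrankEq p.finrank_perp

/-- The multiple `z ↦ (⟨v, v⟩ / ⟨v, z⟩) z` of `z` lying in the affine hyperplane `v + v^⊥`. -/
def normalize (p : CProj n) (z : CSpace n) : CSpace n :=
  (inner ℂ p.rep p.rep / inner ℂ p.rep z) • z

theorem normalize_smul (p : CProj n) (a : ℂˣ) (z : CSpace n) :
    p.normalize ((a : ℂ) • z) = p.normalize z := by
  have ha := a.ne_zero
  simp only [normalize, inner_smul_right, smul_smul]
  congr 1
  by_cases h : inner ℂ p.rep z = 0
  · simp [h]
  · field_simp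

/-- The local section `[z] ↦ (⟨v, v⟩ / ⟨v, z⟩) z` of the tautological projection
`ℂ^n ∖ {0} → ℂP^{n-1}`, defined near the line `p = [v]` and taking `p` to `v`. -/
def section_ (p : CProj n) : CProj n → CSpace n :=
  Projectivization.lift (fun v => p.normalize v) (by
    rintro ⟨a, ha⟩ ⟨b, hb⟩ t ht
    have ht0 : t ≠ 0 := by
      rintro rfl
      simp only [zero_smul] at ht
      exact ha ht
    simp only at ht ⊢
    rw [ht]
    exact p.normalize_smul (Units.mk0 t ht0) b)

theorem section_mk' (p : CProj n) (v : {v : CSpace n // v ≠ 0}) :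
    p.section_ (Projectivization.mk' ℂ v) = p.normalize v := rfl

theorem inner_rep_self_ne_zero (p : CProj n) : inner ℂ p.rep p.rep ≠ 0 :=
  inner_self_ne_zero.2 p.rep_nonzero

/-- The affine domain `{[z] : ⟨v, z⟩ ≠ 0}`. -/
def affine (p : CProj n) : Set (CProj n) := {q | inner ℂ p.rep q.rep ≠ 0}

theorem mk'_mem_affine (p : CProj n) (v : {v : CSpace n // v ≠ 0}) :
    Projectivization.mk' ℂ v ∈ p.affine ↔ inner ℂ p.rep (v : CSpace n) ≠ 0 := by
  obtain ⟨a, ha⟩ := Projectivization.exists_smul_eq_mk_rep ℂ (v : CSpace n) v.2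
  change inner ℂ p.rep (Projectivization.mk ℂ (v : CSpace n) v.2).rep ≠ 0 ↔ _
  rw [← ha, Units.smul_def, inner_smul_right]
  simp

theorem isOpen_affine (p : CProj n) : IsOpen p.affine := by
  rw [← isOpenQuotientMap_mk'.isQuotientMap.isOpen_preimage]
  have : (Projectivization.mk' ℂ : {v : CSpace n // v ≠ 0} → CProj n) ⁻¹' p.affine =
      {v : {v : CSpace n // v ≠ 0} | inner ℂ p.rep (v : CSpace n) ≠ 0} := by
    ext v
    exact p.mk'_mem_affine v
  rw [this]
  exact isOpen_ne_fun (continuous_const.inner continuous_subtype_val) continuous_const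

theorem continuousOn_section (p : CProj n) : ContinuousOn p.section_ p.affine := by
  rw [isOpenQuotientMap_mk'.isQuotientMap.continuousOn_isOpen_iff p.isOpen_affine]
  have : p.section_ ∘ (Projectivization.mk' ℂ) =
      fun v : {v : CSpace n // v ≠ 0} => p.normalize v := rfl
  rw [this]
  have h1 : Continuous fun v : {v : CSpace n // v ≠ 0} => inner ℂ p.rep (v : CSpace n) :=
    continuous_const.inner continuous_subtype_val
  have h2 : Continuous fun v : {v : CSpace n // v ≠ 0} => (v : CSpace n) := continuous_subtype_val
  refine ContinuousOn.smul (ContinuousOn.div continuousOn_const h1.continuousOn ?_)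
    h2.continuousOn
  · intro v hv
    exact (p.mk'_mem_affine v).1 hv

/-- The orthogonal projection of `ℂ^n` onto `v^⊥`. -/
def proj (p : CProj n) : CSpace n →L[ℂ] p.perp := p.perp.orthogonalProjectionOnto

theorem proj_rep (p : CProj n) : p.proj p.rep = 0 :=
  Submodule.orthogonalProjectionOnto_orthogonalComplement_singleton_eq_zero p.rep

theorem proj_perp (p : CProj n) (y : p.perp) : p.proj y = y :=
  Submodule.orthogonalProjectionOnto_mem_subspace_eq_self y

theorem inner_rep_perp (p : CProj n) (y : p.perp) : inner ℂ p.rep (y : CSpace n) = 0 :=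
  Submodule.mem_orthogonal_singleton_iff_inner_right.1 y.2

theorem inner_rep_add (p : CProj n) (y : p.perp) :
    inner ℂ p.rep (p.rep + y : CSpace n) = inner ℂ p.rep p.rep := by
  rw [inner_add_right, inner_rep_perp, add_zero]

theorem rep_add_ne_zero (p : CProj n) (y : p.perp) : (p.rep + y : CSpace n) ≠ 0 := by
  intro h
  have := p.inner_rep_add y
  rw [h, inner_zero_right] at this
  exact p.inner_rep_self_ne_zero this.symm

theorem normalize_rep_add (p : CProj n) (y : p.perp) :
    p.normalize (p.rep + y) = p.rep + y := by
  rw [normalize, inner_rep_add, div_self p.inner_rep_self_ne_zero, one_smul]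

theorem normalize_eq (p : CProj n) (z : CSpace n) (hz : inner ℂ p.rep z ≠ 0) :
    p.rep + p.proj (p.normalize z) = p.normalize z := by
  have hmem : p.normalize z - p.rep ∈ p.perp := by
    rw [Submodule.mem_orthogonal_singleton_iff_inner_right, inner_sub_right, normalize,
      inner_smul_right, div_mul_cancel₀ _ hz, sub_self]
  have h : p.normalize z = p.rep + ((⟨_, hmem⟩ : p.perp) : CSpace n) := by simp
  conv_lhs => rw [h, map_add, proj_rep, proj_perp, zero_add]
  exact h.symm

/-- The affine chart of projective space at `p = [v]`: the line `[z]` with `⟨v, z⟩ ≠ 0` goes to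
the point `y` of `v^⊥` such that `[z] = [v + y]`. -/
def chart (p : CProj n) : OpenPartialHomeomorph (CProj n) (CSpace (n - 1)) where
  toFun q := p.coord (p.proj (p.section_ q))
  invFun x := Projectivization.mk ℂ (p.rep + p.coord.symm x) (p.rep_add_ne_zero _)
  source := p.affine
  target := Set.univ
  map_source' _ _ := Set.mem_univ _
  map_target' x _ := by
    refine (p.mk'_mem_affine ⟨_, p.rep_add_ne_zero (p.coord.symm x)⟩).2 ?_
    rw [inner_rep_add]
    exact p.inner_rep_self_ne_zero
  left_inv' q hq := by
    obtain ⟨v, rfl⟩ := isOpenQuotientMap_mk'.surjective q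
    have hv := (p.mk'_mem_affine v).1 hq
    simp only [ContinuousLinearEquiv.symm_apply_apply, section_mk', normalize_eq p _ hv]
    refine (Projectivization.mk_eq_mk_iff' ℂ _ _ _ _).2 ⟨_, rfl⟩
  right_inv' x _ := by
    change p.coord (p.proj (p.normalize (p.rep + p.coord.symm x))) = x
    rw [normalize_rep_add, map_add, proj_rep, proj_perp, zero_add,
      ContinuousLinearEquiv.apply_symm_apply]
  open_source := p.isOpen_affine
  open_target := isOpen_univ
  continuousOn_toFun := by
    exact (p.coord.continuous.comp p.proj.continuous).comp_continuousOn p.continuousOn_section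
  continuousOn_invFun := by
    refine Continuous.continuousOn ?_
    refine isOpenQuotientMap_mk'.continuous.comp (Continuous.subtype_mk ?_ _)
    exact continuous_const.add (continuous_subtype_val.comp p.coord.symm.continuous)

instance : ChartedSpace (CSpace (n - 1)) (CProj n) where
  atlas := Set.range chart
  chartAt := chart
  mem_chart_source p := p.inner_rep_self_ne_zero
  chart_mem_atlas p := ⟨p, rfl⟩

instance : IsManifold 𝓘(ℝ, CSpace (n - 1)) ∞ (CProj n) := by
  refine isManifold_of_contDiffOn _ _ _ ?_
  rintro _ _ ⟨p, rfl⟩ ⟨q, rfl⟩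
  have hs : ContDiff ℝ ∞ fun x : CSpace (n - 1) => (p.rep + p.coord.symm x : CSpace n) := by
    refine contDiff_const.add ?_
    exact ((p.perp.subtypeL.comp (p.coord.symm : CSpace (n - 1) →L[ℂ] p.perp)).restrictScalars
      ℝ).contDiff
  have hi : ContDiff ℝ ∞ fun x : CSpace (n - 1) =>
      inner ℂ q.rep (p.rep + p.coord.symm x : CSpace n) :=
    ((innerSL ℂ q.rep).restrictScalars ℝ).contDiff.comp hs
  have hl : ContDiff ℝ ∞ fun z : CSpace n => q.coord (q.proj z) :=
    (((q.coord : q.perp →L[ℂ] CSpace (n - 1)).comp q.proj).restrictScalars ℝ).contDiff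
  have hsrc : ∀ x ∈ (𝓘(ℝ, CSpace (n - 1)).symm ⁻¹' (p.chart.symm ≫ₕ q.chart).source ∩
      Set.range 𝓘(ℝ, CSpace (n - 1))), inner ℂ q.rep (p.rep + p.coord.symm x : CSpace n) ≠ 0 := by
    intro x hx
    exact (q.mk'_mem_affine ⟨_, p.rep_add_ne_zero (p.coord.symm x)⟩).1 hx.1.2
  change ContDiffOn ℝ ∞ (fun x : CSpace (n - 1) =>
    q.coord (q.proj (q.normalize (p.rep + p.coord.symm x)))) _
  refine hl.comp_contDiffOn ?_
  unfold normalize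
  simp only [div_eq_mul_inv]
  exact ContDiffOn.fun_smul (contDiffOn_const.mul (hi.contDiffOn.inv hsrc)) hs.contDiffOn

/-- The bilinear form
`c (B(v,v) B(X,Y) - B(v,X) B(v,Y) - B(iv,X) B(iv,Y)) / B(v,v)^2` on `ℂ^n`, where `B = form n ν`.
It has kernel `ℂ v`, and if `B(v,v) = c = ±1` it is `B` on the `B`-orthogonal complement of
`ℂ v`. -/
def fubiniStudyForm (c : ℝ) (ν : ℕ) (v : CSpace n) : LinearMap.BilinForm ℝ (CSpace n) :=
  (c / form n ν v v ^ 2) • (form n ν v v • form n ν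
    - LinearMap.BilinForm.linMulLin (form n ν v) (form n ν v)
    - LinearMap.BilinForm.linMulLin (form n ν (mulI n v)) (form n ν (mulI n v)))

/-- The Fubini-Study metric on the lines on which `form n ν` has the sign `c = ±1`:
`g(dπ X, dπ Y) = fubiniStudyForm c ν v X Y` for `π : v ↦ [v]`, where tangent vectors of projective
space are lifted to `ℂ^n` by the derivative of a local section of `π`. -/
def fubiniStudy (c : ℝ) (ν : ℕ) : BilinField 𝓘(ℝ, CSpace (n - 1)) (CProj n) := fun p =>
  LinearMap.compl₁₂ (fubiniStudyForm c ν p.rep)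
    (mfderiv 𝓘(ℝ, CSpace (n - 1)) 𝓘(ℝ, CSpace n) p.section_ p).toLinearMap
    (mfderiv 𝓘(ℝ, CSpace (n - 1)) 𝓘(ℝ, CSpace n) p.section_ p).toLinearMap

theorem form_rep_neg_iff (ν : ℕ) (v : {v : CSpace n // v ≠ 0}) :
    form n ν (Projectivization.mk' ℂ v : CProj n).rep (Projectivization.mk' ℂ v : CProj n).rep < 0
      ↔ form n ν (v : CSpace n) v < 0 := by
  obtain ⟨a, ha⟩ := Projectivization.exists_smul_eq_mk_rep ℂ (v : CSpace n) v.2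
  change form n ν (Projectivization.mk ℂ (v : CSpace n) v.2).rep
    (Projectivization.mk ℂ (v : CSpace n) v.2).rep < 0 ↔ _
  rw [← ha, Units.smul_def, form_smul_smul]
  have hpos := Complex.normSq_pos.2 a.ne_zero
  constructor
  · intro h
    by_contra h'
    exact absurd h (not_lt.2 (mul_nonneg hpos.le (not_lt.1 h')))
  · intro h
    exact mul_neg_of_pos_of_neg hpos h

/-- The open subset of projective space consisting of the lines on which `form n ν` is negative. -/
def negLines (n ν : ℕ) : TopologicalSpace.Opens (CProj n) where
  carrier := {p | form n ν p.rep p.rep < 0}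
  is_open' := by
    rw [← isOpenQuotientMap_mk'.isQuotientMap.isOpen_preimage]
    have : (Projectivization.mk' ℂ : {v : CSpace n // v ≠ 0} → CProj n) ⁻¹'
        {p | form n ν p.rep p.rep < 0} =
        {v : {v : CSpace n // v ≠ 0} | form n ν (v : CSpace n) v < 0} := by
      ext v
      exact form_rep_neg_iff ν v
    rw [this]
    have h2 : Continuous fun v : {v : CSpace n // v ≠ 0} => (v : CSpace n) :=
      continuous_subtype_val
    exact isOpen_lt ((contDiff_form n ν).continuous.comp (h2.prodMk h2)) continuous_const

end CProj

/-- The indefinite dual of `ℂP^{n-1}`: the manifold of the lines in `ℂ^n` on which `form n ν` is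
negative. It is the quotient of the pseudo-sphere by the unit complex numbers. -/
abbrev CProjDual (n ν : ℕ) := CProj.negLines n ν

/-- The metric of `CProjDual n ν`. -/
def dualFubiniStudy (n ν : ℕ) : BilinField 𝓘(ℝ, CSpace (n - 1)) (CProjDual n ν) :=
  pullback 𝓘(ℝ, CSpace (n - 1)) 𝓘(ℝ, CSpace (n - 1)) (fun p : CProjDual n ν => (p : CProj n))
    (CProj.fubiniStudy (-1) ν)

/-! ### Circle actions -/

/-- The unit complex numbers act on the unit sphere by complex multiplication. -/
instance (n : ℕ) : MulAction Circle (USphere n) where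
  smul a z := ⟨(a : ℂ) • (z : CSpace n), by
    have hz : ‖(z : CSpace n)‖ = 1 := by simp
    simp [norm_smul, hz, Circle.norm_coe]⟩
  one_smul z := Subtype.ext (by
    change ((1 : Circle) : ℂ) • (z : CSpace n) = z
    simp)
  mul_smul a b z := Subtype.ext (by
    change ((a * b : Circle) : ℂ) • (z : CSpace n) = (a : ℂ) • (b : ℂ) • (z : CSpace n)
    simp [mul_smul])

/-- The unit complex numbers act on the pseudo-sphere by complex multiplication. -/
instance (n ν : ℕ) : MulAction Circle (PseudoSphere n ν) where
  smul a z := ⟨(a : ℂ) • z.incl, by rw [form_smul_smul, z.incl_spec]; simp⟩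
  one_smul z := PseudoSphere.ext (by
    change ((1 : Circle) : ℂ) • z.incl = z.incl
    simp)
  mul_smul a b z := PseudoSphere.ext (by
    change ((a * b : Circle) : ℂ) • z.incl = (a : ℂ) • (b : ℂ) • z.incl
    simp [mul_smul])

section Actions

variable (N : Type*) [MulAction Circle N]

/-- `S^1` acts on `S^1 × N` by complex multiplication on `S^1` and trivially on `N`. -/
abbrev actFirst (N : Type*) : MulAction Circle (Circle × N) where
  smul a x := (a * x.1, x.2)
  one_smul x := Prod.ext (one_mul x.1) rfl
  mul_smul a b x := Prod.ext (mul_assoc a b x.1) rfl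

/-- `S^1` acts on `S^1 × N` trivially on `S^1` and by the given action on `N`. -/
abbrev actSecond : MulAction Circle (Circle × N) where
  smul a x := (x.1, a • x.2)
  one_smul x := Prod.ext rfl (one_smul _ x.2)
  mul_smul a b x := Prod.ext rfl (mul_smul a b x.2)

/-- The product action of `S^1 × S^1` on `S^1 × N`. -/
abbrev actProduct : MulAction (Circle × Circle) (Circle × N) where
  smul a x := (a.1 * x.1, a.2 • x.2)
  one_smul x := Prod.ext (one_mul x.1) (one_smul _ x.2)
  mul_smul a b x := Prod.ext (mul_assoc a.1 b.1 x.1) (mul_smul a.2 b.2 x.2)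

end Actions

/-- The projection of the unit sphere to projective space. -/
def hopf (n : ℕ) (z : USphere n) : CProj n :=
  Projectivization.mk ℂ (z : CSpace n) (by
    intro h
    have hz : ‖(z : CSpace n)‖ = 1 := by simp
    simp [h] at hz)

theorem PseudoSphere.incl_ne_zero {n ν : ℕ} (z : PseudoSphere n ν) : z.incl ≠ 0 := by
  intro h
  have := z.incl_spec
  simp [h] at this

/-- The projection of the pseudo-sphere to the indefinite dual of projective space. -/
def hopfDual (n ν : ℕ) (z : PseudoSphere n ν) : CProjDual n ν :=
  ⟨Projectivization.mk ℂ z.incl z.incl_ne_zero,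
    (CProj.form_rep_neg_iff ν ⟨z.incl, z.incl_ne_zero⟩).2 (by
      change form n ν z.incl z.incl < 0
      rw [z.incl_spec]
      norm_num)⟩

/-! ### The total space `M = S^1 × N` -/

/-- The metric `c dθ^2` on the circle. -/
def circleMetric (c : ℝ) : BilinField (𝓡 1) Circle :=
  induced (𝓡 1) (fun a : Circle => (a : ℂ)) (c • innerₗ ℂ)

section Total

variable {n : ℕ} {E : Type*} [NormedAddCommGroup E] [NormedSpace ℝ E]
  {H : Type*} [TopologicalSpace H] (I : ModelWithCorners ℝ E H)
  {N : Type*} [TopologicalSpace N] [ChartedSpace H N]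

/-- The 1-form `dθ` on `M = S^1 × N`, dual to the unit vector field `∂_θ = i θ` of `S^1 ⊆ ℂ`:
the coefficient of `i θ` in `u ∈ T_θ S^1` is `Im (conj θ * u)`. -/
def dTheta (x : Circle × N) : TangentSpace ((𝓡 1).prod I) x →L[ℝ] ℝ :=
  (Complex.imCLM ∘L ContinuousLinearMap.mul ℝ ℂ (starRingEnd ℂ (x.1 : ℂ))) ∘L
    mfderiv ((𝓡 1).prod I) 𝓘(ℝ, ℂ) (fun y : Circle × N => (y.1 : ℂ)) x

/-- The derivative of `(θ, Θ) ↦ Θ`, for `N ⊆ ℂ^n` with inclusion `incl`. -/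
def dIncl (incl : N → CSpace n) (x : Circle × N) :
    TangentSpace ((𝓡 1).prod I) x →L[ℝ] CSpace n :=
  mfderiv ((𝓡 1).prod I) 𝓘(ℝ, CSpace n) (fun y : Circle × N => incl y.2) x

/-- For `N ⊆ ℂ^n` with inclusion `incl`, the map `Ξ : TM → ℂ^n` on `M = S^1 × N` which sends
the unit vector field `∂_θ` at `(θ, Θ)` to the normal vector `Θ` and is the inclusion on `TN`. -/
def Xi (incl : N → CSpace n) (x : Circle × N) :
    TangentSpace ((𝓡 1).prod I) x →L[ℝ] CSpace n :=
  (dTheta I x).smulRight (incl x.2) + dIncl I incl x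

/-- The field of endomorphisms `J = Ξ⁻¹ ∘ A ∘ Ξ` of `TM` corresponding under `Ξ` to a fixed
endomorphism `A` of `ℂ^n`. -/
def XiConj (incl : N → CSpace n) (A : CSpace n →L[ℝ] CSpace n) :
    EndField ((𝓡 1).prod I) (Circle × N) := fun x =>
  (Xi I incl x).inverse ∘L A ∘L Xi I incl x

/-- `Ξ` is an isometric linear isomorphism of every tangent space with `(ℂ^n, form n ν)`. -/
def XiIsometry (ν : ℕ) (incl : N → CSpace n)
    (g : BilinField ((𝓡 1).prod I) (Circle × N)) : Prop :=
  ∀ x, Function.Bijective (Xi I incl x) ∧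
    ∀ X Y, form n ν (Xi I incl x X) (Xi I incl x Y) = g x X Y

end Total

/-- The inclusion of the unit sphere. -/
def sphereIncl (n : ℕ) (z : USphere n) : CSpace n := z

/-- The round metric of the unit sphere. -/
def sphereMetric (n : ℕ) [NeZero n] : BilinField (𝓡 (2 * n - 1)) (USphere n) :=
  induced (𝓡 (2 * n - 1)) (sphereIncl n) (form n 0)

/-- The metric induced on the pseudo-sphere. -/
def pseudoSphereMetric (n ν : ℕ) : BilinField (𝓡 (2 * n - 1)) (PseudoSphere n ν) :=
  induced (𝓡 (2 * n - 1)) PseudoSphere.incl (form n ν)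

/-- The product metric `dθ^2 ⊕ g` on `S^1 × S^{2n-1}`. -/
def totalMetric (n : ℕ) [NeZero n] :
    BilinField ((𝓡 1).prod (𝓡 (2 * n - 1))) (Circle × USphere n) :=
  prodMetric (𝓡 1) (𝓡 (2 * n - 1)) (circleMetric 1) (sphereMetric n)

/-- The endomorphism `Ξ⁻¹ ∘ A ∘ Ξ` of the tangent bundle of `S^1 × S^{2n-1}`. -/
def totalJ (n : ℕ) [NeZero n] (A : CSpace n →L[ℝ] CSpace n) :
    EndField ((𝓡 1).prod (𝓡 (2 * n - 1))) (Circle × USphere n) :=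
  XiConj (𝓡 (2 * n - 1)) (sphereIncl n) A

/-- The product metric `-dθ^2 ⊕ g` on `S^1 × N`, with `N` the pseudo-sphere. The circle is negative
definite, like the normal bundle of the pseudo-sphere. -/
def pseudoTotalMetric (n ν : ℕ) :
    BilinField ((𝓡 1).prod (𝓡 (2 * n - 1))) (Circle × PseudoSphere n ν) :=
  prodMetric (𝓡 1) (𝓡 (2 * n - 1)) (circleMetric (-1)) (pseudoSphereMetric n ν)

/-- The endomorphism `Ξ⁻¹ ∘ A ∘ Ξ` of the tangent bundle of `S^1 × N`, with `N` the
pseudo-sphere. -/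
def pseudoTotalJ (n ν : ℕ) (A : CSpace n →L[ℝ] CSpace n) :
    EndField ((𝓡 1).prod (𝓡 (2 * n - 1))) (Circle × PseudoSphere n ν) :=
  XiConj (𝓡 (2 * n - 1)) PseudoSphere.incl A

end AntiInvariant

open AntiInvariant

namespace AntiInvariant

/-! ### Smooth vector fields and Lie brackets through maps to a vector space -/

section VectorFields

open ContinuousLinearMap VectorField

variable {E : Type*} [NormedAddCommGroup E] [NormedSpace ℝ E]
  {H : Type*} [TopologicalSpace H] {I : ModelWithCorners ℝ E H}
  {E' : Type*} [NormedAddCommGroup E'] [NormedSpace ℝ E']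
  {H' : Type*} [TopologicalSpace H'] {I' : ModelWithCorners ℝ E' H'}
  {W : Type*} [NormedAddCommGroup W] [NormedSpace ℝ W]
  {W' : Type*} [NormedAddCommGroup W'] [NormedSpace ℝ W']
  {M : Type*} [TopologicalSpace M] [ChartedSpace H M]
  {M' : Type*} [TopologicalSpace M'] [ChartedSpace H' M']

/-! Both total spaces are treated at once: `N` is a quadric `{B(z, z) = c}` in `ℂ^n` with `c = ±1`
(`IsQuadric`). Since `TN` at `Θ` is the `B`-orthogonal complement of `Θ` and `B(Θ, Θ) = c`, the
decomposition `ℂ^n = ℝΘ ⊕ Θ^⊥` shows that `Ξ` is an isometry of `c dθ² ⊕ g_N` with `B`; a dimension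
count gives bijectivity. Pointwise questions about `M` thereby become linear algebra in `(ℂ^n, B)`.

Integrability is the one condition on `J` that is not pointwise. The local map `F(θ, Θ) = e^{arg θ}
Θ`, polar coordinates with `arg θ` as logarithmic radius, has derivative `e^{arg θ} Ξ`
(`IsQuadric.exists_potential`). The conformal factor commutes with `A`, so `F` is a local chart in
which `J` is the constant endomorphism `A`. Constant structures are integrable
(`isIntegrable_of_constant`), because differentiation commutes with `A` and Lie brackets are
commutators of derivatives. The same chart shows that `J` is smooth. Hence every `B`-orthogonal `A`
with `A² = -1` yields a pseudo-Hermitian structure.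

For the submersions, let `P = Ξ(𝒱)`. It is `ℝΘ` for `M → N`, `ℝ iΘ` for `M → S^1 × N'`, and their
sum for `M → N'`. By `IsQuadric.isAntiInvariant` it remains to see that `B` is nondegenerate on `P`,
that `A P ⟂ P`, and that the base metric agrees with `B` on `P^⊥`. An orthogonal `A` with `A² = -1`
is skew, so `B(Av, v) = 0`, which settles one-dimensional fibres. For two-dimensional fibres one
also needs `B(jΘ, iΘ) = 0`, which follows from the anticommutation of `i` and `j`; `j` preserves `B`
because, `ν` being even, both complex coordinates of a quaternion carry the same sign.

The Fubini–Study form kills `ℂv`, is invariant under rescaling `v`, and equals `B` on vectors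
orthogonal to `ℂv` when `B(v, v) = c`. Consequently any local lift of a map to projective space
computes the metric (`CProj.fubiniStudy_mfderiv`). The inclusion of `N` is such a lift of `N → N'`,
and with horizontal lifts (`IsHopf.exists_horizontal`) this gives both the isometry property and the
nondegeneracy of the base metric. -/

theorem mvfderiv_comp_mfderiv_apply {f : M' → W} {g : M → M'} {p : M}
    (hf : MDifferentiableAt I' 𝓘(ℝ, W) f (g p)) (hg : MDifferentiableAt I I' g p)
    (X : TangentSpace I p) :
    mvfderiv I (fun q => f (g q)) p X = mvfderiv I' f (g p) (mfderiv I I' g p X) := by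
  have := mfderiv_comp p hf hg
  exact congrArg (fun L : TangentSpace I p →L[ℝ] W => L X) this

theorem mvfderiv_fderiv_comp_apply {f : W → W'} {g : M → W} {p : M}
    (hf : DifferentiableAt ℝ f (g p)) (hg : MDifferentiableAt I 𝓘(ℝ, W) g p)
    (X : TangentSpace I p) :
    mvfderiv I (fun q => f (g q)) p X = fderiv ℝ f (g p) (mvfderiv I g p X) := by
  have := mfderiv_comp p hf.mdifferentiableAt hg
  rw [mfderiv_eq_fderiv] at this
  exact congrArg (fun L : TangentSpace I p →L[ℝ] W' => L X) this

theorem mvfderiv_clm_comp_apply (f : W →L[ℝ] W') {g : M → W} {p : M}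
    (hg : MDifferentiableAt I 𝓘(ℝ, W) g p) (X : TangentSpace I p) :
    mvfderiv I (fun q => f (g q)) p X = f (mvfderiv I g p X) := by
  rw [mvfderiv_fderiv_comp_apply f.differentiableAt hg, f.fderiv]

theorem mvfderiv_congr {f g : M → W} {p : M} (h : f =ᶠ[𝓝 p] g) :
    mvfderiv I f p = mvfderiv I g p := by
  ext X
  exact congrArg (fun L : TangentSpace I p →L[ℝ] W => L X) h.mfderiv_eq

/-- The derivative of a smooth vector-valued map along a smooth vector field is smooth. -/
theorem contMDiffAt_mvfderiv_apply [IsManifold I 1 M] {F : M → W} {X : VField I M} {p₀ : M}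
    (hF : ContMDiffAt I 𝓘(ℝ, W) ∞ F p₀)
    (hX : ContMDiffAt I I.tangent ∞ (fun p => (⟨p, X p⟩ : TangentBundle I M)) p₀) :
    ContMDiffAt I 𝓘(ℝ, W) ∞ (fun p => mvfderiv I F p (X p)) p₀ := by
  have h1 : ContMDiffAt I 𝓘(ℝ, W).tangent ∞
      (fun p => (⟨F p, mfderiv I 𝓘(ℝ, W) F p (X p)⟩ : TangentBundle 𝓘(ℝ, W) W)) p₀ :=
    ContMDiffAt.clm_apply_of_inCoordinates (b₁ := id) (b₂ := F)
      (ϕ := fun p => mfderiv I 𝓘(ℝ, W) F p) (v := X)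
      (hF.mfderiv_const (m := ∞) (by simp)) hX hF
  exact (contMDiff_snd_tangentBundle_modelSpace W 𝓘(ℝ, W)).contMDiffAt.comp p₀ h1

/-- A vector field is smooth if its image under a local diffeomorphism to a vector space is. -/
theorem contMDiffAt_of_mvfderiv_apply [CompleteSpace E] [IsManifold I 1 M] {F : M → W}
    {X : VField I M} {p₀ : M} (hF : ContMDiffAt I 𝓘(ℝ, W) ∞ F p₀)
    (hinv : (mvfderiv I F p₀).IsInvertible)
    (hX : ContMDiffAt I 𝓘(ℝ, W) ∞ (fun p => mvfderiv I F p (X p)) p₀) :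
    ContMDiffAt I I.tangent ∞ (fun p => (⟨p, X p⟩ : TangentBundle I M)) p₀ := by
  -- `dF` read in the trivialisations at `p₀` and `F p₀`: a map between fixed spaces, which can
  -- depend smoothly on the point and be inverted smoothly near `p₀`.
  let A : M → E →L[ℝ] W := fun p => inCoordinates
      E (TangentSpace I (M := M)) W (TangentSpace 𝓘(ℝ, W) (M := W))
      p₀ p (F p₀) (F p) (mfderiv I 𝓘(ℝ, W) F p)
  have hA : ContMDiffAt I 𝓘(ℝ, E →L[ℝ] W) ∞ A p₀ :=
    hF.mfderiv_const (m := ∞) (by simp)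
  have hAeq : ∀ p ∈ (trivializationAt E (TangentSpace I) p₀).baseSet, ∀ v : TangentSpace I p,
      A p (trivializationAt E (TangentSpace I) p₀ ⟨p, v⟩).2 = mvfderiv I F p v := by
    intro p hp v
    simp only [A]
    rw [inCoordinates_eq hp (Set.mem_univ (F p) :
      F p ∈ (trivializationAt W (TangentSpace 𝓘(ℝ, W)) (F p₀)).baseSet)]
    have h := (trivializationAt E (TangentSpace I) p₀).symm_apply_apply_mk hp v
    have h2 : ∀ w : W, (trivializationAt W (TangentSpace 𝓘(ℝ, W)) (F p₀)
        (⟨F p, w⟩ : TangentBundle 𝓘(ℝ, W) W)).2 = w := fun w => by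
      rw [trivializationAt_model_space_apply]
    exact (h2 _).trans (congrArg (mvfderiv I F p) h)
  have hinv' : (A p₀).IsInvertible := by
    simp only [A]
    rw [inCoordinates_eq (FiberBundle.mem_baseSet_trivializationAt' p₀)
      (FiberBundle.mem_baseSet_trivializationAt' (F p₀))]
    exact isInvertible_equiv.comp (ContinuousLinearMap.IsInvertible.comp (g := mfderiv I 𝓘(ℝ, W) F p₀) hinv isInvertible_equiv)
  have hA' := (hinv'.contDiffAt_map_inverse (n := ∞)).contMDiffAt.comp p₀ hA
  rw [Bundle.contMDiffAt_section]
  -- In the trivialisation, `X` is `A⁻¹` applied to the smooth function `dF(X)`, wherever `A` is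
  -- invertible; this is an open condition.
  refine (hA'.clm_apply hX).congr_of_eventuallyEq ?_
  have hopen : ∀ᶠ p in 𝓝 p₀, (A p).IsInvertible :=
    hA.continuousAt.eventually (ContinuousLinearEquiv.isOpen.mem_nhds hinv')
  filter_upwards [hopen, (trivializationAt E (TangentSpace I) p₀).open_baseSet.mem_nhds
    (FiberBundle.mem_baseSet_trivializationAt' p₀)] with p hp hbase
  rw [← hAeq p hbase]
  obtain ⟨e, he⟩ := hp
  simp [← he]

theorem mvfderiv_eq_fderiv_comp_extChartAt [I.Boundaryless] [IsManifold I 1 M] {a : M → W}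
    {p₀ p : M} (hp : p ∈ (extChartAt I p₀).source) (ha : MDifferentiableAt I 𝓘(ℝ, W) a p)
    (Z : TangentSpace I p) :
    mvfderiv I a p Z = fderiv ℝ (fun z => a ((extChartAt I p₀).symm z)) (extChartAt I p₀ p)
      (mvfderiv I (extChartAt I p₀) p Z) := by
  have hs := mdifferentiableWithinAt_extChartAt_symm (I := I)
    ((extChartAt I p₀).map_source hp)
  rw [I.range_eq_univ, mdifferentiableWithinAt_univ] at hs
  have hb : MDifferentiableAt 𝓘(ℝ, E) 𝓘(ℝ, W) (fun z => a ((extChartAt I p₀).symm z))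
      (extChartAt I p₀ p) := by
    refine MDifferentiableAt.comp (I' := I) _ ?_ hs
    rwa [(extChartAt I p₀).left_inv hp]
  have hφ : MDifferentiableAt I 𝓘(ℝ, E) (extChartAt I p₀) p :=
    mdifferentiableAt_extChartAt (by rwa [← extChartAt_source (I := I)])
  rw [← mvfderiv_fderiv_comp_apply hb.differentiableAt hφ]
  refine congrArg (fun L : _ →L[ℝ] W => L Z) (mvfderiv_congr ?_)
  filter_upwards [(isOpen_extChartAt_source p₀).mem_nhds hp] with q hq
  rw [(extChartAt I p₀).left_inv hq]

/-- The derivative of a vector-valued map along `[X, Y]` is the commutator of the derivatives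
along `X` and `Y`. -/
theorem mvfderiv_mlieBracket_apply [CompleteSpace E] [I.Boundaryless] [IsManifold I ∞ M]
    [IsManifold I 1 M]
    {F : M → W} {X Y : VField I M} {p₀ : M} (hF : ContMDiffAt I 𝓘(ℝ, W) ∞ F p₀)
    (hX : ContMDiffAt I I.tangent ∞ (fun p => (⟨p, X p⟩ : TangentBundle I M)) p₀)
    (hY : ContMDiffAt I I.tangent ∞ (fun p => (⟨p, Y p⟩ : TangentBundle I M)) p₀) :
    mvfderiv I F p₀ (mlieBracket I X Y p₀) =
      mvfderiv I (fun p => mvfderiv I F p (Y p)) p₀ (X p₀) -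
      mvfderiv I (fun p => mvfderiv I F p (X p)) p₀ (Y p₀) := by
  set φ := extChartAt I p₀ with hφ
  have hp₀ : p₀ ∈ φ.source := mem_extChartAt_source p₀
  have hφp : φ.symm (φ p₀) = p₀ := φ.left_inv hp₀
  have hsymm : ContMDiffAt 𝓘(ℝ, E) I ∞ φ.symm (φ p₀) := by
    have := contMDiffWithinAt_extChartAt_symm_range (n := ∞) (I := I) p₀
      (mem_extChartAt_target (I := I) p₀)
    rwa [I.range_eq_univ, contMDiffWithinAt_univ] at this
  have htgt : φ.target ∈ 𝓝 (φ p₀) := extChartAt_target_mem_nhds p₀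
  have hF' : ∀ᶠ p in 𝓝 p₀, MDifferentiableAt I 𝓘(ℝ, W) F p := by
    have h2 : ContMDiffAt I 𝓘(ℝ, W) 1 F p₀ := hF.of_le (by simp)
    filter_upwards [(contMDiffAt_iff_contMDiffAt_nhds (by simp)).1 h2] with p hp
    exact hp.mdifferentiableAt (by simp)
  have hev : ∀ {P : M → Prop}, (∀ᶠ p in 𝓝 p₀, P p) → ∀ᶠ z in 𝓝 (φ p₀), P (φ.symm z) := by
    intro P hP
    refine hsymm.continuousAt.eventually ?_
    rwa [hφp]
  have hcd : ∀ {a : M → W}, ContMDiffAt I 𝓘(ℝ, W) ∞ a p₀ →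
      ContDiffAt ℝ ∞ (fun z => a (φ.symm z)) (φ p₀) := by
    intro a ha
    refine ContMDiffAt.contDiffAt (ContMDiffAt.comp (I' := I) _ ?_ hsymm)
    rwa [hφp]
  -- The field read in the chart at `p₀`. Near `φ p₀` it is the pullback under `φ.symm` that enters
  -- the definition of the manifold bracket.
  let lift : VField I M → E → E := fun X z => mvfderiv I φ (φ.symm z) (X (φ.symm z))
  have hlift : ∀ X : VField I M, mpullbackWithin 𝓘(ℝ, E) I φ.symm X (Set.range I)
      =ᶠ[𝓝 (φ p₀)] lift X := by
    intro X
    filter_upwards [htgt] with z hz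
    refine (IsInvertible.inverse_apply_eq
      (isInvertible_mfderivWithin_extChartAt_symm hz)).2 ?_
    exact (congrArg (fun L : _ →L[ℝ] TangentSpace I (φ.symm z) => L (X (φ.symm z)))
      (mfderivWithin_extChartAt_symm_comp_mfderiv_extChartAt hz)).symm
  have hd : ∀ X : VField I M,
      ContMDiffAt I I.tangent ∞ (fun p => (⟨p, X p⟩ : TangentBundle I M)) p₀ →
      DifferentiableAt ℝ (lift X) (φ p₀) := by
    intro X hX
    have h1 : ContMDiffAt I 𝓘(ℝ, E) ∞ (fun p => mvfderiv I φ p (X p)) (φ.symm (φ p₀)) := by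
      rw [hφp]
      exact contMDiffAt_mvfderiv_apply contMDiffAt_extChartAt hX
    exact ((h1.comp (φ p₀) hsymm).contDiffAt).differentiableAt (by simp)
  have hder : ∀ X : VField I M,
      (fun z => fderiv ℝ (fun z => F (φ.symm z)) z (lift X z)) =ᶠ[𝓝 (φ p₀)]
        (fun z => mvfderiv I F (φ.symm z) (X (φ.symm z))) := by
    intro X
    filter_upwards [htgt, hev hF'] with z hz hFz
    rw [mvfderiv_eq_fderiv_comp_extChartAt (p₀ := p₀) (φ.map_target hz) hFz, φ.right_inv hz]
  have hbr : mvfderiv I φ p₀ (mlieBracket I X Y p₀) = lieBracket ℝ (lift X) (lift Y) (φ p₀) := by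
    have h := Filter.EventuallyEq.lieBracket_vectorField_eq (𝕜 := ℝ) (E := E) (hlift X) (hlift Y)
    have hs : φ.symm ⁻¹' Set.univ ∩ Set.range I = Set.univ := by simp [I.range_eq_univ]
    have hW : ∀ (A B : E → E) (s : Set E), s = Set.univ →
        lieBracketWithin ℝ A B s (φ p₀) = lieBracket ℝ A B (φ p₀) := by
      rintro A B s rfl
      rw [lieBracketWithin_univ]
    exact ((isInvertible_mfderiv_extChartAt (I := I) hp₀).inverse_apply_eq.1 rfl).symm.trans
      ((hW _ _ _ hs).trans h)
  have hcomp : ∀ a : M → W, MDifferentiableAt I 𝓘(ℝ, W) a p₀ → ∀ Z : VField I M,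
      fderiv ℝ (fun z => a (φ.symm z)) (φ p₀) (lift Z (φ p₀)) = mvfderiv I a p₀ (Z p₀) := by
    intro a ha Z
    rw [mvfderiv_eq_fderiv_comp_extChartAt hp₀ ha]
    simp only [lift]
    rw [hφp]
  -- The commutator formula in the model space, applied to `F` read in the chart, followed by
  -- translation of each directional derivative back to `M`.
  rw [mvfderiv_eq_fderiv_comp_extChartAt hp₀ hF'.self_of_nhds, hbr,
    fderiv_apply_lieBracket (n := ∞) (hcd hF) (by simp; norm_cast) (hd Y hY) (hd X hX),
    (hder X).fderiv_eq, (hder Y).fderiv_eq]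
  rw [hcomp (fun p => mvfderiv I F p (Y p))
      ((contMDiffAt_mvfderiv_apply hF hY).mdifferentiableAt (by simp)) X,
    hcomp (fun p => mvfderiv I F p (X p))
      ((contMDiffAt_mvfderiv_apply hF hX).mdifferentiableAt (by simp)) Y]

/-- An almost complex structure which is constant in local vector-valued coordinates is
integrable. -/
theorem isIntegrable_of_constant [CompleteSpace E] [I.Boundaryless] [IsManifold I ∞ M]
    [IsManifold I 1 M] {J : EndField I M} (A : W →L[ℝ] W)
    (h : ∀ p₀, ∃ F : M → W, ContMDiffAt I 𝓘(ℝ, W) ∞ F p₀ ∧ Function.Injective (mvfderiv I F p₀) ∧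
      ∀ᶠ p in 𝓝 p₀, ∀ X, mvfderiv I F p (J p X) = A (mvfderiv I F p X)) :
    IsIntegrable I J := by
  intro U hU A₁ B₁ A₂ B₂ hA₁ hB₁ hA₂ hB₂ h₁ h₂ p₀ hp₀
  obtain ⟨F, hF, hinj, hJ⟩ := h p₀
  have hA₁ := hA₁.contMDiffAt (hU.mem_nhds hp₀)
  have hB₁ := hB₁.contMDiffAt (hU.mem_nhds hp₀)
  have hA₂ := hA₂.contMDiffAt (hU.mem_nhds hp₀)
  have hB₂ := hB₂.contMDiffAt (hU.mem_nhds hp₀)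
  have hdiff : ∀ {X : VField I M},
      ContMDiffAt I I.tangent ∞ (fun p => (⟨p, X p⟩ : TangentBundle I M)) p₀ →
      MDifferentiableAt I 𝓘(ℝ, W) (fun p => mvfderiv I F p (X p)) p₀ := fun hX =>
    (contMDiffAt_mvfderiv_apply hF hX).mdifferentiableAt (by simp)
  -- On the functions `dF(C)` and `dF(D)` the type condition is a linear relation with constant
  -- coefficients `A`, valid near `p₀`; it may therefore be differentiated.
  have key : ∀ {C D : VField I M}, IsType10 I J U C D →
      ContMDiffAt I I.tangent ∞ (fun p => (⟨p, C p⟩ : TangentBundle I M)) p₀ →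
      ContMDiffAt I I.tangent ∞ (fun p => (⟨p, D p⟩ : TangentBundle I M)) p₀ →
      ∀ Z, A (mvfderiv I (fun p => mvfderiv I F p (C p)) p₀ Z) =
          - mvfderiv I (fun p => mvfderiv I F p (D p)) p₀ Z ∧
        A (mvfderiv I (fun p => mvfderiv I F p (D p)) p₀ Z) =
          mvfderiv I (fun p => mvfderiv I F p (C p)) p₀ Z := by
    intro C D hCD hC hD Z
    rw [← mvfderiv_clm_comp_apply A (hdiff hC), ← mvfderiv_clm_comp_apply A (hdiff hD),
      ← neg_apply, ← mvfderiv_fun_neg]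
    constructor
    · refine congrArg (fun L : _ →L[ℝ] W => L Z) (mvfderiv_congr ?_)
      filter_upwards [hJ, hU.mem_nhds hp₀] with p hp hpU
      rw [← hp, (hCD p hpU).1, map_neg]
    · refine congrArg (fun L : _ →L[ℝ] W => L Z) (mvfderiv_congr ?_)
      filter_upwards [hJ, hU.mem_nhds hp₀] with p hp hpU
      rw [← hp, (hCD p hpU).2]
  have k₁ := key h₁ hA₁ hB₁
  have k₂ := key h₂ hA₂ hB₂
  have hJ₀ := hJ.self_of_nhds
  -- After `dF`, each bracket is a difference of derivatives on which `A` acts by `k₁` and `k₂`, and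
  -- the eight terms match.
  constructor <;> apply hinj <;>
    simp only [hJ₀, Pi.add_apply, Pi.sub_apply, map_add, map_sub, map_neg,
      mvfderiv_mlieBracket_apply hF hA₁ hA₂, mvfderiv_mlieBracket_apply hF hB₁ hB₂,
      mvfderiv_mlieBracket_apply hF hA₁ hB₂, mvfderiv_mlieBracket_apply hF hB₁ hA₂, k₁, k₂] <;>
    abel

end VectorFields

/-! ### Linear algebra of the indefinite inner products -/

section Form

variable {n ν : ℕ}

theorem mulI_apply (z : CSpace n) : mulI n z = Complex.I • z := rfl

theorem mulI_mulI (z : CSpace n) : mulI n (mulI n z) = -z := by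
  rw [mulI_apply, mulI_apply, smul_smul, Complex.I_mul_I, neg_one_smul]

theorem form_mulI_mulI (z w : CSpace n) : form n ν (mulI n z) (mulI n w) = form n ν z w := by
  rw [mulI_apply, mulI_apply, form_smul_smul]
  simp

/-- An isometry squaring to `-1` is skew. -/
theorem form_skew {A : CSpace n →L[ℝ] CSpace n} (hsq : ∀ z, A (A z) = -z)
    (hA : ∀ z w, form n ν (A z) (A w) = form n ν z w) (z w : CSpace n) :
    form n ν (A z) w = -form n ν z (A w) := by
  rw [← hA (A z) w, hsq, map_neg, LinearMap.neg_apply]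

theorem form_skew_self {A : CSpace n →L[ℝ] CSpace n} (hsq : ∀ z, A (A z) = -z)
    (hA : ∀ z w, form n ν (A z) (A w) = form n ν z w) (z : CSpace n) :
    form n ν (A z) z = 0 := by
  have h := form_skew hsq hA z z
  rw [form_comm n ν z] at h
  linarith

theorem form_mulI_self (z : CSpace n) : form n ν (mulI n z) z = 0 :=
  form_skew_self mulI_mulI form_mulI_mulI z

theorem form_self_mulI (z : CSpace n) : form n ν z (mulI n z) = 0 := by
  rw [form_comm, form_mulI_self]

theorem complex_smul_eq (a : ℂ) (z : CSpace n) : a • z = a.re • z + a.im • mulI n z := by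
  rw [mulI_apply, ← Complex.coe_smul, ← Complex.coe_smul, smul_smul, ← add_smul,
    Complex.re_add_im]

theorem mulI_smul (a : ℂ) (z : CSpace n) : mulI n (a • z) = a • mulI n z := by
  rw [mulI_apply, mulI_apply, smul_comm]

theorem eq_zero_of_form_eq_zero {z : CSpace n} (h : ∀ w, form n ν z w = 0) : z = 0 := by
  ext k
  -- Testing against the `k`-th component of `z` leaves the single term `±|z_k|²`.
  have h1 := h (EuclideanSpace.single k (z k))
  rw [form_apply, Finset.sum_eq_single k] at h1
  · have hne : (if (k : ℕ) < ν then (-1 : ℝ) else 1) ≠ 0 := by split_ifs <;> norm_num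
    have h2 := (mul_eq_zero.1 h1).resolve_left hne
    simp only [PiLp.single_apply, if_true] at h2
    rw [← Complex.normSq_apply] at h2
    simpa using h2
  · intro j _ hj
    simp [hj]
  · simp

theorem form_zero_eq_inner (z w : CSpace n) : form n 0 z w = (inner ℂ z w).re := by
  rw [form_apply, PiLp.inner_apply, Complex.re_sum]
  refine Finset.sum_congr rfl fun k _ => ?_
  simp [mul_comm]

theorem form_zero_self (z : CSpace n) : form n 0 z z = ‖z‖ ^ 2 := by
  rw [form_zero_eq_inner, inner_self_eq_norm_sq_to_K]
  norm_cast

theorem form_zero_self_pos {z : CSpace n} (hz : z ≠ 0) : 0 < form n 0 z z := by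
  rw [form_zero_self]
  positivity

theorem contMDiffAt_form {E : Type*} [NormedAddCommGroup E] [NormedSpace ℝ E]
    {H : Type*} [TopologicalSpace H] {I : ModelWithCorners ℝ E H}
    {M : Type*} [TopologicalSpace M] [ChartedSpace H M] {f g : M → CSpace n} {p : M}
    (hf : ContMDiffAt I 𝓘(ℝ, CSpace n) ∞ f p) (hg : ContMDiffAt I 𝓘(ℝ, CSpace n) ∞ g p) :
    ContMDiffAt I 𝓘(ℝ, ℝ) ∞ (fun q => form n ν (f q) (g q)) p :=
  ((contDiff_form n ν).contMDiff.contMDiffAt).comp p (hf.prodMk_space hg)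

end Form

/-! ### Left multiplication by the quaternion `j` -/

section Quaternion

variable {ℓ ν : ℕ}

/-- The involution of the complex coordinates of `ℍ^ℓ` swapping the two coordinates of each
quaternion. -/
def swapPerm (ℓ : ℕ) : Equiv.Perm (Fin (2 * ℓ)) :=
  Function.Involutive.toPerm
    (fun k => if h : (k : ℕ) % 2 = 0 then ⟨k + 1, by omega⟩ else ⟨k - 1, by omega⟩) (by
      intro k
      by_cases h : (k : ℕ) % 2 = 0
      · have h' : ¬ ((k : ℕ) + 1) % 2 = 0 := by omega
        simp [h, h']
      · have h' : ((k : ℕ) - 1) % 2 = 0 := by omega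
        simp only [h, dite_false, h', dite_true]
        ext
        simp
        omega)

/-- From `j w = w̄ j` for complex `w` one gets `j (z₁ + z₂ j) = -z̄₂ + z̄₁ j`. In coordinates: swap
the two entries, conjugate, and change one sign. -/
theorem mulJ_apply (z : CSpace (2 * ℓ)) (k : Fin (2 * ℓ)) :
    mulJ ℓ z k = (if (k : ℕ) % 2 = 0 then -1 else 1) * starRingEnd ℂ (z (swapPerm ℓ k)) := by
  have h : mulJ ℓ z = (quatEquiv ℓ).symm ((fun _ : Fin ℓ => quatJ) * quatEquiv ℓ z) := rfl
  rw [h]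
  change (if (k : ℕ) % 2 = 0 then _ else _) = _
  have hsw : swapPerm ℓ k = if h : (k : ℕ) % 2 = 0 then ⟨k + 1, by omega⟩ else ⟨k - 1, by omega⟩ :=
    rfl
  rw [hsw]
  by_cases h : (k : ℕ) % 2 = 0
  · have h1 : (⟨2 * ((k : ℕ) / 2) + 1, by omega⟩ : Fin (2 * ℓ)) = ⟨k + 1, by omega⟩ := by
      ext; simp; omega
    simp only [h, if_true, dite_true]
    refine Complex.ext ?_ ?_
    · change (quatJ * quatEquiv ℓ z ⟨k / 2, by omega⟩).re = _
      rw [Quaternion.re_mul]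
      simp [quatEquiv_apply, quatJ, h1]
    · change (quatJ * quatEquiv ℓ z ⟨k / 2, by omega⟩).imI = _
      rw [Quaternion.imI_mul]
      simp [quatEquiv_apply, quatJ, h1]
  · have h1 : (⟨2 * ((k : ℕ) / 2), by omega⟩ : Fin (2 * ℓ)) = ⟨k - 1, by omega⟩ := by
      ext; simp; omega
    simp only [h, if_false, dite_false]
    refine Complex.ext ?_ ?_
    · change (quatJ * quatEquiv ℓ z ⟨k / 2, by omega⟩).imJ = _
      rw [Quaternion.imJ_mul]
      simp [quatEquiv_apply, quatJ, h1]
    · change (quatJ * quatEquiv ℓ z ⟨k / 2, by omega⟩).imK = _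
      rw [Quaternion.imK_mul]
      simp [quatEquiv_apply, quatJ, h1]

theorem swapPerm_swapPerm (k : Fin (2 * ℓ)) : swapPerm ℓ (swapPerm ℓ k) = k :=
  (swapPerm ℓ).left_inv k

theorem swapPerm_val (k : Fin (2 * ℓ)) :
    (swapPerm ℓ k : ℕ) = if (k : ℕ) % 2 = 0 then (k : ℕ) + 1 else (k : ℕ) - 1 := by
  change ((if h : (k : ℕ) % 2 = 0 then ⟨k + 1, by omega⟩ else ⟨k - 1, by omega⟩ : Fin (2 * ℓ)) : ℕ)
    = _
  split_ifs <;> rfl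

theorem mulJ_mulJ (z : CSpace (2 * ℓ)) : mulJ ℓ (mulJ ℓ z) = -z := by
  ext k
  rw [mulJ_apply, mulJ_apply, swapPerm_swapPerm, swapPerm_val]
  by_cases h : (k : ℕ) % 2 = 0
  · have h' : ¬ ((k : ℕ) + 1) % 2 = 0 := by omega
    simp [h, h']
  · have h' : ((k : ℕ) - 1) % 2 = 0 := by omega
    simp [h, h']

theorem mulJ_mulI (z : CSpace (2 * ℓ)) : mulJ ℓ (mulI _ z) = -mulI _ (mulJ ℓ z) := by
  ext k
  rw [mulI_apply, mulI_apply, PiLp.neg_apply, PiLp.smul_apply, mulJ_apply, mulJ_apply]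
  simp

/-- For even `ν` the negative coordinates form complete pairs, so the swap respects the signs of the
form; conjugation and signs applied to both arguments do not change the real products. -/
theorem form_mulJ_mulJ (hν : Even ν) (z w : CSpace (2 * ℓ)) :
    form (2 * ℓ) ν (mulJ ℓ z) (mulJ ℓ w) = form (2 * ℓ) ν z w := by
  rw [form_apply, form_apply, ← Equiv.sum_comp (swapPerm ℓ)]
  refine Finset.sum_congr rfl fun k _ => ?_
  have hs : ((swapPerm ℓ k : ℕ) < ν) ↔ ((k : ℕ) < ν) := by
    obtain ⟨m, rfl⟩ := hν
    rw [swapPerm_val]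
    split_ifs <;> omega
  rw [mulJ_apply, mulJ_apply, swapPerm_swapPerm]
  simp only [hs]
  congr 1
  split_ifs <;> simp

/-- Both `i` and `j` are skew. Moving each across the form expresses `B(ijz, z)` as `-B(jz, iz)`
and, by anticommutation, as `+B(jz, iz)`. -/
theorem form_mulJ_mulI_self (hν : Even ν) (z : CSpace (2 * ℓ)) :
    form (2 * ℓ) ν (mulJ ℓ z) (mulI _ z) = 0 := by
  have h1 := form_skew (ν := ν) mulI_mulI form_mulI_mulI (mulJ ℓ z) z
  have h2 := form_skew mulJ_mulJ (form_mulJ_mulJ hν) (mulI _ z) z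
  rw [mulJ_mulI, map_neg, LinearMap.neg_apply, form_comm _ _ (mulI _ z)] at h2
  linarith

end Quaternion

/-! ### The Fubini-Study form -/

namespace CProj

variable {n ν : ℕ} {c : ℝ}

theorem fubiniStudyForm_apply (v X Y : CSpace n) :
    fubiniStudyForm c ν v X Y = c / form n ν v v ^ 2 * (form n ν v v * form n ν X Y
      - form n ν v X * form n ν v Y - form n ν (mulI n v) X * form n ν (mulI n v) Y) := by
  simp [fubiniStudyForm, LinearMap.BilinForm.linMulLin_apply]

theorem fubiniStudyForm_comm (v X Y : CSpace n) :
    fubiniStudyForm c ν v X Y = fubiniStudyForm c ν v Y X := by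
  rw [fubiniStudyForm_apply, fubiniStudyForm_apply, form_comm n ν X]
  ring

/-- The vectors `v` and `iv` are `B`-orthogonal with the same square, so for `X = v` or `X = iv` the
first term cancels one of the subtracted ones. -/
theorem fubiniStudyForm_smul_self (v Y : CSpace n) (μ : ℂ) :
    fubiniStudyForm c ν v (μ • v) Y = 0 := by
  rw [fubiniStudyForm_apply, complex_smul_eq]
  simp only [map_add, map_smul, LinearMap.add_apply, LinearMap.smul_apply, smul_eq_mul,
    form_self_mulI, form_mulI_self, form_mulI_mulI]
  ring

theorem fubiniStudyForm_smul_smul {lam : ℂ} (hl : lam ≠ 0) (v X Y : CSpace n) :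
    fubiniStudyForm c ν (lam • v) (lam • X) (lam • Y) = fubiniStudyForm c ν v X Y := by
  have h : Complex.normSq lam ≠ 0 := by simpa using hl
  simp only [fubiniStudyForm_apply, mulI_smul, form_smul_smul]
  -- For a null `v` both sides are zero, division by zero being zero; otherwise numerator and
  -- denominator both scale by `|λ|⁴`.
  by_cases hv : form n ν v v = 0
  · simp [hv]
  · field_simp

/-- The Fubini-Study form is invariant under changes of the representative of a line. -/
theorem fubiniStudyForm_congr {lam : ℂ} (hl : lam ≠ 0) (v X Y : CSpace n) (μ μ' : ℂ) :
    fubiniStudyForm c ν (lam • v) (lam • X + μ • v) (lam • Y + μ' • v) =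
      fubiniStudyForm c ν v X Y := by
  have e : ∀ m : ℂ, m • v = (m * lam⁻¹) • (lam • v) := fun m => by
    rw [smul_smul, inv_mul_cancel_right₀ hl]
  rw [e μ, e μ', map_add, fubiniStudyForm_comm _ _ ((μ' * lam⁻¹) • lam • v),
    fubiniStudyForm_smul_self, add_zero, map_add, LinearMap.add_apply,
    fubiniStudyForm_smul_self, add_zero, fubiniStudyForm_smul_smul hl]

/-- On vectors orthogonal to the line the Fubini-Study form is the inner product. -/
theorem fubiniStudyForm_of_orthogonal {v X Y : CSpace n} (hc : c * c = 1)
    (hv : form n ν v v = c) (hX : form n ν v X = 0) (hX' : form n ν (mulI n v) X = 0) :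
    fubiniStudyForm c ν v X Y = form n ν X Y := by
  have : c ≠ 0 := by rintro rfl; simp at hc
  rw [fubiniStudyForm_apply, hX, hX', hv]
  field_simp
  ring

end CProj

/-! ### The circle -/

theorem contMDiff_circle_coe : ContMDiff (𝓡 1) 𝓘(ℝ, ℂ) ∞ (fun a : Circle => (a : ℂ)) :=
  haveI := finrank_real_complex_fact'
  contMDiff_coe_sphere (E := ℂ) (n := 1)

theorem mdifferentiable_circle_coe (a : Circle) :
    MDifferentiableAt (𝓡 1) 𝓘(ℝ, ℂ) (fun a : Circle => (a : ℂ)) a :=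
  contMDiff_circle_coe.contMDiffAt.mdifferentiableAt (by simp)

theorem injective_mvfderiv_circle_coe (a : Circle) :
    Function.Injective (mvfderiv (𝓡 1) (fun a : Circle => (a : ℂ)) a) :=
  haveI := finrank_real_complex_fact'
  injective_mvfderiv_subtypeVal_sphere (E := ℂ) (n := 1) a

/-- The tangent space of the circle at `θ` is spanned by `i θ`. -/
theorem mvfderiv_circle_coe_apply (a : Circle) (X : TangentSpace (𝓡 1) a) :
    mvfderiv (𝓡 1) (fun a : Circle => (a : ℂ)) a X =
      ((starRingEnd ℂ (a : ℂ)) * mvfderiv (𝓡 1) (fun a : Circle => (a : ℂ)) a X).im •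
        (Complex.I * (a : ℂ)) := by
  -- Differentiating `|a|² = 1` gives `Re(ā u) = 0`, so `ā u` is purely imaginary and `u` is
  -- recovered on multiplying by `a`.
  have h1 : mvfderiv (𝓡 1) (fun a : Circle => Complex.normSq (a : ℂ)) a X = 0 := by
    have : (fun a : Circle => Complex.normSq (a : ℂ)) = fun _ => 1 := by
      funext b; simp
    rw [this, mvfderiv_const]
    rfl
  set u := mvfderiv (𝓡 1) (fun a : Circle => (a : ℂ)) a X with hu
  have h2 : HasFDerivAt (fun z : ℂ => Complex.normSq z)
      ((a : ℂ).re • Complex.reCLM + (a : ℂ).re • Complex.reCLM +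
        ((a : ℂ).im • Complex.imCLM + (a : ℂ).im • Complex.imCLM)) (a : ℂ) := by
    have hr := Complex.reCLM.hasFDerivAt (x := (a : ℂ))
    have hi := Complex.imCLM.hasFDerivAt (x := (a : ℂ))
    exact (hr.mul hr).add (hi.mul hi)
  rw [mvfderiv_fderiv_comp_apply h2.differentiableAt (mdifferentiable_circle_coe a), h2.fderiv,
    ← hu] at h1
  have h3 : (a : ℂ).re * (a : ℂ).re + (a : ℂ).im * (a : ℂ).im = 1 := by
    rw [← Complex.normSq_apply]; simp
  simp at h1
  apply Complex.ext <;> simp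
  · linear_combination (-u.re) * h3 + (a : ℂ).re / 2 * h1
  · linear_combination (-u.im) * h3 + (a : ℂ).im / 2 * h1

theorem isInvertible_of_bijective {V W : Type*} [NormedAddCommGroup V] [NormedSpace ℝ V]
    [NormedAddCommGroup W] [NormedSpace ℝ W] [FiniteDimensional ℝ V] {L : V →L[ℝ] W}
    (hL : Function.Bijective L) : L.IsInvertible :=
  ⟨(LinearEquiv.ofBijective L.toLinearMap hL).toContinuousLinearEquiv, rfl⟩

/-! ### Central quadrics -/

section Quadric

variable {n : ℕ} {N : Type*} [TopologicalSpace N]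
  [ChartedSpace (EuclideanSpace ℝ (Fin (2 * n - 1))) N]

/-- The map `incl` embeds the manifold `N` in `ℂ^n` as the quadric `{z : ⟨z, z⟩ = c}`. -/
structure IsQuadric (c : ℝ) (ν : ℕ) (incl : N → CSpace n) : Prop where
  smooth : ContMDiff (𝓡 (2 * n - 1)) 𝓘(ℝ, CSpace n) ∞ incl
  injective : Function.Injective incl
  immersion : ∀ z, Function.Injective (mvfderiv (𝓡 (2 * n - 1)) incl z)
  form_self : ∀ z, form n ν (incl z) (incl z) = c
  exists_eq : ∀ v, form n ν v v = c → ∃ z, incl z = v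

/-- The metric `c dθ^2 ⊕ g_N` of `S^1 × N`. -/
abbrev quadricMetric (c : ℝ) (ν : ℕ) (incl : N → CSpace n) :
    BilinField ((𝓡 1).prod (𝓡 (2 * n - 1))) (Circle × N) :=
  prodMetric (𝓡 1) (𝓡 (2 * n - 1)) (circleMetric c) (induced (𝓡 (2 * n - 1)) incl (form n ν))

namespace IsQuadric

variable {c : ℝ} {ν : ℕ} {incl : N → CSpace n}

local notation "IM" => ModelWithCorners.prod (𝓡 1) (𝓡 (2 * n - 1))

theorem mdifferentiableAt (h : IsQuadric c ν incl) (z : N) :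
    MDifferentiableAt (𝓡 (2 * n - 1)) 𝓘(ℝ, CSpace n) incl z :=
  h.smooth.contMDiffAt.mdifferentiableAt (by simp)

/-- The derivative of the constant function `B(incl, incl) = c`. -/
theorem form_mvfderiv (h : IsQuadric c ν incl) (z : N) (X : TangentSpace (𝓡 (2 * n - 1)) z) :
    form n ν (incl z) (mvfderiv (𝓡 (2 * n - 1)) incl z X) = 0 := by
  have h1 : mvfderiv (𝓡 (2 * n - 1)) (fun z => form n ν (incl z) (incl z)) z X = 0 := by
    have : (fun z => form n ν (incl z) (incl z)) = fun _ => c := funext h.form_self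
    rw [this, mvfderiv_const]
    rfl
  have hd : HasFDerivAt (fun w => form n ν w w) _ (incl z) :=
    (form n ν).toContinuousBilinearMap.hasFDerivAt.clm_apply (hasFDerivAt_id (incl z))
  rw [mvfderiv_fderiv_comp_apply hd.differentiableAt (h.mdifferentiableAt z), hd.fderiv] at h1
  simpa [form_comm n ν _ (incl z)] using h1

theorem dIncl_apply (h : IsQuadric c ν incl) (x : Circle × N) (X : TangentSpace IM x) :
    dIncl (𝓡 (2 * n - 1)) incl x X =
      mvfderiv (𝓡 (2 * n - 1)) incl x.2 (mfderiv IM (𝓡 (2 * n - 1)) Prod.snd x X) :=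
  mvfderiv_comp_mfderiv_apply (h.mdifferentiableAt x.2) mdifferentiableAt_snd X

theorem mvfderiv_fst_coe (x : Circle × N) (X : TangentSpace IM x) :
    mvfderiv IM (fun y : Circle × N => (y.1 : ℂ)) x X =
      mvfderiv (𝓡 1) (fun a : Circle => (a : ℂ)) x.1 (mfderiv IM (𝓡 1) Prod.fst x X) :=
  mvfderiv_comp_mfderiv_apply (mdifferentiable_circle_coe x.1) mdifferentiableAt_fst X

theorem dTheta_apply (x : Circle × N) (X : TangentSpace IM x) :
    dTheta (𝓡 (2 * n - 1)) x X =
      ((starRingEnd ℂ (x.1 : ℂ)) * mvfderiv IM (fun y : Circle × N => (y.1 : ℂ)) x X).im := rfl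

theorem mvfderiv_fst_coe_eq (x : Circle × N) (X : TangentSpace IM x) :
    mvfderiv IM (fun y : Circle × N => (y.1 : ℂ)) x X =
      dTheta (𝓡 (2 * n - 1)) x X • (Complex.I * (x.1 : ℂ)) := by
  rw [dTheta_apply, mvfderiv_fst_coe]
  exact mvfderiv_circle_coe_apply _ _

theorem Xi_apply (x : Circle × N) (X : TangentSpace IM x) :
    Xi (𝓡 (2 * n - 1)) incl x X =
      dTheta (𝓡 (2 * n - 1)) x X • incl x.2 + dIncl (𝓡 (2 * n - 1)) incl x X := rfl

theorem form_dIncl (h : IsQuadric c ν incl) (x : Circle × N) (X : TangentSpace IM x) :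
    form n ν (incl x.2) (dIncl (𝓡 (2 * n - 1)) incl x X) = 0 := by
  rw [h.dIncl_apply]
  exact h.form_mvfderiv _ _

/-- The tangent space of `N` is orthogonal to `Θ`, so pairing with `Θ` reads off the `∂_θ`
component. This is how `dθ` is recovered from `Ξ`. -/
theorem form_Xi (h : IsQuadric c ν incl) (x : Circle × N) (X : TangentSpace IM x) :
    form n ν (incl x.2) (Xi (𝓡 (2 * n - 1)) incl x X) = c * dTheta (𝓡 (2 * n - 1)) x X := by
  rw [Xi_apply, map_add, map_smul, h.form_dIncl, h.form_self, smul_eq_mul]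
  ring

theorem eq_zero_of_dTheta_of_dIncl (h : IsQuadric c ν incl) (x : Circle × N)
    (X : TangentSpace IM x) (h1 : dTheta (𝓡 (2 * n - 1)) x X = 0)
    (h2 : dIncl (𝓡 (2 * n - 1)) incl x X = 0) : X = 0 := by
  rw [h.dIncl_apply] at h2
  have h3 := (injective_iff_map_eq_zero _).1 (h.immersion x.2) _ h2
  have h4 := mvfderiv_fst_coe_eq x X
  rw [h1, zero_smul, mvfderiv_fst_coe] at h4
  have h5 := (injective_iff_map_eq_zero _).1 (injective_mvfderiv_circle_coe x.1) _ h4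
  rw [mfderiv_fst] at h5
  rw [mfderiv_snd] at h3
  exact Prod.ext h5 h3

theorem Xi_injective (h : IsQuadric c ν incl) (hc : c * c = 1) (x : Circle × N) :
    Function.Injective (Xi (𝓡 (2 * n - 1)) incl x) := by
  refine (injective_iff_map_eq_zero _).2 fun X hX => ?_
  have h0 : c ≠ 0 := by rintro rfl; simp at hc
  have h1 := h.form_Xi x X
  rw [hX, map_zero] at h1
  have h2 : dTheta (𝓡 (2 * n - 1)) x X = 0 := (mul_eq_zero.1 h1.symm).resolve_left h0
  refine h.eq_zero_of_dTheta_of_dIncl x X h2 ?_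
  rw [Xi_apply, h2, zero_smul, zero_add] at hX
  exact hX

theorem Xi_bijective [NeZero n] (h : IsQuadric c ν incl) (hc : c * c = 1) (x : Circle × N) :
    Function.Bijective (Xi (𝓡 (2 * n - 1)) incl x) := by
  refine ⟨h.Xi_injective hc x, ?_⟩
  -- The count `1 + (2n - 1) = 2n` uses `n ≠ 0`, since the subtraction is truncated.
  have hd : Module.finrank ℝ (EuclideanSpace ℝ (Fin 1) × EuclideanSpace ℝ (Fin (2 * n - 1))) =
      Module.finrank ℝ (CSpace n) := by
    rw [finrank_real_CSpace, Module.finrank_prod, finrank_euclideanSpace_fin,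
      finrank_euclideanSpace_fin]
    have := NeZero.pos n
    omega
  exact (LinearMap.injective_iff_surjective_of_finrank_eq_finrank hd
    (f := (Xi (𝓡 (2 * n - 1)) incl x).toLinearMap)).1 (h.Xi_injective hc x)

theorem quadricMetric_apply (h : IsQuadric c ν incl) (x : Circle × N) (X Y : TangentSpace IM x) :
    quadricMetric c ν incl x X Y =
      c * (dTheta (𝓡 (2 * n - 1)) x X * dTheta (𝓡 (2 * n - 1)) x Y) +
      form n ν (dIncl (𝓡 (2 * n - 1)) incl x X) (dIncl (𝓡 (2 * n - 1)) incl x Y) := by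
  have h1 : quadricMetric c ν incl x X Y =
      c * inner ℝ (mvfderiv (𝓡 1) (fun a : Circle => (a : ℂ)) x.1 (mfderiv IM (𝓡 1) Prod.fst x X))
        (mvfderiv (𝓡 1) (fun a : Circle => (a : ℂ)) x.1 (mfderiv IM (𝓡 1) Prod.fst x Y)) +
      form n ν
        (mvfderiv (𝓡 (2 * n - 1)) incl x.2 (mfderiv IM (𝓡 (2 * n - 1)) Prod.snd x X))
        (mvfderiv (𝓡 (2 * n - 1)) incl x.2 (mfderiv IM (𝓡 (2 * n - 1)) Prod.snd x Y)) := rfl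
  rw [h1, ← h.dIncl_apply, ← h.dIncl_apply, ← mvfderiv_fst_coe, ← mvfderiv_fst_coe,
    mvfderiv_fst_coe_eq, mvfderiv_fst_coe_eq, inner_smul_left, inner_smul_right,
    real_inner_self_eq_norm_sq, norm_mul, Complex.norm_I, Circle.norm_coe]
  simp

/-- The cross terms vanish because `Θ` is normal to `N`, and `B(Θ, Θ) = c` matches the coefficient
of `dθ²`. This is why the circle carries the sign `c`. -/
theorem form_Xi_Xi (h : IsQuadric c ν incl) (x : Circle × N) (X Y : TangentSpace IM x) :
    form n ν (Xi (𝓡 (2 * n - 1)) incl x X) (Xi (𝓡 (2 * n - 1)) incl x Y) =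
      quadricMetric c ν incl x X Y := by
  rw [h.quadricMetric_apply, Xi_apply, Xi_apply]
  simp only [map_add, map_smul, LinearMap.add_apply, LinearMap.smul_apply, smul_eq_mul,
    h.form_self, h.form_dIncl, form_comm n ν (dIncl _ _ _ _) (incl x.2)]
  ring

theorem xiIsometry [NeZero n] (h : IsQuadric c ν incl) (hc : c * c = 1) :
    XiIsometry (𝓡 (2 * n - 1)) ν incl (quadricMetric c ν incl) :=
  fun x => ⟨h.Xi_bijective hc x, h.form_Xi_Xi x⟩

/-- `ContinuousLinearMap.inverse` has the junk value zero on non-invertible maps; bijectivity of `Ξ`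
is what makes `J` the genuine conjugate of `A`. -/
theorem Xi_XiConj [NeZero n] (h : IsQuadric c ν incl) (hc : c * c = 1)
    (A : CSpace n →L[ℝ] CSpace n) (x : Circle × N) (X : TangentSpace IM x) :
    Xi (𝓡 (2 * n - 1)) incl x (XiConj (𝓡 (2 * n - 1)) incl A x X) =
      A (Xi (𝓡 (2 * n - 1)) incl x X) :=
  ((isInvertible_of_bijective
    (V := EuclideanSpace ℝ (Fin 1) × EuclideanSpace ℝ (Fin (2 * n - 1)))
    (h.Xi_bijective hc x)).inverse_apply_eq.1 rfl).symm

end IsQuadric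
end Quadric

/-! ### Tangent spaces of quadrics, logarithmic polar coordinates, and the pseudo-Hermitian
structure -/

section Quadric

variable {n : ℕ} {N : Type*} [TopologicalSpace N]
  [ChartedSpace (EuclideanSpace ℝ (Fin (2 * n - 1))) N]

namespace IsQuadric

variable {c : ℝ} {ν : ℕ} {incl : N → CSpace n}

local notation "IM" => ModelWithCorners.prod (𝓡 1) (𝓡 (2 * n - 1))

theorem exists_tangent [NeZero n] (h : IsQuadric c ν incl) (hc : c * c = 1) (x : Circle × N)
    (r : ℝ) (w : CSpace n) (hw : form n ν (incl x.2) w = 0) :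
    ∃ X : TangentSpace IM x,
      dTheta (𝓡 (2 * n - 1)) x X = r ∧ dIncl (𝓡 (2 * n - 1)) incl x X = w := by
  obtain ⟨X, hX⟩ := (h.Xi_bijective hc x).2 (r • incl x.2 + w)
  have h1 := h.form_Xi x X
  rw [hX, map_add, map_smul, hw, h.form_self, smul_eq_mul] at h1
  have h2 : dTheta (𝓡 (2 * n - 1)) x X = r := by
    -- `h1` says `r c = c dθ(X)`; since `c² = 1`, multiplying by `c` cancels the factor.
    linear_combination (-c) * h1 + (r - dTheta (𝓡 (2 * n - 1)) x X) * hc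
  refine ⟨X, h2, ?_⟩
  rw [Xi_apply, h2] at hX
  exact add_left_cancel hX

/-- Converse of `form_mvfderiv`: the tangent space fills `Θ^⊥`. It is read off from `Ξ` over an
arbitrary point of the circle, here `1`. -/
theorem exists_mvfderiv_eq [NeZero n] (h : IsQuadric c ν incl) (hc : c * c = 1) (z : N)
    (w : CSpace n) (hw : form n ν (incl z) w = 0) :
    ∃ X : TangentSpace (𝓡 (2 * n - 1)) z, mvfderiv (𝓡 (2 * n - 1)) incl z X = w := by
  obtain ⟨X, -, hX⟩ := h.exists_tangent hc ((1 : Circle), z) 0 w hw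
  rw [h.dIncl_apply] at hX
  exact ⟨_, hX⟩

theorem contMDiff_snd (h : IsQuadric c ν incl) :
    ContMDiff IM 𝓘(ℝ, CSpace n) ∞ (fun y : Circle × N => incl y.2) :=
  h.smooth.comp _root_.contMDiff_snd

theorem contMDiff_fst_coe :
    ContMDiff IM 𝓘(ℝ, ℂ) ∞ (fun y : Circle × N => (y.1 : ℂ)) :=
  contMDiff_circle_coe.comp contMDiff_fst

section Smooth

variable [IsManifold (𝓡 (2 * n - 1)) ∞ N]

theorem contMDiffAt_Xi_apply (h : IsQuadric c ν incl) {p₀ : Circle × N} {X : VField IM (Circle × N)}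
    (hX : ContMDiffAt IM (IM).tangent ∞ (fun p => (⟨p, X p⟩ : TangentBundle IM (Circle × N))) p₀) :
    ContMDiffAt IM 𝓘(ℝ, CSpace n) ∞ (fun p => Xi (𝓡 (2 * n - 1)) incl p (X p)) p₀ := by
  have h1 := contMDiffAt_mvfderiv_apply (contMDiff_fst_coe (n := n) (N := N)).contMDiffAt hX
  have h2 := contMDiffAt_mvfderiv_apply h.contMDiff_snd.contMDiffAt hX
  have hconj : ContMDiffAt IM 𝓘(ℝ, ℂ) ∞ (fun y : Circle × N => starRingEnd ℂ (y.1 : ℂ)) p₀ :=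
    (Complex.conjCLE.contDiff.contMDiff).contMDiffAt.comp p₀
      (contMDiff_fst_coe (n := n) (N := N)).contMDiffAt
  have hmul : ContDiff ℝ ∞ fun q : ℂ × ℂ => (q.1 * q.2).im :=
    Complex.imCLM.contDiff.comp (contDiff_fst.mul contDiff_snd)
  have h3 : ContMDiffAt IM 𝓘(ℝ, ℝ) ∞ (fun p => dTheta (𝓡 (2 * n - 1)) p (X p)) p₀ :=
    hmul.contMDiff.contMDiffAt.comp p₀ (hconj.prodMk_space h1)
  exact (h3.smul h.contMDiff_snd.contMDiffAt).add h2

theorem isPseudoRiemannianMetric_quadricMetric [NeZero n] (h : IsQuadric c ν incl)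
    (hc : c * c = 1) : IsPseudoRiemannianMetric IM (quadricMetric c ν incl) where
  symm p X Y := by rw [← h.form_Xi_Xi, ← h.form_Xi_Xi, form_comm]
  nondegenerate p X hX := by
    refine (injective_iff_map_eq_zero _).1 (h.Xi_injective hc p) X ?_
    refine eq_zero_of_form_eq_zero (n := n) (ν := ν) fun w => ?_
    obtain ⟨Y, rfl⟩ := (h.Xi_bijective hc p).2 w
    rw [h.form_Xi_Xi, hX]
  smooth U hU X Y hX hY p hp := by
    simp only [← h.form_Xi_Xi]
    exact (contMDiffAt_form (h.contMDiffAt_Xi_apply (hX.contMDiffAt (hU.mem_nhds hp)))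
      (h.contMDiffAt_Xi_apply (hY.contMDiffAt (hU.mem_nhds hp)))).contMDiffWithinAt

theorem isPseudoRiemannianMetric_induced [NeZero n] (h : IsQuadric c ν incl) (hc : c * c = 1) :
    IsPseudoRiemannianMetric (𝓡 (2 * n - 1)) (induced (𝓡 (2 * n - 1)) incl (form n ν)) where
  symm p X Y := form_comm _ _ _ _
  nondegenerate z X hX := by
    refine (injective_iff_map_eq_zero _).1 (h.immersion z) X ?_
    refine eq_zero_of_form_eq_zero (n := n) (ν := ν) fun w => ?_
    -- The projection of `w` to `Θ^⊥`, with coefficient `c B(Θ, w)` because `1 / c = c`. The removed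
    -- multiple of `Θ` pairs to zero with the tangent vector.
    obtain ⟨Y, hY⟩ := h.exists_mvfderiv_eq hc z (w - (c * form n ν (incl z) w) • incl z) (by
      rw [map_sub, map_smul, h.form_self, smul_eq_mul]
      linear_combination (-form n ν (incl z) w) * hc)
    have h1 : form n ν (mvfderiv (𝓡 (2 * n - 1)) incl z X)
      (mvfderiv (𝓡 (2 * n - 1)) incl z Y) = 0 := hX Y
    rwa [hY, map_sub, map_smul, form_comm n ν _ (incl z), h.form_mvfderiv, smul_zero,
      sub_zero] at h1
  smooth U hU X Y hX hY p hp :=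
    (contMDiffAt_form
      (contMDiffAt_mvfderiv_apply h.smooth.contMDiffAt (hX.contMDiffAt (hU.mem_nhds hp)))
      (contMDiffAt_mvfderiv_apply h.smooth.contMDiffAt
        (hY.contMDiffAt (hU.mem_nhds hp)))).contMDiffWithinAt

end Smooth

/-- Near every point, `(θ, Θ) ↦ e^{arg θ} Θ` is a local diffeomorphism to `ℂ^n` whose
derivative is a multiple of `Ξ`. -/
theorem exists_potential (h : IsQuadric c ν incl) (p₀ : Circle × N) :
    ∃ F : Circle × N → CSpace n, ContMDiffAt IM 𝓘(ℝ, CSpace n) ∞ F p₀ ∧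
      ∃ r : Circle × N → ℝ, (∀ p, r p ≠ 0) ∧ ContMDiffAt IM 𝓘(ℝ, ℝ) ∞ r p₀ ∧
      ∀ᶠ p in 𝓝 p₀, mvfderiv IM F p = r p • Xi (𝓡 (2 * n - 1)) incl p := by
  -- Rotating `p₀` to `1` keeps a neighbourhood of it off the branch cut of the logarithm; `ρ(w) =
  -- e^{arg w}`.
  let u : Circle × N → ℂ := fun p => (p.1 : ℂ) * starRingEnd ℂ (p₀.1 : ℂ)
  let ρ : ℂ → ℝ := fun w => Real.exp (Complex.log w).im
  have hu : ContMDiff IM 𝓘(ℝ, ℂ) ∞ u :=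
    ((ContinuousLinearMap.mul ℝ ℂ).flip (starRingEnd ℂ (p₀.1 : ℂ))).contDiff.contMDiff.comp
      contMDiff_fst_coe
  have hρ : ∀ w ∈ Complex.slitPlane, HasFDerivAt ρ
      (ρ w • (Complex.imCLM ∘L (w⁻¹ • ContinuousLinearMap.id ℝ ℂ))) w := by
    intro w hw
    have h1 : HasFDerivAt Complex.log (w⁻¹ • ContinuousLinearMap.id ℝ ℂ) w := by
      have := (Complex.hasStrictDerivAt_log hw).hasDerivAt.hasFDerivAt.restrictScalars ℝ
      refine this.congr_fderiv (ContinuousLinearMap.ext fun v => ?_)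
      simp [mul_comm]
    exact (Complex.imCLM.hasFDerivAt.comp w h1).exp
  have hρs : ∀ w ∈ Complex.slitPlane, ContDiffAt ℝ ∞ ρ w := by
    intro w hw
    have h1 : ContDiffAt ℝ ∞ Complex.log w := (Complex.contDiffAt_log hw).restrict_scalars ℝ
    exact Real.contDiff_exp.contDiffAt.comp w (Complex.imCLM.contDiff.contDiffAt.comp w h1)
  have hu₀ : u p₀ = 1 := by
    simp only [u]
    rw [Complex.mul_conj]
    simp
  have hr : ContMDiffAt IM 𝓘(ℝ, ℝ) ∞ (fun p => ρ (u p)) p₀ :=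
    ContMDiffAt.comp (g := ρ) (f := u) p₀
      (hρs _ (by rw [hu₀]; exact Complex.one_mem_slitPlane)).contMDiffAt hu.contMDiffAt
  refine ⟨fun p => ρ (u p) • incl p.2, hr.smul h.contMDiff_snd.contMDiffAt,
    fun p => ρ (u p), fun p => (Real.exp_pos _).ne', hr, ?_⟩
  have hev : ∀ᶠ p in 𝓝 p₀, u p ∈ Complex.slitPlane :=
    hu.continuous.continuousAt.eventually (Complex.isOpen_slitPlane.mem_nhds (by
      rw [hu₀]; exact Complex.one_mem_slitPlane))
  filter_upwards [hev] with p hp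
  have hd1 : MDifferentiableAt IM 𝓘(ℝ, ℂ) u p := hu.contMDiffAt.mdifferentiableAt (by simp)
  have hd2 : MDifferentiableAt IM 𝓘(ℝ, ℝ) (fun p => ρ (u p)) p :=
    (hρ _ hp).differentiableAt.mdifferentiableAt.comp p hd1
  ext1 X
  rw [mvfderiv_fun_smul hd2 (h.contMDiff_snd.contMDiffAt.mdifferentiableAt (by simp))]
  have h1 : mvfderiv IM (fun p => ρ (u p)) p X = ρ (u p) * dTheta (𝓡 (2 * n - 1)) p X := by
    rw [mvfderiv_fderiv_comp_apply (hρ _ hp).differentiableAt hd1, (hρ _ hp).fderiv]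
    have h2 : mvfderiv IM u p X =
        mvfderiv IM (fun y : Circle × N => (y.1 : ℂ)) p X * starRingEnd ℂ (p₀.1 : ℂ) :=
      mvfderiv_clm_comp_apply ((ContinuousLinearMap.mul ℝ ℂ).flip (starRingEnd ℂ (p₀.1 : ℂ)))
        ((contMDiff_fst_coe (n := n) (N := N)).contMDiffAt.mdifferentiableAt (by simp)) X
    -- The logarithmic derivative of `u` does not see the constant factor `θ̄₀`; its imaginary part
    -- is `dθ`.
    have h3 : (u p)⁻¹ * (mvfderiv IM (fun y : Circle × N => (y.1 : ℂ)) p X *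
        starRingEnd ℂ (p₀.1 : ℂ)) =
        starRingEnd ℂ (p.1 : ℂ) * mvfderiv IM (fun y : Circle × N => (y.1 : ℂ)) p X := by
      have hp0 : starRingEnd ℂ (p₀.1 : ℂ) ≠ 0 := by simp
      have hp1 : (p.1 : ℂ) ≠ 0 := by simp
      have hpi : starRingEnd ℂ (p.1 : ℂ) = (p.1 : ℂ)⁻¹ := by
        rw [← Circle.coe_inv_eq_conj, Circle.coe_inv]
      rw [hpi]
      simp only [u]
      field_simp
    simp only [_root_.smul_apply, ContinuousLinearMap.comp_apply, h2, smul_eq_mul,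
      ContinuousLinearMap.id_apply, h3, dTheta_apply, Complex.imCLM_apply]
  have h4 : dIncl (𝓡 (2 * n - 1)) incl p X = mvfderiv IM (fun y : Circle × N => incl y.2) p X := rfl
  simp only [_root_.add_apply, _root_.smul_apply,
    ContinuousLinearMap.smulRight_apply, h1, Xi_apply, h4, smul_add, mul_smul]
  rw [add_comm]

/-- `(S^1 × N, g, Ξ⁻¹ A Ξ)` is pseudo-Hermitian for every orthogonal complex structure `A` of
`ℂ^n`. -/
theorem isPseudoHermitian [IsManifold (𝓡 (2 * n - 1)) ∞ N] [NeZero n] (h : IsQuadric c ν incl)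
    (hc : c * c = 1) {A : CSpace n →L[ℝ] CSpace n} (hsq : ∀ z, A (A z) = -z)
    (hA : ∀ z w, form n ν (A z) (A w) = form n ν z w) :
    IsPseudoHermitian IM (quadricMetric c ν incl) (XiConj (𝓡 (2 * n - 1)) incl A) where
  metric := h.isPseudoRiemannianMetric_quadricMetric hc
  smooth U hU X hX p₀ hp₀ := by
    obtain ⟨F, hF, r, hr, hrs, hd⟩ := h.exists_potential p₀
    have hX₀ := hX.contMDiffAt (hU.mem_nhds hp₀)
    -- `J X` is smooth because `dF(J X) = A(dF X)` is, and `dF` is invertible at `p₀`, being a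
    -- nonzero multiple of `Ξ`.
    refine (contMDiffAt_of_mvfderiv_apply hF ?_ ?_).contMDiffWithinAt
    · refine isInvertible_of_bijective
        (V := EuclideanSpace ℝ (Fin 1) × EuclideanSpace ℝ (Fin (2 * n - 1))) ?_
      rw [hd.self_of_nhds]
      exact (Units.mk0 (r p₀) (hr p₀)  |> fun s => (MulAction.bijective s :
        Function.Bijective (fun w : CSpace n => s • w))).comp (h.Xi_bijective hc p₀)
    · refine ((A.contDiff.contMDiff.contMDiffAt.comp p₀
        (contMDiffAt_mvfderiv_apply hF hX₀))).congr_of_eventuallyEq ?_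
      filter_upwards [hd] with p hp
      simp only [hp, Function.comp_apply]
      simp only [_root_.smul_apply, h.Xi_XiConj hc, map_smul]
  sq p X := by
    apply h.Xi_injective hc p
    rw [h.Xi_XiConj hc, h.Xi_XiConj hc, hsq, map_neg]
  compatible p X Y := by
    rw [← h.form_Xi_Xi, h.Xi_XiConj hc, h.Xi_XiConj hc, hA, h.form_Xi_Xi]
  integrable := by
    refine isIntegrable_of_constant A fun p₀ => ?_
    obtain ⟨F, hF, r, hr, hrs, hd⟩ := h.exists_potential p₀
    refine ⟨F, hF, ?_, ?_⟩
    · rw [hd.self_of_nhds]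
      exact (smul_right_injective _ (hr p₀)).comp (h.Xi_injective hc p₀)
    · filter_upwards [hd] with p hp X
      simp only [hp, _root_.smul_apply, h.Xi_XiConj hc, map_smul]

end IsQuadric
end Quadric

/-! ### Maps to complex projective space -/

namespace CProj

variable {n : ℕ}

local notation "IP" => modelWithCornersSelf ℝ (CSpace (n - 1))

/-- In the affine chart the section is the affine map `x ↦ v + y(x)`. Its smoothness, and the
injectivity and range of its derivative, come from this. -/
theorem rep_add_coord_symm_chart (p : CProj n) {q : CProj n} (hq : q ∈ p.affine) :
    p.rep + (p.coord.symm (extChartAt IP p q) : CSpace n) = p.section_ q := by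
  change p.rep + (p.coord.symm (p.coord (p.proj (p.section_ q))) : CSpace n) = _
  obtain ⟨v, rfl⟩ := isOpenQuotientMap_mk'.surjective q
  rw [ContinuousLinearEquiv.symm_apply_apply, section_mk']
  exact normalize_eq p _ ((p.mk'_mem_affine v).1 hq)

theorem mem_affine_self (p : CProj n) : p ∈ p.affine := p.inner_rep_self_ne_zero

/-- The linear part of the section `q ↦ v + y(q)`. -/
def coordSymmL (p : CProj n) : CSpace (n - 1) →L[ℝ] CSpace n :=
  (p.perp.subtypeL.comp (p.coord.symm : CSpace (n - 1) →L[ℂ] p.perp)).restrictScalars ℝ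

theorem coordSymmL_apply (p : CProj n) (x : CSpace (n - 1)) :
    p.coordSymmL x = (p.coord.symm x : CSpace n) := rfl

theorem contMDiffAt_section (p : CProj n) {q : CProj n} (hq : q ∈ p.affine) :
    ContMDiffAt IP 𝓘(ℝ, CSpace n) ∞ p.section_ q := by
  have h1 : ContMDiffAt IP IP ∞ (extChartAt IP p) q :=
    contMDiffAt_extChartAt' (by exact hq)
  have h2 : ContDiff ℝ ∞ fun x : CSpace (n - 1) => p.rep + p.coordSymmL x :=
    contDiff_const.add p.coordSymmL.contDiff
  refine (h2.contMDiff.contMDiffAt.comp q h1).congr_of_eventuallyEq ?_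
  filter_upwards [p.isOpen_affine.mem_nhds hq] with q' hq'
  exact (p.rep_add_coord_symm_chart hq').symm

theorem mdifferentiableAt_section (p : CProj n) {q : CProj n} (hq : q ∈ p.affine) :
    MDifferentiableAt IP 𝓘(ℝ, CSpace n) p.section_ q :=
  (p.contMDiffAt_section hq).mdifferentiableAt (by simp)

theorem section_self (p : CProj n) : p.section_ p = p.rep := by
  have h : p = Projectivization.mk' ℂ ⟨p.rep, p.rep_nonzero⟩ := p.mk_rep.symm
  rw [congrArg p.section_ h, section_mk', normalize, div_self p.inner_rep_self_ne_zero, one_smul]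

theorem mvfderiv_section_apply (p : CProj n) (X : TangentSpace IP p) :
    mvfderiv IP p.section_ p X = p.coordSymmL (mvfderiv IP (extChartAt IP p) p X) := by
  have h1 : MDifferentiableAt IP IP (extChartAt IP p) p :=
    contMDiffAt_extChartAt.mdifferentiableAt (by simp : (∞ : WithTop ℕ∞) ≠ 0)
  have h2 : DifferentiableAt ℝ (fun x : CSpace (n - 1) => p.rep + p.coordSymmL x)
      (extChartAt IP p p) := (p.coordSymmL.differentiableAt).const_add _
  have h3 : mvfderiv IP p.section_ p =
      mvfderiv IP (fun q => p.rep + p.coordSymmL (extChartAt IP p q)) p := by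
    refine mvfderiv_congr ?_
    filter_upwards [p.isOpen_affine.mem_nhds p.mem_affine_self] with q' hq'
    exact (p.rep_add_coord_symm_chart hq').symm
  rw [h3, mvfderiv_fderiv_comp_apply h2 h1, fderiv_const_add, ContinuousLinearMap.fderiv]

theorem inner_rep_mvfderiv_section (p : CProj n) (X : TangentSpace IP p) :
    inner ℂ p.rep (mvfderiv IP p.section_ p X) = 0 := by
  rw [mvfderiv_section_apply, coordSymmL_apply, inner_rep_perp]

theorem mvfderiv_section_injective (p : CProj n) :
    Function.Injective (mvfderiv IP p.section_ p) := by
  refine (injective_iff_map_eq_zero _).2 fun X hX => ?_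
  rw [mvfderiv_section_apply, coordSymmL_apply, ZeroMemClass.coe_eq_zero,
    EmbeddingLike.map_eq_zero_iff] at hX
  obtain ⟨e, he⟩ := isInvertible_mfderiv_extChartAt (I := IP) (mem_extChartAt_source p)
  refine e.injective (Eq.trans ?_ (hX.trans (map_zero e).symm))
  exact congrArg (fun L : TangentSpace IP p →L[ℝ] CSpace (n - 1) => L X) he

section Lift

variable {E : Type*} [NormedAddCommGroup E] [NormedSpace ℝ E]
  {H : Type*} [TopologicalSpace H] {I : ModelWithCorners ℝ E H}
  {M : Type*} [TopologicalSpace M] [ChartedSpace H M]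
  {f : M → CProj n} {s : M → CSpace n} {x : M}

/-- A map to projective space with a smooth homogeneous lift is smooth. -/
theorem contMDiffAt_of_lift (hs : ContMDiffAt I 𝓘(ℝ, CSpace n) ∞ s x) (h0 : ∀ y, s y ≠ 0)
    (hf : ∀ y, f y = Projectivization.mk ℂ (s y) (h0 y)) :
    ContMDiffAt I IP ∞ f x := by
  have hfc : f = fun y => Projectivization.mk' ℂ ⟨s y, h0 y⟩ := funext hf
  rw [contMDiffAt_iff_target]
  refine ⟨?_, ?_⟩
  · rw [hfc]
    refine isOpenQuotientMap_mk'.continuous.continuousAt.comp ?_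
    exact Topology.IsInducing.subtypeVal.continuousAt_iff.2 hs.continuousAt
  · set p := f x with hp
    have h1 : extChartAt IP p ∘ f = fun y => p.coord (p.proj (p.normalize (s y))) := by
      funext y
      rw [hfc]
      rfl
    have hx : inner ℂ p.rep (s x) ≠ 0 := by
      have := p.mem_affine_self
      nth_rewrite 2 [hp] at this
      rw [hfc] at this
      exact (p.mk'_mem_affine _).1 this
    rw [h1]
    have hl : ContDiff ℝ ∞ fun z : CSpace n => p.coord (p.proj z) :=
      (((p.coord : p.perp →L[ℂ] CSpace (n - 1)).comp p.proj).restrictScalars ℝ).contDiff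
    have hi : ContDiff ℝ ∞ fun z : CSpace n => inner ℂ p.rep z :=
      ((innerSL ℂ p.rep).restrictScalars ℝ).contDiff
    have hn : ContDiffAt ℝ ∞ p.normalize (s x) := by
      unfold normalize
      simp only [div_eq_mul_inv]
      exact (contDiffAt_const.mul (hi.contDiffAt.inv hx)).smul contDiffAt_id
    exact (hl.contDiffAt.comp _ hn).contMDiffAt.comp x hs

/-- The derivative of a map to projective space in terms of the derivative of a homogeneous
lift. -/
theorem exists_mvfderiv_section_comp (hf : MDifferentiableAt I IP f x)
    (hs : MDifferentiableAt I 𝓘(ℝ, CSpace n) s x)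
    (hfs : ∀ᶠ y in 𝓝 x, ∃ h : s y ≠ 0, f y = Projectivization.mk ℂ (s y) h) :
    ∃ lam : ℂ, lam ≠ 0 ∧ (f x).rep = lam • s x ∧ ∀ X : TangentSpace I x, ∃ μ : ℂ,
      mvfderiv IP (f x).section_ (f x) (mfderiv I IP f x X) =
        lam • mvfderiv I s x X + μ • s x := by
  set p := f x with hp
  -- The section along `f` is the lift `s` times a scalar function of `s`. The value of that
  -- function at `x` is `lam`, and its derivative supplies `μ` in the product rule.
  have hsec : ∀ᶠ y in 𝓝 x, p.section_ (f y) =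
      (inner ℂ p.rep p.rep / inner ℂ p.rep (s y) : ℂ) • s y := by
    filter_upwards [hfs] with y ⟨hy, hfy⟩
    rw [hfy]
    rfl
  have hrep : p.rep = (inner ℂ p.rep p.rep / inner ℂ p.rep (s x) : ℂ) • s x := by
    rw [← hsec.self_of_nhds, ← hp, section_self]
  have hlam : (inner ℂ p.rep p.rep / inner ℂ p.rep (s x) : ℂ) ≠ 0 := by
    intro h
    rw [h, zero_smul] at hrep
    exact p.rep_nonzero hrep
  have hx : inner ℂ p.rep (s x) ≠ 0 := fun h => hlam (by rw [h, div_zero])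
  refine ⟨_, hlam, hrep, fun X => ?_⟩
  have hi : ContDiff ℝ ∞ fun z : CSpace n => inner ℂ p.rep z :=
    ((innerSL ℂ p.rep).restrictScalars ℝ).contDiff
  have hq : DifferentiableAt ℝ (fun z : CSpace n => (inner ℂ p.rep p.rep / inner ℂ p.rep z : ℂ))
      (s x) := by
    simp only [div_eq_mul_inv]
    exact ((contDiffAt_const.mul (hi.contDiffAt.inv hx)).differentiableAt (by simp) :)
  have hd := mvfderiv_comp_mfderiv_apply (p.mdifferentiableAt_section p.mem_affine_self) hf X
  refine ⟨fderiv ℝ (fun z : CSpace n => (inner ℂ p.rep p.rep / inner ℂ p.rep z : ℂ)) (s x)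
    (mvfderiv I s x X), ?_⟩
  rw [← hd, mvfderiv_congr hsec]
  have hF : HasFDerivAt (fun z : CSpace n =>
      (inner ℂ p.rep p.rep / inner ℂ p.rep z : ℂ) • z) _ (s x) :=
    hq.hasFDerivAt.smul (hasFDerivAt_id (s x))
  rw [mvfderiv_fderiv_comp_apply hF.differentiableAt hs, hF.fderiv]
  simp

variable {c : ℝ} {ν : ℕ}

/-- The metric is defined with one particular section at each point, but any local lift computes it:
another lift changes the point by a factor `lam` and derivatives by `lam` and a multiple of `s`, all
ignored by the form (`fubiniStudyForm_congr`). -/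
theorem fubiniStudy_mfderiv (hf : MDifferentiableAt I IP f x)
    (hs : MDifferentiableAt I 𝓘(ℝ, CSpace n) s x)
    (hfs : ∀ᶠ y in 𝓝 x, ∃ h : s y ≠ 0, f y = Projectivization.mk ℂ (s y) h)
    (X Y : TangentSpace I x) :
    fubiniStudy c ν (f x) (mfderiv I IP f x X) (mfderiv I IP f x Y) =
      fubiniStudyForm c ν (s x) (mvfderiv I s x X) (mvfderiv I s x Y) := by
  obtain ⟨lam, hl, hrep, hd⟩ := exists_mvfderiv_section_comp hf hs hfs
  obtain ⟨μ, hμ⟩ := hd X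
  obtain ⟨μ', hμ'⟩ := hd Y
  have h1 : fubiniStudy c ν (f x) (mfderiv I IP f x X) (mfderiv I IP f x Y) =
    fubiniStudyForm c ν (f x).rep (mvfderiv IP (f x).section_ (f x) (mfderiv I IP f x X))
      (mvfderiv IP (f x).section_ (f x) (mfderiv I IP f x Y)) := rfl
  rw [h1, hμ, hμ', hrep, fubiniStudyForm_congr hl]

/-- Tangent vectors of projective space are vectors of `ℂ^n` modulo the line, up to one common
scale. This serves to compute kernels and to construct lifts of tangent vectors. -/
theorem eq_mfderiv_iff (hf : MDifferentiableAt I IP f x)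
    (hs : MDifferentiableAt I 𝓘(ℝ, CSpace n) s x)
    (hfs : ∀ᶠ y in 𝓝 x, ∃ h : s y ≠ 0, f y = Projectivization.mk ℂ (s y) h) :
    ∃ lam : ℂ, lam ≠ 0 ∧ ∀ (X : TangentSpace I x) (Y : TangentSpace IP (f x)),
      mfderiv I IP f x X = Y ↔ ∃ μ : ℂ,
        mvfderiv I s x X = lam • mvfderiv IP (f x).section_ (f x) Y + μ • s x := by
  obtain ⟨lam, hl, hrep, hd⟩ := exists_mvfderiv_section_comp hf hs hfs
  refine ⟨lam⁻¹, inv_ne_zero hl, fun X Y => ?_⟩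
  obtain ⟨μ, hμ⟩ := hd X
  constructor
  · rintro rfl
    refine ⟨-(lam⁻¹ * μ), ?_⟩
    rw [hμ, smul_add, smul_smul, smul_smul, inv_mul_cancel₀ hl, one_smul]
    module
  · rintro ⟨μ', hμ'⟩
    apply (f x).mvfderiv_section_injective
    have h1 : mvfderiv IP (f x).section_ (f x) (mfderiv I IP f x X) =
        mvfderiv IP (f x).section_ (f x) Y + (μ' + lam⁻¹ * μ) • (f x).rep := by
      rw [hμ, hμ', hrep, smul_add, smul_smul, mul_inv_cancel₀ hl, one_smul, smul_smul, smul_smul,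
        add_mul, mul_comm lam⁻¹ μ, inv_mul_cancel_right₀ hl]
      module
    -- Derivatives of the section are Hermitian-orthogonal to the representative, so the multiple of
    -- `rep` in `h1` must vanish.
    have h2 := (f x).inner_rep_mvfderiv_section (mfderiv I IP f x X)
    rw [h1, inner_add_right, inner_rep_mvfderiv_section, zero_add, inner_smul_right] at h2
    rw [h1, (mul_eq_zero.1 h2).resolve_right (f x).inner_rep_self_ne_zero, zero_smul, add_zero]

theorem mfderiv_eq_zero_iff (hf : MDifferentiableAt I IP f x)
    (hs : MDifferentiableAt I 𝓘(ℝ, CSpace n) s x)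
    (hfs : ∀ᶠ y in 𝓝 x, ∃ h : s y ≠ 0, f y = Projectivization.mk ℂ (s y) h)
    (X : TangentSpace I x) :
    mfderiv I IP f x X = 0 ↔ ∃ μ : ℂ, mvfderiv I s x X = μ • s x := by
  obtain ⟨lam, hl, h⟩ := eq_mfderiv_iff hf hs hfs
  rw [h X 0]
  simp

end Lift

theorem mk_section_eq (p : CProj n) {q : CProj n} (hq : q ∈ p.affine) :
    ∃ h : p.section_ q ≠ 0, q = Projectivization.mk ℂ (p.section_ q) h := by
  have h1 := p.chart.left_inv hq
  have h2 := p.rep_add_coord_symm_chart hq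
  have h3 : p.section_ q ≠ 0 := h2 ▸ p.rep_add_ne_zero _
  refine ⟨h3, ?_⟩
  conv_lhs => rw [← h1]
  exact (Projectivization.mk_eq_mk_iff' ℂ _ _ _ _).2 ⟨1, by rw [one_smul, ← h2]; rfl⟩

end CProj

/-! ### Nondegenerate spans -/

section Span

variable {n ν : ℕ} {c : ℝ}

theorem nondegenerate_span_singleton {v : CSpace n} (hc : c ≠ 0) (hv : form n ν v v = c) :
    ∀ a ∈ Submodule.span ℝ {v}, (∀ b ∈ Submodule.span ℝ {v}, form n ν a b = 0) → a = 0 := by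
  intro a ha h
  obtain ⟨t, rfl⟩ := Submodule.mem_span_singleton.1 ha
  have h1 := h v (Submodule.mem_span_singleton_self v)
  rw [map_smul, LinearMap.smul_apply, hv, smul_eq_mul] at h1
  rw [(mul_eq_zero.1 h1).resolve_right hc, zero_smul]

theorem nondegenerate_span_pair {v w : CSpace n} (hc : c ≠ 0) (hv : form n ν v v = c)
    (hw : form n ν w w = c) (hvw : form n ν v w = 0) :
    ∀ a ∈ Submodule.span ℝ {v, w}, (∀ b ∈ Submodule.span ℝ {v, w}, form n ν a b = 0) → a = 0 := by
  intro a ha h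
  obtain ⟨t, u, rfl⟩ := Submodule.mem_span_pair.1 ha
  have h1 := h v (Submodule.subset_span (by simp))
  have h2 := h w (Submodule.subset_span (by simp))
  simp only [map_add, map_smul, LinearMap.add_apply, LinearMap.smul_apply, smul_eq_mul, hv, hw,
    hvw, form_comm n ν w v, mul_zero, add_zero, zero_add] at h1 h2
  rw [(mul_eq_zero.1 h1).resolve_right hc, (mul_eq_zero.1 h2).resolve_right hc]
  simp

theorem form_span_eq_zero {S T : Set (CSpace n)} (A : CSpace n →L[ℝ] CSpace n)
    (h : ∀ s ∈ S, ∀ t ∈ T, form n ν (A s) t = 0) {a b : CSpace n}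
    (ha : a ∈ Submodule.span ℝ S) (hb : b ∈ Submodule.span ℝ T) : form n ν (A a) b = 0 := by
  induction ha using Submodule.span_induction with
  | mem s hs =>
    induction hb using Submodule.span_induction with
    | mem t ht => exact h s hs t ht
    | zero => simp
    | add x y _ _ hx hy => simp [hx, hy]
    | smul r x _ hx => simp [hx]
  | zero => simp
  | add x y _ _ hx hy => simp [hx, hy]
  | smul r x _ hx => simp [hx]

end Span

/-! ### Submersions from `S^1 × N` in terms of subspaces of `ℂ^n`, and the projection to `N` -/

section Quadric

variable {n : ℕ} {N : Type*} [TopologicalSpace N]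
  [ChartedSpace (EuclideanSpace ℝ (Fin (2 * n - 1))) N]

local notation "IM" => ModelWithCorners.prod (𝓡 1) (𝓡 (2 * n - 1))
local notation "IN" => modelWithCornersSelf ℝ (EuclideanSpace ℝ (Fin (2 * n - 1)))
local notation "IP" => modelWithCornersSelf ℝ (CSpace (n - 1))

namespace IsQuadric

variable {c : ℝ} {ν : ℕ} {incl : N → CSpace n}

section General

variable {E' : Type*} [NormedAddCommGroup E'] [NormedSpace ℝ E']
  {H' : Type*} [TopologicalSpace H'] {I' : ModelWithCorners ℝ E' H'}
  {B : Type*} [TopologicalSpace B] [ChartedSpace H' B]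
  {π : Circle × N → B} {P : Circle × N → Submodule ℝ (CSpace n)}

theorem map_vertical [NeZero n] (h : IsQuadric c ν incl) (hc : c * c = 1)
    (hV : ∀ x X, mfderiv IM I' π x X = 0 ↔ Xi IN incl x X ∈ P x) (x : Circle × N) :
    (vertical IM I' π x).map (Xi IN incl x).toLinearMap = P x := by
  ext v
  constructor
  · rintro ⟨X, hX, rfl⟩
    exact (hV x X).1 hX
  · intro hv
    obtain ⟨X, rfl⟩ := (h.Xi_bijective hc x).2 v
    exact ⟨X, (hV x X).2 hv, rfl⟩

theorem finrank_vertical [NeZero n] (h : IsQuadric c ν incl) (hc : c * c = 1)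
    (hV : ∀ x X, mfderiv IM I' π x X = 0 ↔ Xi IN incl x X ∈ P x) (x : Circle × N) :
    Module.finrank ℝ (vertical IM I' π x) = Module.finrank ℝ (P x) := by
  rw [← h.map_vertical hc hV x]
  exact (LinearEquiv.finrank_eq (Submodule.equivMapOfInjective _ (h.Xi_injective hc x) _))

/-- A submersion from `S^1 × N` whose vertical spaces correspond under `Ξ` to subspaces `P` of
`ℂ^n` is anti-invariant pseudo-Hermitian if `A P` is orthogonal to `P`. -/
theorem isAntiInvariant [NeZero n] [IsManifold IN ∞ N] [IsManifold I' 1 B]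
    (h : IsQuadric c ν incl) (hc : c * c = 1)
    {A : CSpace n →L[ℝ] CSpace n} (hsq : ∀ z, A (A z) = -z)
    (hA : ∀ z w, form n ν (A z) (A w) = form n ν z w) {gB : BilinField I' B}
    (hgB : IsPseudoRiemannianMetric I' gB) (hπ : ContMDiff IM I' ∞ π)
    (hsurj : ∀ x, Function.Surjective (mfderiv IM I' π x))
    (hV : ∀ x X, mfderiv IM I' π x X = 0 ↔ Xi IN incl x X ∈ P x)
    (hP : ∀ x, ∀ a ∈ P x, (∀ b ∈ P x, form n ν a b = 0) → a = 0)
    (hAP : ∀ x, ∀ a ∈ P x, ∀ b ∈ P x, form n ν (A a) b = 0)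
    (hiso : ∀ x X Y, (∀ b ∈ P x, form n ν b (Xi IN incl x X) = 0) →
      (∀ b ∈ P x, form n ν b (Xi IN incl x Y) = 0) →
      gB (π x) (mfderiv IM I' π x X) (mfderiv IM I' π x Y) =
        form n ν (Xi IN incl x X) (Xi IN incl x Y)) :
    IsAntiInvariantPseudoHermitianSubmersion IM I' (quadricMetric c ν incl)
      (XiConj IN incl A) gB π := by
  -- As `Ξ` is a bijective isometry, it carries the horizontal space to the `B`-orthogonal
  -- complement of `P`.
  have hhor : ∀ x X, X ∈ horizontal IM I' (quadricMetric c ν incl) π x ↔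
      ∀ b ∈ P x, form n ν b (Xi IN incl x X) = 0 := by
    intro x X
    constructor
    · intro hX b hb
      obtain ⟨Y, rfl⟩ := (h.Xi_bijective hc x).2 b
      rw [h.form_Xi_Xi]
      exact hX Y ((hV x Y).2 hb)
    · intro hX Y hY
      have := hX _ ((hV x Y).1 hY)
      rwa [h.form_Xi_Xi] at this
  refine ⟨h.isPseudoHermitian hc hsq hA, ⟨h.isPseudoRiemannianMetric_quadricMetric hc, hgB, hπ,
    hsurj, fun x X hX hXY => ?_, fun x X hX Y hY => ?_⟩, fun x X hX => ?_⟩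
  · apply (injective_iff_map_eq_zero _).1 (h.Xi_injective hc x)
    refine hP x _ ((hV x X).1 hX) fun b hb => ?_
    obtain ⟨Y, rfl⟩ := (h.Xi_bijective hc x).2 b
    rw [h.form_Xi_Xi]
    exact hXY Y ((hV x Y).2 hb)
  · rw [hiso x X Y ((hhor x X).1 hX) ((hhor x Y).1 hY), h.form_Xi_Xi]
  · rw [hhor]
    intro b hb
    rw [h.Xi_XiConj hc, form_comm]
    exact hAP x _ ((hV x X).1 hX) b hb

end General

theorem isPosDef_quadricMetric (h : IsQuadric 1 0 incl) : IsPosDef IM (quadricMetric 1 0 incl) := by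
  intro x X hX
  rw [← h.form_Xi_Xi]
  exact form_zero_self_pos fun h0 => hX ((injective_iff_map_eq_zero _).1
    (h.Xi_injective (by norm_num) x) X h0)

theorem isPosDef_induced (h : IsQuadric 1 0 incl) :
    IsPosDef IN (induced IN incl (form n 0)) := by
  intro z X hX
  exact form_zero_self_pos fun h0 => hX ((injective_iff_map_eq_zero _).1 (h.immersion z) X h0)

theorem dTheta_eq_zero_of_form (h : IsQuadric c ν incl) (hc : c * c = 1) {x : Circle × N}
    {X : TangentSpace IM x} (hX : form n ν (incl x.2) (Xi IN incl x X) = 0) :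
    dTheta IN x X = 0 := by
  rw [h.form_Xi] at hX
  exact (mul_eq_zero.1 hX).resolve_left (by rintro rfl; simp at hc)

theorem mfderiv_snd_eq_zero_iff (h : IsQuadric c ν incl) (x : Circle × N)
    (X : TangentSpace IM x) :
    mfderiv IM IN (Prod.snd : Circle × N → N) x X = 0 ↔ dIncl IN incl x X = 0 := by
  rw [h.dIncl_apply]
  exact (map_eq_zero_iff _ (h.immersion x.2)).symm

theorem mfderiv_fst_eq_zero_iff (x : Circle × N) (X : TangentSpace IM x) :
    mfderiv IM (𝓡 1) (Prod.fst : Circle × N → Circle) x X = 0 ↔ dTheta IN x X = 0 := by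
  have h1 := mvfderiv_fst_coe_eq x X
  rw [mvfderiv_fst_coe] at h1
  rw [← map_eq_zero_iff _ (injective_mvfderiv_circle_coe x.1), h1]
  simp

theorem mfderiv_snd_eq_zero_iff_Xi (h : IsQuadric c ν incl) (hc : c * c = 1) (x : Circle × N)
    (X : TangentSpace IM x) :
    mfderiv IM IN (Prod.snd : Circle × N → N) x X = 0 ↔
      Xi IN incl x X ∈ Submodule.span ℝ {incl x.2} := by
  rw [h.mfderiv_snd_eq_zero_iff, Submodule.mem_span_singleton]
  constructor
  · intro h0
    exact ⟨dTheta IN x X, by rw [Xi_apply, h0, add_zero]⟩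
  · rintro ⟨t, ht⟩
    have h1 := h.form_Xi x X
    rw [← ht, map_smul, h.form_self, smul_eq_mul] at h1
    have h2 : dTheta IN x X = t := by
      linear_combination (-c) * h1 + (t - dTheta IN x X) * hc
    rw [Xi_apply, h2] at ht
    exact (left_eq_add.1 ht)

theorem surjective_mfderiv_snd (x : Circle × N) :
    Function.Surjective (mfderiv IM IN (Prod.snd : Circle × N → N) x) := by
  rw [mfderiv_snd]
  exact Prod.snd_surjective

/-- The projection `S^1 × N → N`. -/
theorem isAntiInvariant_snd [NeZero n] [IsManifold IN ∞ N]
    (h : IsQuadric c ν incl) (hc : c * c = 1)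
    {A : CSpace n →L[ℝ] CSpace n} (hsq : ∀ z, A (A z) = -z)
    (hA : ∀ z w, form n ν (A z) (A w) = form n ν z w) :
    IsAntiInvariantPseudoHermitianSubmersion IM IN (quadricMetric c ν incl)
      (XiConj IN incl A) (induced IN incl (form n ν)) (Prod.snd : Circle × N → N) := by
  refine h.isAntiInvariant hc hsq hA (P := fun x => Submodule.span ℝ {incl x.2})
    (h.isPseudoRiemannianMetric_induced hc) _root_.contMDiff_snd surjective_mfderiv_snd
    (h.mfderiv_snd_eq_zero_iff_Xi hc)
    (fun x => nondegenerate_span_singleton (by rintro rfl; simp at hc) (h.form_self x.2))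
    (fun x a ha b hb => form_span_eq_zero A ?_ ha hb) ?_
  · rintro _ rfl _ rfl
    exact form_skew_self hsq hA _
  · intro x X Y hX hY
    have hX' := h.dTheta_eq_zero_of_form hc (hX _ (Submodule.mem_span_singleton_self _))
    have hY' := h.dTheta_eq_zero_of_form hc (hY _ (Submodule.mem_span_singleton_self _))
    rw [Xi_apply, Xi_apply, hX', hY', zero_smul, zero_add, zero_add, h.dIncl_apply, h.dIncl_apply]
    rfl

theorem finrank_vertical_snd [NeZero n] (h : IsQuadric c ν incl) (hc : c * c = 1)
    (x : Circle × N) :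
    Module.finrank ℝ (vertical IM IN (Prod.snd : Circle × N → N) x) = 1 := by
  rw [h.finrank_vertical hc (P := fun x => Submodule.span ℝ {incl x.2})
    (h.mfderiv_snd_eq_zero_iff_Xi hc)]
  refine finrank_span_singleton fun h0 => ?_
  have h1 := h.form_self x.2
  rw [h0, map_zero] at h1
  simp [← h1] at hc

end IsQuadric
end Quadric

/-! ### Quotients of quadrics by the unit complex numbers -/

namespace CProj

variable {n : ℕ} {E : Type*} [NormedAddCommGroup E] [NormedSpace ℝ E]
  {H : Type*} [TopologicalSpace H] {I : ModelWithCorners ℝ E H}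
  {M : Type*} [TopologicalSpace M] [ChartedSpace H M]
  {f : M → CProj n} {x : M} {c : ℝ} {ν : ℕ}

local notation "IP" => modelWithCornersSelf ℝ (CSpace (n - 1))

/-- The definition changes section from point to point, so smoothness is not visible in it. Near `x`
the single section at `f x` gives a smooth lift `σ` of `f`; by `fubiniStudy_mfderiv` it computes the
metric throughout, as an explicit expression with denominator `B(σ, σ)²` nonzero at `x`. A general
`f` covers product bases too. -/
theorem contMDiffAt_fubiniStudy [IsManifold I 1 M] (hf : ContMDiff I IP ∞ f)
    (hx : form n ν (f x).rep (f x).rep ≠ 0) {X Y : VField I M}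
    (hX : ContMDiffAt I I.tangent ∞ (fun p => (⟨p, X p⟩ : TangentBundle I M)) x)
    (hY : ContMDiffAt I I.tangent ∞ (fun p => (⟨p, Y p⟩ : TangentBundle I M)) x) :
    ContMDiffAt I 𝓘(ℝ, ℝ) ∞ (fun y =>
      fubiniStudy c ν (f y) (mfderiv I IP f y (X y)) (mfderiv I IP f y (Y y))) x := by
  set σ : M → CSpace n := fun y => (f x).section_ (f y) with hσ
  have hmem : ∀ᶠ y in 𝓝 x, f y ∈ (f x).affine :=
    hf.continuous.continuousAt.preimage_mem_nhds
      ((f x).isOpen_affine.mem_nhds (f x).mem_affine_self)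
  have hs : ∀ y, f y ∈ (f x).affine → ContMDiffAt I 𝓘(ℝ, CSpace n) ∞ σ y := fun y hy =>
    ((f x).contMDiffAt_section hy).comp y hf.contMDiffAt
  have hσx : σ x = (f x).rep := (f x).section_self
  have hs₀ := hs x (f x).mem_affine_self
  have h1 : ∀ᶠ y in 𝓝 x,
      fubiniStudy c ν (f y) (mfderiv I IP f y (X y)) (mfderiv I IP f y (Y y)) =
        fubiniStudyForm c ν (σ y) (mvfderiv I σ y (X y)) (mvfderiv I σ y (Y y)) := by
    filter_upwards [hmem.eventually_nhds] with y hy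
    refine fubiniStudy_mfderiv (hf.contMDiffAt.mdifferentiableAt (by simp))
      ((hs y hy.self_of_nhds).mdifferentiableAt (by simp)) ?_ _ _
    filter_upwards [hy] with y' hy'
    exact (f x).mk_section_eq hy'
  refine ContMDiffAt.congr_of_eventuallyEq ?_ h1
  simp only [fubiniStudyForm_apply]
  have hI : ContMDiffAt I 𝓘(ℝ, CSpace n) ∞ (fun y => mulI n (σ y)) x :=
    (mulI n).contDiff.contMDiff.contMDiffAt.comp x hs₀
  have hdX := contMDiffAt_mvfderiv_apply hs₀ hX
  have hdY := contMDiffAt_mvfderiv_apply hs₀ hY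
  have hq : ContMDiffAt I 𝓘(ℝ, ℝ) ∞ (fun y => c / form n ν (σ y) (σ y) ^ 2) x := by
    have hr : ContDiffAt ℝ ∞ (fun r : ℝ => c / r ^ 2) (form n ν (σ x) (σ x)) :=
      contDiffAt_const.div (contDiffAt_id.pow 2) (pow_ne_zero 2 (by rw [hσx]; exact hx))
    exact ContMDiffAt.comp (g := fun r : ℝ => c / r ^ 2) x hr.contMDiffAt (contMDiffAt_form hs₀ hs₀)
  refine hq.mul ((((contMDiffAt_form hs₀ hs₀).mul (contMDiffAt_form hdX hdY)).sub
    ((contMDiffAt_form hs₀ hdX).mul (contMDiffAt_form hs₀ hdY))).sub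
    ((contMDiffAt_form hI hdX).mul (contMDiffAt_form hI hdY)))

end CProj

/-! ### The quotient `N → N'`: horizontal lifts and metrics on the base -/

section Hopf

variable {n : ℕ} {N : Type*} [TopologicalSpace N]
  [ChartedSpace (EuclideanSpace ℝ (Fin (2 * n - 1))) N]
  {N' : Type*} [TopologicalSpace N'] [ChartedSpace (CSpace (n - 1)) N']

local notation "IM" => ModelWithCorners.prod (𝓡 1) (𝓡 (2 * n - 1))
local notation "IN" => modelWithCornersSelf ℝ (EuclideanSpace ℝ (Fin (2 * n - 1)))
local notation "IP" => modelWithCornersSelf ℝ (CSpace (n - 1))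
local notation "IB" => ModelWithCorners.prod (𝓡 1) (modelWithCornersSelf ℝ (CSpace (n - 1)))

/-- The map `π : N → N'` covers the map `z ↦ [z]` to projective space, in which `N'` is immersed
by `κ`. -/
structure IsHopf (incl : N → CSpace n) (κ : N' → CProj n) (π : N → N') : Prop where
  smooth_base : ContMDiff IP IP ∞ κ
  immersion_base : ∀ q, Function.Injective (mfderiv IP IP κ q)
  smooth : ContMDiff IN IP ∞ π
  surjective : Function.Surjective π
  base_eq : ∀ z, ∃ h, κ (π z) = Projectivization.mk ℂ (incl z) h

namespace IsHopf

variable {c : ℝ} {ν : ℕ} {incl : N → CSpace n} {κ : N' → CProj n} {π : N → N'}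

theorem mdifferentiableAt (hp : IsHopf incl κ π) (z : N) : MDifferentiableAt IN IP π z :=
  hp.smooth.contMDiffAt.mdifferentiableAt (by simp)

theorem mdifferentiableAt_comp (hp : IsHopf incl κ π) (z : N) :
    MDifferentiableAt IN IP (κ ∘ π) z :=
  (hp.smooth_base.comp hp.smooth).contMDiffAt.mdifferentiableAt (by simp)

theorem mfderiv_comp_apply (hp : IsHopf incl κ π) (z : N) (X : TangentSpace IN z) :
    mfderiv IN IP (κ ∘ π) z X = mfderiv IP IP κ (π z) (mfderiv IN IP π z X) := by
  rw [mfderiv_comp (I' := IP) z (hp.smooth_base.contMDiffAt.mdifferentiableAt (by simp))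
    (hp.mdifferentiableAt z)]
  rfl

theorem eventually_eq (hp : IsHopf incl κ π) (z : N) :
    ∀ᶠ y in 𝓝 z, ∃ h : incl y ≠ 0, (κ ∘ π) y = Projectivization.mk ℂ (incl y) h :=
  Filter.Eventually.of_forall hp.base_eq

/-- A vector killed by the projection lies in `ℂΘ`; tangency to the quadric removes its `Θ`
component and leaves a real multiple of `iΘ`. -/
theorem mfderiv_eq_zero_iff (hp : IsHopf incl κ π) (h : IsQuadric c ν incl) (hc : c * c = 1)
    (z : N) (X : TangentSpace IN z) :
    mfderiv IN IP π z X = 0 ↔ ∃ t : ℝ, mvfderiv IN incl z X = t • mulI n (incl z) := by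
  rw [← map_eq_zero_iff _ (hp.immersion_base (π z)), ← hp.mfderiv_comp_apply,
    CProj.mfderiv_eq_zero_iff (hp.mdifferentiableAt_comp z) (h.mdifferentiableAt z)
      (hp.eventually_eq z)]
  constructor
  · rintro ⟨μ, hμ⟩
    have h1 := h.form_mvfderiv z X
    rw [complex_smul_eq] at hμ
    rw [hμ, map_add, map_smul, map_smul, h.form_self, form_self_mulI, smul_zero, add_zero] at h1
    have h2 : μ.re = 0 := (mul_eq_zero.1 h1).resolve_right (by rintro rfl; simp at hc)
    exact ⟨μ.im, by rw [hμ, h2, zero_smul, zero_add]⟩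
  · rintro ⟨t, ht⟩
    exact ⟨⟨0, t⟩, by rw [ht, complex_smul_eq, zero_smul, zero_add]⟩

/-- Lift `Y` to `ℂ^n` by the section and correct it by an element of `ℂΘ`, which the projection does
not see. Orthogonality to `Θ` makes the result tangent to `N`, and orthogonality to `iΘ` makes it
horizontal. -/
theorem exists_horizontal [NeZero n] (hp : IsHopf incl κ π) (h : IsQuadric c ν incl)
    (hc : c * c = 1) (z : N) (Y : TangentSpace IP (π z)) :
    ∃ X, mfderiv IN IP π z X = Y ∧ form n ν (mulI n (incl z)) (mvfderiv IN incl z X) = 0 := by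
  obtain ⟨lam, -, H⟩ := CProj.eq_mfderiv_iff (hp.mdifferentiableAt_comp z)
    (h.mdifferentiableAt z) (hp.eventually_eq z)
  set Y' : TangentSpace IP (κ (π z)) := mfderiv IP IP κ (π z) Y with hY'
  obtain ⟨w₀, hw₀⟩ : ∃ w₀ : CSpace n,
    w₀ = lam • mvfderiv IP (κ (π z)).section_ (κ (π z)) Y' := ⟨_, rfl⟩
  -- Minus the coefficients of the `B`-projection of `w₀` on `Θ` and `iΘ`, two orthogonal vectors of
  -- square `c = 1 / c`.
  set μ : ℂ := ⟨-(c * form n ν (incl z) w₀), -(c * form n ν (mulI n (incl z)) w₀)⟩ with hμ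
  have hI : form n ν (mulI n (incl z)) (mulI n (incl z)) = c := by
    rw [form_mulI_mulI, h.form_self]
  obtain ⟨X, hX⟩ := h.exists_mvfderiv_eq hc z (w₀ + μ • incl z) (by
    rw [complex_smul_eq, map_add, map_add, map_smul, map_smul, h.form_self, form_self_mulI]
    simp only [hμ, smul_eq_mul]
    linear_combination (-form n ν (incl z) w₀) * hc)
  refine ⟨X, hp.immersion_base _ ?_, ?_⟩
  · rw [← hp.mfderiv_comp_apply]
    exact (H X Y').2 ⟨μ, by rw [hX, hw₀]; rfl⟩
  · rw [hX, complex_smul_eq, map_add, map_add, map_smul, map_smul, form_mulI_self, hI]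
    simp only [hμ, smul_eq_mul]
    linear_combination (-form n ν (mulI n (incl z)) w₀) * hc

/-- Only one argument has to be horizontal. The nondegeneracy proof relies on this, pairing a
horizontal lift with arbitrary tangent vectors. -/
theorem metric_apply (hp : IsHopf incl κ π) (h : IsQuadric c ν incl) (hc : c * c = 1) (z : N)
    (X Y : TangentSpace IN z) (hX : form n ν (mulI n (incl z)) (mvfderiv IN incl z X) = 0) :
    pullback IP IP κ (CProj.fubiniStudy c ν) (π z) (mfderiv IN IP π z X) (mfderiv IN IP π z Y) =
      form n ν (mvfderiv IN incl z X) (mvfderiv IN incl z Y) := by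
  have h1 : pullback IP IP κ (CProj.fubiniStudy c ν) (π z) (mfderiv IN IP π z X)
      (mfderiv IN IP π z Y) =
    CProj.fubiniStudy c ν (κ (π z)) (mfderiv IP IP κ (π z) (mfderiv IN IP π z X))
      (mfderiv IP IP κ (π z) (mfderiv IN IP π z Y)) := rfl
  rw [h1, ← hp.mfderiv_comp_apply, ← hp.mfderiv_comp_apply]
  refine (CProj.fubiniStudy_mfderiv (hp.mdifferentiableAt_comp z) (h.mdifferentiableAt z)
    (hp.eventually_eq z) X Y).trans ?_
  exact CProj.fubiniStudyForm_of_orthogonal hc (h.form_self z) (h.form_mvfderiv z X) hX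

theorem metric_symm (q : N') (X Y : TangentSpace IP q) :
    pullback IP IP κ (CProj.fubiniStudy c ν) q X Y =
      pullback IP IP κ (CProj.fubiniStudy c ν) q Y X := by
  have h1 : ∀ X Y : TangentSpace IP q, pullback IP IP κ (CProj.fubiniStudy c ν) q X Y =
      CProj.fubiniStudyForm c ν (κ q).rep
        (mvfderiv IP (κ q).section_ (κ q) (mfderiv IP IP κ q X))
        (mvfderiv IP (κ q).section_ (κ q) (mfderiv IP IP κ q Y)) := fun _ _ => rfl
  rw [h1, h1, CProj.fubiniStudyForm_comm]

theorem metric_nondegenerate [NeZero n] (hp : IsHopf incl κ π) (h : IsQuadric c ν incl)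
    (hc : c * c = 1) (q : N') (X : TangentSpace IP q)
    (hX : ∀ Y, pullback IP IP κ (CProj.fubiniStudy c ν) q X Y = 0) : X = 0 := by
  obtain ⟨z, rfl⟩ := hp.surjective q
  obtain ⟨U, rfl, hU⟩ := hp.exists_horizontal h hc z X
  have h0 : mvfderiv IN incl z U = 0 := by
    refine eq_zero_of_form_eq_zero (n := n) (ν := ν) fun w => ?_
    obtain ⟨W, hW⟩ := h.exists_mvfderiv_eq hc z (w - (c * form n ν (incl z) w) • incl z) (by
      rw [map_sub, map_smul, h.form_self, smul_eq_mul]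
      linear_combination (-form n ν (incl z) w) * hc)
    have h1 := hX (mfderiv IN IP π z W)
    rwa [hp.metric_apply h hc z U W hU, hW, map_sub, map_smul, form_comm n ν _ (incl z),
      h.form_mvfderiv, smul_zero, sub_zero] at h1
  rw [(injective_iff_map_eq_zero _).1 (h.immersion z) U h0, map_zero]

theorem metric_posDef [NeZero n] (hp : IsHopf incl κ π) (h : IsQuadric 1 0 incl) :
    IsPosDef IP (pullback IP IP κ (CProj.fubiniStudy 1 0)) := by
  intro q X hX
  obtain ⟨z, rfl⟩ := hp.surjective q
  obtain ⟨U, rfl, hU⟩ := hp.exists_horizontal h (by norm_num) z X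
  rw [hp.metric_apply h (by norm_num) z U U hU]
  refine form_zero_self_pos fun h0 => hX ?_
  rw [(injective_iff_map_eq_zero _).1 (h.immersion z) U h0, map_zero]

theorem form_rep_ne_zero (hp : IsHopf incl κ π) (h : IsQuadric c ν incl) (hc : c * c = 1)
    (q : N') : form n ν (κ q).rep (κ q).rep ≠ 0 := by
  obtain ⟨z, rfl⟩ := hp.surjective q
  obtain ⟨hz, hq⟩ := hp.base_eq z
  obtain ⟨a, ha⟩ := Projectivization.exists_smul_eq_mk_rep ℂ (incl z) hz
  rw [hq, ← ha, Units.smul_def, form_smul_smul, h.form_self]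
  exact mul_ne_zero (Complex.normSq_pos.2 a.ne_zero).ne' (by rintro rfl; simp at hc)

theorem isPseudoRiemannianMetric [NeZero n] [IsManifold IP 1 N'] (hp : IsHopf incl κ π)
    (h : IsQuadric c ν incl) (hc : c * c = 1) :
    IsPseudoRiemannianMetric IP (pullback IP IP κ (CProj.fubiniStudy c ν)) where
  symm := metric_symm
  nondegenerate := hp.metric_nondegenerate h hc
  smooth _ hU _ _ hX hY p hp' :=
    (CProj.contMDiffAt_fubiniStudy hp.smooth_base (hp.form_rep_ne_zero h hc p)
      (hX.contMDiffAt (hU.mem_nhds hp')) (hY.contMDiffAt (hU.mem_nhds hp'))).contMDiffWithinAt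

/-- The metric of `S^1 × N'`. -/
abbrev prodBaseMetric (c : ℝ) (ν : ℕ) (κ : N' → CProj n) : BilinField IB (Circle × N') :=
  prodMetric (𝓡 1) IP (circleMetric c) (pullback IP IP κ (CProj.fubiniStudy c ν))

theorem prodBaseMetric_apply (q : Circle × N') (X Y : TangentSpace IB q) :
    prodBaseMetric c ν κ q X Y =
      c * inner ℝ (mvfderiv (𝓡 1) (fun a : Circle => (a : ℂ)) q.1 (mfderiv IB (𝓡 1) Prod.fst q X))
        (mvfderiv (𝓡 1) (fun a : Circle => (a : ℂ)) q.1 (mfderiv IB (𝓡 1) Prod.fst q Y)) +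
      pullback IP IP κ (CProj.fubiniStudy c ν) q.2 (mfderiv IB IP Prod.snd q X)
        (mfderiv IB IP Prod.snd q Y) := rfl

theorem exists_mfderiv_fst_snd (q : Circle × N') (X : TangentSpace (𝓡 1) q.1)
    (Y : TangentSpace IP q.2) : ∃ Z : TangentSpace IB q,
      mfderiv IB (𝓡 1) Prod.fst q Z = X ∧ mfderiv IB IP Prod.snd q Z = Y := by
  rw [mfderiv_fst, mfderiv_snd]
  exact ⟨(X, Y), rfl, rfl⟩

theorem eq_zero_of_mfderiv_fst_snd {q : Circle × N'} {Z : TangentSpace IB q}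
    (h1 : mfderiv IB (𝓡 1) Prod.fst q Z = 0) (h2 : mfderiv IB IP Prod.snd q Z = 0) : Z = 0 := by
  rw [mfderiv_fst] at h1
  rw [mfderiv_snd] at h2
  exact Prod.ext h1 h2

theorem isPosDef_prodBaseMetric [NeZero n] (hp : IsHopf incl κ π) (h : IsQuadric 1 0 incl) :
    IsPosDef IB (prodBaseMetric 1 0 κ) := by
  intro q X hX
  rw [prodBaseMetric_apply, one_mul]
  by_cases h2 : mfderiv IB IP Prod.snd q X = 0
  · have h3 := mt ((injective_iff_map_eq_zero _).1 (injective_mvfderiv_circle_coe q.1) _)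
      fun h1 => hX (eq_zero_of_mfderiv_fst_snd (n := n) h1 h2)
    have h4 : pullback IP IP κ (CProj.fubiniStudy 1 0) q.2 (mfderiv IB IP Prod.snd q X)
        (mfderiv IB IP Prod.snd q X) = 0 := by
      rw [h2]
      exact map_zero _
    rw [h4, add_zero]
    exact real_inner_self_pos.2 h3
  · exact add_pos_of_nonneg_of_pos real_inner_self_nonneg (hp.metric_posDef h q.2 _ h2)

theorem isPseudoRiemannianMetric_prod [NeZero n] [IsManifold IP 1 N'] (hp : IsHopf incl κ π)
    (h : IsQuadric c ν incl) (hc : c * c = 1) :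
    IsPseudoRiemannianMetric IB (prodBaseMetric c ν κ) where
  symm q X Y := by
    rw [prodBaseMetric_apply, prodBaseMetric_apply, real_inner_comm]
    exact congrArg₂ _ rfl (metric_symm _ _ _)
  nondegenerate q X hX := by
    -- Test vectors with one component zero separate the two summands of the metric.
    refine eq_zero_of_mfderiv_fst_snd (n := n) ?_ (hp.metric_nondegenerate h hc q.2 _ fun Y => ?_)
    · obtain ⟨Z, h1, h2⟩ := exists_mfderiv_fst_snd (n := n) q (mfderiv IB (𝓡 1) Prod.fst q X) 0
      have h3 := hX Z
      have h4 : pullback IP IP κ (CProj.fubiniStudy c ν) q.2 (mfderiv IB IP Prod.snd q X)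
          (mfderiv IB IP Prod.snd q Z) = 0 := by
        rw [h2]
        exact map_zero _
      rw [prodBaseMetric_apply, h4, add_zero, h1] at h3
      exact (injective_iff_map_eq_zero _).1 (injective_mvfderiv_circle_coe q.1) _
        (inner_self_eq_zero.1 ((mul_eq_zero.1 h3).resolve_left (by rintro rfl; simp at hc)))
    · obtain ⟨Z, h1, h2⟩ := exists_mfderiv_fst_snd (n := n) q 0 Y
      have h3 := hX Z
      rw [prodBaseMetric_apply, h1, h2, map_zero, inner_zero_right, mul_zero, zero_add] at h3
      exact h3
  smooth U hU X Y hX hY p hp' := by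
    have hX₀ := hX.contMDiffAt (hU.mem_nhds hp')
    have hY₀ := hY.contMDiffAt (hU.mem_nhds hp')
    have hκ : ContMDiff IB IP ∞ (fun y : Circle × N' => κ y.2) :=
      hp.smooth_base.comp contMDiff_snd
    have hθ : ContMDiff IB 𝓘(ℝ, ℂ) ∞ (fun y : Circle × N' => (y.1 : ℂ)) :=
      contMDiff_circle_coe.comp contMDiff_fst
    have h1 : ∀ (q : Circle × N') (Z : TangentSpace IB q),
        mvfderiv IB (fun y : Circle × N' => (y.1 : ℂ)) q Z =
          mvfderiv (𝓡 1) (fun a : Circle => (a : ℂ)) q.1 (mfderiv IB (𝓡 1) Prod.fst q Z) :=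
      fun q Z => mvfderiv_comp_mfderiv_apply (mdifferentiable_circle_coe q.1)
        mdifferentiableAt_fst Z
    have h2 : ∀ (q : Circle × N') (Z : TangentSpace IB q),
        mfderiv IB IP (fun y : Circle × N' => κ y.2) q Z =
          mfderiv IP IP κ q.2 (mfderiv IB IP Prod.snd q Z) := fun q Z => by
      have := mfderiv_comp (I' := IP) q
        (hp.smooth_base.contMDiffAt.mdifferentiableAt (by simp))
        (mdifferentiableAt_snd (I := 𝓡 1) (I' := IP) (x := q))
      exact congrArg (fun L : TangentSpace IB q →L[ℝ] CSpace (n - 1) => L Z) this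
    have h3 : ∀ q, prodBaseMetric c ν κ q (X q) (Y q) =
        c * inner ℝ (mvfderiv IB (fun y : Circle × N' => (y.1 : ℂ)) q (X q))
          (mvfderiv IB (fun y : Circle × N' => (y.1 : ℂ)) q (Y q)) +
        CProj.fubiniStudy c ν (κ q.2) (mfderiv IB IP (fun y : Circle × N' => κ y.2) q (X q))
          (mfderiv IB IP (fun y : Circle × N' => κ y.2) q (Y q)) := fun q => by
      rw [h1, h1, h2, h2]
      rfl
    simp only [h3]
    refine ContMDiffAt.contMDiffWithinAt (ContMDiffAt.add (contMDiffAt_const.mul ?_) ?_)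
    · exact contDiff_inner.contMDiff.contMDiffAt.comp p
        ((contMDiffAt_mvfderiv_apply hθ.contMDiffAt hX₀).prodMk_space
          (contMDiffAt_mvfderiv_apply hθ.contMDiffAt hY₀))
    · exact CProj.contMDiffAt_fubiniStudy hκ (hp.form_rep_ne_zero h hc p.2) hX₀ hY₀

end IsHopf
end Hopf

section Hopf

variable {n : ℕ} {N : Type*} [TopologicalSpace N]
  [ChartedSpace (EuclideanSpace ℝ (Fin (2 * n - 1))) N]
  {N' : Type*} [TopologicalSpace N'] [ChartedSpace (CSpace (n - 1)) N']

local notation "IM" => ModelWithCorners.prod (𝓡 1) (𝓡 (2 * n - 1))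
local notation "IN" => modelWithCornersSelf ℝ (EuclideanSpace ℝ (Fin (2 * n - 1)))
local notation "IP" => modelWithCornersSelf ℝ (CSpace (n - 1))
local notation "IB" => ModelWithCorners.prod (𝓡 1) (modelWithCornersSelf ℝ (CSpace (n - 1)))

namespace IsHopf

variable {c : ℝ} {ν : ℕ} {incl : N → CSpace n} {κ : N' → CProj n} {π : N → N'}

/-! #### The projection `S^1 × N → N'` -/

theorem mfderiv_comp_snd (hp : IsHopf incl κ π) (x : Circle × N) (X : TangentSpace IM x) :
    mfderiv IM IP (fun y : Circle × N => π y.2) x X =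
      mfderiv IN IP π x.2 (mfderiv IM IN Prod.snd x X) := by
  have := mfderiv_comp (I' := IN) x (hp.mdifferentiableAt x.2)
    (mdifferentiableAt_snd (I := 𝓡 1) (I' := IN) (x := x))
  exact congrArg (fun L : TangentSpace IM x →L[ℝ] CSpace (n - 1) => L X) this

theorem mfderiv_comp_snd_eq_zero_iff (hp : IsHopf incl κ π) (h : IsQuadric c ν incl)
    (hc : c * c = 1) (x : Circle × N) (X : TangentSpace IM x) :
    mfderiv IM IP (fun y : Circle × N => π y.2) x X = 0 ↔
      ∃ t : ℝ, dIncl IN incl x X = t • mulI n (incl x.2) := by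
  rw [hp.mfderiv_comp_snd, hp.mfderiv_eq_zero_iff h hc, h.dIncl_apply]

/-- The generator `Θ` is `Ξ(∂_θ)`, from the discarded circle, and `iΘ` is the direction of the fibre
of `N → N'`. -/
theorem mfderiv_comp_snd_eq_zero_iff_Xi (hp : IsHopf incl κ π) (h : IsQuadric c ν incl)
    (hc : c * c = 1) (x : Circle × N) (X : TangentSpace IM x) :
    mfderiv IM IP (fun y : Circle × N => π y.2) x X = 0 ↔
      Xi IN incl x X ∈ Submodule.span ℝ {incl x.2, mulI n (incl x.2)} := by
  rw [hp.mfderiv_comp_snd_eq_zero_iff h hc, Submodule.mem_span_pair]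
  constructor
  · rintro ⟨t, ht⟩
    exact ⟨dTheta IN x X, t, by rw [IsQuadric.Xi_apply, ht]⟩
  · rintro ⟨r, t, ht⟩
    refine ⟨t, ?_⟩
    have h1 := h.form_Xi x X
    rw [← ht, map_add, map_smul, map_smul, h.form_self, form_self_mulI, smul_zero, add_zero,
      smul_eq_mul] at h1
    have h2 : dTheta IN x X = r := by
      linear_combination (-c) * h1 + (r - dTheta IN x X) * hc
    rw [IsQuadric.Xi_apply, h2] at ht
    exact (add_left_cancel ht).symm

theorem surjective_mfderiv [NeZero n] (hp : IsHopf incl κ π) (h : IsQuadric c ν incl)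
    (hc : c * c = 1) (z : N) : Function.Surjective (mfderiv IN IP π z) := fun Y =>
  (hp.exists_horizontal h hc z Y).imp fun _ => And.left

theorem form_mulI_dIncl (x : Circle × N) (X : TangentSpace IM x) :
    form n ν (mulI n (incl x.2)) (Xi IN incl x X) =
      form n ν (mulI n (incl x.2)) (dIncl IN incl x X) := by
  rw [IsQuadric.Xi_apply, map_add, map_smul, form_mulI_self, smul_zero, zero_add]

/-- On `span {Θ, iΘ}` skewness of `A` gives only the diagonal products; `hAI` is needed for the
mixed ones. It fails for `A = i`, whence the quaternionic `j`. -/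
theorem isAntiInvariant_comp_snd [NeZero n] [IsManifold IN ∞ N] [IsManifold IP 1 N']
    (hp : IsHopf incl κ π) (h : IsQuadric c ν incl) (hc : c * c = 1)
    {A : CSpace n →L[ℝ] CSpace n} (hsq : ∀ z, A (A z) = -z)
    (hA : ∀ z w, form n ν (A z) (A w) = form n ν z w)
    (hAI : ∀ z, form n ν (A z) (mulI n z) = 0) :
    IsAntiInvariantPseudoHermitianSubmersion IM IP (quadricMetric c ν incl)
      (XiConj IN incl A) (pullback IP IP κ (CProj.fubiniStudy c ν))
      (fun y : Circle × N => π y.2) := by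
  refine h.isAntiInvariant hc hsq hA
    (P := fun x => Submodule.span ℝ {incl x.2, mulI n (incl x.2)})
    (hp.isPseudoRiemannianMetric h hc) (hp.smooth.comp contMDiff_snd) (fun x Y => ?_)
    (hp.mfderiv_comp_snd_eq_zero_iff_Xi h hc)
    (fun x => nondegenerate_span_pair (by rintro rfl; simp at hc) (h.form_self x.2)
      (by rw [form_mulI_mulI, h.form_self]) (form_self_mulI _))
    (fun x a ha b hb => form_span_eq_zero A ?_ ha hb) ?_
  · obtain ⟨X, hX⟩ := hp.surjective_mfderiv h hc x.2 Y
    obtain ⟨Z, hZ⟩ := IsQuadric.surjective_mfderiv_snd x X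
    exact ⟨Z, by rw [hp.mfderiv_comp_snd, hZ, hX]⟩
  · have h1 : form n ν (A (mulI n (incl x.2))) (incl x.2) = 0 := by
      rw [form_skew hsq hA, form_comm, hAI, neg_zero]
    rintro _ (rfl | rfl) _ (rfl | rfl)
    · exact form_skew_self hsq hA _
    · exact hAI _
    · exact h1
    · exact form_skew_self hsq hA _
  · intro x X Y hX hY
    have hX' := h.dTheta_eq_zero_of_form hc (hX _ (Submodule.subset_span (by simp)))
    have hY' := h.dTheta_eq_zero_of_form hc (hY _ (Submodule.subset_span (by simp)))
    have hX₂ := hX _ (Submodule.subset_span (by simp : mulI n (incl x.2) ∈ _))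
    rw [form_mulI_dIncl, h.dIncl_apply] at hX₂
    rw [IsQuadric.Xi_apply, IsQuadric.Xi_apply, hX', hY', zero_smul, zero_add, zero_add,
      h.dIncl_apply, h.dIncl_apply, hp.mfderiv_comp_snd, hp.mfderiv_comp_snd]
    exact hp.metric_apply h hc _ _ _ hX₂

/-! #### The projection `S^1 × N → S^1 × N'` -/

theorem mfderiv_fst_prodMap (hp : IsHopf incl κ π) (x : Circle × N) (X : TangentSpace IM x) :
    mfderiv IB (𝓡 1) Prod.fst (Prod.map id π x) (mfderiv IM IB (Prod.map id π) x X) =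
      mfderiv IM (𝓡 1) Prod.fst x X := by
  rw [mfderiv_prodMap mdifferentiableAt_id (hp.mdifferentiableAt x.2), mfderiv_fst, mfderiv_fst,
    mfderiv_id]
  rfl

theorem mfderiv_snd_prodMap (hp : IsHopf incl κ π) (x : Circle × N) (X : TangentSpace IM x) :
    mfderiv IB IP Prod.snd (Prod.map id π x) (mfderiv IM IB (Prod.map id π) x X) =
      mfderiv IN IP π x.2 (mfderiv IM IN Prod.snd x X) := by
  rw [mfderiv_prodMap mdifferentiableAt_id (hp.mdifferentiableAt x.2), mfderiv_snd, mfderiv_snd]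
  rfl

theorem mfderiv_prodMap_eq_zero_iff_Xi (hp : IsHopf incl κ π) (h : IsQuadric c ν incl)
    (hc : c * c = 1) (x : Circle × N) (X : TangentSpace IM x) :
    mfderiv IM IB (Prod.map id π) x X = 0 ↔
      Xi IN incl x X ∈ Submodule.span ℝ {mulI n (incl x.2)} := by
  have h1 : mfderiv IM IB (Prod.map id π) x X = 0 ↔
      dTheta IN x X = 0 ∧ ∃ t : ℝ, dIncl IN incl x X = t • mulI n (incl x.2) := by
    rw [← IsQuadric.mfderiv_fst_eq_zero_iff, ← hp.mfderiv_comp_snd_eq_zero_iff h hc,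
      hp.mfderiv_comp_snd, ← hp.mfderiv_fst_prodMap, ← hp.mfderiv_snd_prodMap]
    constructor
    · intro h0
      rw [h0]
      exact ⟨map_zero _, map_zero _⟩
    · rintro ⟨h2, h3⟩
      exact eq_zero_of_mfderiv_fst_snd (n := n) h2 h3
  rw [h1, Submodule.mem_span_singleton]
  constructor
  · rintro ⟨h2, t, ht⟩
    exact ⟨t, by rw [IsQuadric.Xi_apply, h2, ht, zero_smul, zero_add]⟩
  · rintro ⟨t, ht⟩
    have h2 := h.dTheta_eq_zero_of_form hc (x := x) (X := X) (by
      rw [← ht, map_smul, form_self_mulI, smul_zero])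
    exact ⟨h2, t, by rw [ht, IsQuadric.Xi_apply, h2, zero_smul, zero_add]⟩

/-- Fibres are one-dimensional, so skewness of `A` suffices. For `A = i` the image of `iΘ` is `-Θ`,
the direction of `∂_θ`. -/
theorem isAntiInvariant_prodMap [NeZero n] [IsManifold IN ∞ N] [IsManifold IP 1 N']
    (hp : IsHopf incl κ π) (h : IsQuadric c ν incl) (hc : c * c = 1)
    {A : CSpace n →L[ℝ] CSpace n} (hsq : ∀ z, A (A z) = -z)
    (hA : ∀ z w, form n ν (A z) (A w) = form n ν z w) :
    IsAntiInvariantPseudoHermitianSubmersion IM IB (quadricMetric c ν incl)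
      (XiConj IN incl A) (prodBaseMetric c ν κ) (Prod.map id π : Circle × N → Circle × N') := by
  refine h.isAntiInvariant hc hsq hA (P := fun x => Submodule.span ℝ {mulI n (incl x.2)})
    (hp.isPseudoRiemannianMetric_prod h hc) (contMDiff_id.prodMap hp.smooth) (fun x Y => ?_)
    (hp.mfderiv_prodMap_eq_zero_iff_Xi h hc)
    (fun x => nondegenerate_span_singleton (c := c) (by rintro rfl; simp at hc)
      (by rw [form_mulI_mulI, h.form_self]))
    (fun x a ha b hb => form_span_eq_zero A ?_ ha hb) ?_
  · rw [mfderiv_prodMap mdifferentiableAt_id (hp.mdifferentiableAt x.2), mfderiv_id]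
    obtain ⟨X, hX⟩ := hp.surjective_mfderiv h hc x.2 Y.2
    exact ⟨(Y.1, X), Prod.ext rfl hX⟩
  · rintro _ rfl _ rfl
    exact form_skew_self hsq hA _
  · intro x X Y hX hY
    have hX₂ := hX _ (Submodule.mem_span_singleton_self _)
    rw [form_mulI_dIncl, h.dIncl_apply] at hX₂
    rw [prodBaseMetric_apply, hp.mfderiv_fst_prodMap, hp.mfderiv_fst_prodMap,
      hp.mfderiv_snd_prodMap, hp.mfderiv_snd_prodMap, h.form_Xi_Xi]
    refine (congrArg₂ _ rfl (hp.metric_apply h hc _ _ _ hX₂)).trans ?_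
    rfl

theorem finrank_vertical_prodMap [NeZero n] (hp : IsHopf incl κ π) (h : IsQuadric c ν incl)
    (hc : c * c = 1) (x : Circle × N) :
    Module.finrank ℝ (vertical IM IB (Prod.map id π : Circle × N → Circle × N') x) = 1 := by
  rw [h.finrank_vertical hc (P := fun x => Submodule.span ℝ {mulI n (incl x.2)})
    (hp.mfderiv_prodMap_eq_zero_iff_Xi h hc)]
  refine finrank_span_singleton fun h0 => ?_
  have h1 : form n ν (mulI n (incl x.2)) (mulI n (incl x.2)) = c := by
    rw [form_mulI_mulI, h.form_self]
  rw [h0, map_zero] at h1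
  simp [← h1] at hc

end IsHopf
end Hopf

/-! ### Orbits -/

section Orbits

variable {N N' : Type*} [MulAction Circle N] {π : N → N'}

theorem isOrbitProjection_snd (N : Type*) :
    IsOrbitProjection (actFirst N) (Prod.snd : Circle × N → N) := by
  refine ⟨Prod.snd_surjective, fun x y => ⟨fun h => ⟨y.1 * x.1⁻¹, ?_⟩, ?_⟩⟩
  · exact Prod.ext (inv_mul_cancel_right y.1 x.1) h
  · rintro ⟨g, rfl⟩
    rfl

theorem IsOrbitProjection.prodMap (hπ : IsOrbitProjection (inferInstance : MulAction Circle N) π) :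
    IsOrbitProjection (actSecond N) (Prod.map id π) := by
  refine ⟨Function.surjective_id.prodMap hπ.1, fun x y => ⟨fun h => ?_, ?_⟩⟩
  · obtain ⟨h1, h2⟩ := Prod.ext_iff.1 h
    obtain ⟨g, hg⟩ := (hπ.2 _ _).1 h2
    exact ⟨g, Prod.ext h1 hg⟩
  · rintro ⟨g, rfl⟩
    exact Prod.ext rfl ((hπ.2 _ _).2 ⟨g, rfl⟩)

theorem IsOrbitProjection.comp_snd
    (hπ : IsOrbitProjection (inferInstance : MulAction Circle N) π) :
    IsOrbitProjection (actProduct N) (fun x : Circle × N => π x.2) := by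
  refine ⟨hπ.1.comp Prod.snd_surjective, fun x y => ⟨fun h => ?_, ?_⟩⟩
  · obtain ⟨g, hg⟩ := (hπ.2 _ _).1 h
    exact ⟨(y.1 * x.1⁻¹, g), Prod.ext (inv_mul_cancel_right y.1 x.1) hg⟩
  · rintro ⟨g, rfl⟩
    exact (hπ.2 _ _).2 ⟨g.2, rfl⟩

end Orbits

/-! ### Fibres of `N → N'` as circle orbits -/

section Hopf

variable {n : ℕ} {N : Type*} [TopologicalSpace N]
  [ChartedSpace (EuclideanSpace ℝ (Fin (2 * n - 1))) N]
  {N' : Type*} [TopologicalSpace N'] [ChartedSpace (CSpace (n - 1)) N']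
  {c : ℝ} {ν : ℕ} {incl : N → CSpace n} {κ : N' → CProj n} {π : N → N'}

local notation "IN" => modelWithCornersSelf ℝ (EuclideanSpace ℝ (Fin (2 * n - 1)))
local notation "IP" => modelWithCornersSelf ℝ (CSpace (n - 1))

/-- Rescaling `v` by `1 / √(c B(v, v))` puts it on the quadric: a line on which `B` has the sign `c`
meets `N`. This gives surjectivity onto the space of lines. -/
theorem IsQuadric.exists_smul (h : IsQuadric c ν incl) (hc : c * c = 1) {v : CSpace n}
    (hv : 0 < c * form n ν v v) : ∃ (z : N) (a : ℂ), a ≠ 0 ∧ incl z = a • v := by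
  set r := √(c * form n ν v v) with hr
  have hr0 : 0 < r := Real.sqrt_pos.2 hv
  have hrr : r * r = c * form n ν v v := Real.mul_self_sqrt hv.le
  have ha : ((r⁻¹ : ℝ) : ℂ) ≠ 0 := by exact_mod_cast inv_ne_zero hr0.ne'
  obtain ⟨z, hz⟩ := h.exists_eq (((r⁻¹ : ℝ) : ℂ) • v) (by
    rw [form_smul_smul, Complex.normSq_ofReal]
    have h1 : form n ν v v = c * (r * r) := by
      rw [hrr]
      linear_combination (-form n ν v v) * hc
    rw [h1]
    field_simp)
  exact ⟨z, _, ha, hz⟩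

/-- The fibres of `N → N'` are the orbits of the unit complex numbers. -/
theorem IsHopf.isOrbitProjection [MulAction Circle N] (hp : IsHopf incl κ π)
    (h : IsQuadric c ν incl) (hc : c * c = 1) (hκ : Function.Injective κ)
    (hact : ∀ (a : Circle) (z : N), incl (a • z) = (a : ℂ) • incl z) :
    IsOrbitProjection (inferInstance : MulAction Circle N) π := by
  refine ⟨hp.surjective, fun z w => ?_⟩
  obtain ⟨hz, hz'⟩ := hp.base_eq z
  obtain ⟨hw, hw'⟩ := hp.base_eq w
  rw [← hκ.eq_iff, hz', hw', eq_comm, Projectivization.mk_eq_mk_iff']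
  constructor
  · rintro ⟨a, ha⟩
    have h1 := h.form_self w
    have h2 : c ≠ 0 := by rintro rfl; simp at hc
    rw [← ha, form_smul_smul, h.form_self] at h1
    -- Both points have square `c ≠ 0`, so the scalar relating them has modulus one.
    have h3 : Complex.normSq a = 1 := mul_right_cancel₀ h2 (h1.trans (one_mul c).symm)
    have h4 : ‖a‖ = 1 := by
      rw [Complex.normSq_eq_norm_sq] at h3
      exact (pow_eq_one_iff_of_nonneg (norm_nonneg a) two_ne_zero).1 h3
    refine ⟨⟨a, mem_sphere_zero_iff_norm.2 h4⟩, h.injective ?_⟩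
    exact (hact _ z).trans ha
  · rintro ⟨a, rfl⟩
    exact ⟨a, (hact a z).symm⟩

end Hopf

/-! ### The unit sphere and complex projective space -/

/-- Lets full projective space enter as the case `κ = id` of `IsHopf`, alongside the open subset of
negative lines. -/
theorem pullback_id_fubiniStudy (n : ℕ) (c : ℝ) (ν : ℕ) :
    pullback 𝓘(ℝ, CSpace (n - 1)) 𝓘(ℝ, CSpace (n - 1)) id (CProj.fubiniStudy c ν) =
      (CProj.fubiniStudy c ν : BilinField 𝓘(ℝ, CSpace (n - 1)) (CProj n)) := by
  funext p
  unfold pullback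
  rw [mfderiv_id]
  rfl

section Sphere

variable (n : ℕ) [NeZero n]

theorem isQuadric_sphere : IsQuadric 1 0 (sphereIncl n) where
  smooth := contMDiff_coe_sphere
  injective := Subtype.val_injective
  immersion z := injective_mvfderiv_subtypeVal_sphere z
  form_self z := by
    rw [form_zero_self]
    simp [sphereIncl]
  exists_eq v hv := by
    rw [form_zero_self] at hv
    refine ⟨⟨v, mem_sphere_zero_iff_norm.2 ?_⟩, rfl⟩
    exact (pow_eq_one_iff_of_nonneg (norm_nonneg v) two_ne_zero).1 hv

theorem isHopf_hopf : IsHopf (sphereIncl n) id (hopf n) where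
  smooth_base := contMDiff_id
  immersion_base q := by
    rw [mfderiv_id]
    exact Function.injective_id
  smooth z := CProj.contMDiffAt_of_lift (isQuadric_sphere n).smooth.contMDiffAt _ fun _ => rfl
  surjective p := by
    obtain ⟨z, a, ha, hz⟩ := (isQuadric_sphere n).exists_smul (by norm_num) (v := p.rep)
      (by rw [one_mul]; exact form_zero_self_pos p.rep_nonzero)
    refine ⟨z, ?_⟩
    rw [← p.mk_rep]
    exact (Projectivization.mk_eq_mk_iff' ℂ _ _ _ _).2 ⟨a, hz.symm⟩
  base_eq z := ⟨_, rfl⟩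

theorem isOrbitProjection_hopf :
    IsOrbitProjection (inferInstance : MulAction Circle (USphere n)) (hopf n) :=
  (isHopf_hopf n).isOrbitProjection (isQuadric_sphere n) (by norm_num) Function.injective_id
    fun _ _ => rfl

end Sphere

/-! ### Pseudo-spheres and their projections -/

section PseudoSphere

variable (n ν : ℕ)

namespace PseudoSphere

variable {n ν}

local notation "IN" => modelWithCornersSelf ℝ (EuclideanSpace ℝ (Fin (2 * n - 1)))

theorem lift_coord_symm_extChartAt (p z : PseudoSphere n ν) (hz : z ∈ (extChartAt IN p).source) :
    p.lift (p.coord.symm (extChartAt IN p z)) = z.incl := by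
  have h1 : z ∈ p.chart.source := by rwa [extChartAt_source] at hz
  have h2 : 0 < 1 + form n ν (p.coord.symm (p.chart z) : CSpace n) (p.coord.symm (p.chart z)) :=
    p.chart.map_source h1
  have h3 : p.chart.symm (p.chart z) = ⟨p.lift (p.coord.symm (p.chart z)), p.form_lift _ h2.le⟩ :=
    dif_pos h2.le
  rw [p.chart.left_inv h1] at h3
  exact (congrArg incl h3).symm

theorem contMDiff_incl : ContMDiff IN 𝓘(ℝ, CSpace n) ∞ (incl : PseudoSphere n ν → CSpace n) := by
  intro p
  have h1 : ContMDiffAt IN IN ∞ (extChartAt IN p) p := contMDiffAt_extChartAt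
  have h2 : ContDiff ℝ ∞ fun x : EuclideanSpace ℝ (Fin (2 * n - 1)) =>
      (p.coord.symm x : CSpace n) := p.perp.subtypeL.contDiff.comp p.coord.symm.contDiff
  have h3 : ContDiffAt ℝ ∞ (fun x : EuclideanSpace ℝ (Fin (2 * n - 1)) =>
      p.lift (p.coord.symm x)) (extChartAt IN p p) := by
    unfold lift
    refine ContDiffAt.add (ContDiffAt.fun_smul (f := fun x => √_) ?_ contDiffAt_const)
      h2.contDiffAt
    refine ContDiffAt.sqrt (contDiff_const.add (contDiff_quad.comp h2)).contDiffAt ?_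
    exact ne_of_gt (p.chart.map_source (mem_chart_source _ p))
  refine (h3.contMDiffAt.comp p h1).congr_of_eventuallyEq ?_
  filter_upwards [extChartAt_source_mem_nhds (I := IN) p] with z hz
  exact (lift_coord_symm_extChartAt p z hz).symm

/-- The chart at `p` is the restriction of the linear map `p.coord ∘ p.proj`, so it factors through
`incl`; a vector killed by `d incl` is killed by the invertible derivative of the chart. -/
theorem injective_mvfderiv_incl (p : PseudoSphere n ν) :
    Function.Injective (mvfderiv IN (incl : PseudoSphere n ν → CSpace n) p) := by
  refine (injective_iff_map_eq_zero _).2 fun X hX => ?_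
  have h1 : mvfderiv IN (extChartAt IN p) p X = 0 := by
    have := mvfderiv_clm_comp_apply
      ((p.coord : p.perp →L[ℝ] EuclideanSpace ℝ (Fin (2 * n - 1))).comp p.proj)
      (contMDiff_incl.contMDiffAt.mdifferentiableAt (by simp) :
        MDifferentiableAt IN 𝓘(ℝ, CSpace n) (incl : PseudoSphere n ν → CSpace n) p) X
    rw [hX, map_zero] at this
    exact this
  obtain ⟨e, he⟩ := isInvertible_mfderiv_extChartAt (I := IN) (mem_extChartAt_source p)
  refine e.injective (Eq.trans ?_ (h1.trans (map_zero e).symm))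
  exact congrArg
    (fun L : TangentSpace IN p →L[ℝ] EuclideanSpace ℝ (Fin (2 * n - 1)) => L X) he

end PseudoSphere

theorem isQuadric_pseudoSphere :
    IsQuadric (-1) ν (PseudoSphere.incl : PseudoSphere n ν → CSpace n) where
  smooth := PseudoSphere.contMDiff_incl
  injective _ _ := PseudoSphere.ext
  immersion := PseudoSphere.injective_mvfderiv_incl
  form_self z := z.incl_spec
  exists_eq v hv := ⟨⟨v, hv⟩, rfl⟩

/-- The chart of `U` at `q` is that of `M` composed with the inclusion, so its invertible derivative
factors through that of the inclusion. -/
theorem injective_mfderiv_subtypeVal {E : Type*} [NormedAddCommGroup E] [NormedSpace ℝ E]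
    {M : Type*} [TopologicalSpace M] [ChartedSpace E M] [IsManifold 𝓘(ℝ, E) ∞ M]
    (U : TopologicalSpace.Opens M) (q : U) :
    Function.Injective (mfderiv 𝓘(ℝ, E) 𝓘(ℝ, E) (Subtype.val : U → M) q) := by
  refine (injective_iff_map_eq_zero _).2 fun X hX => ?_
  have h1 : mvfderiv 𝓘(ℝ, E) (extChartAt 𝓘(ℝ, E) q) q X = 0 := by
    have := mvfderiv_comp_mfderiv_apply (f := extChartAt 𝓘(ℝ, E) (q : M))
      (contMDiffAt_extChartAt.mdifferentiableAt (by simp : (∞ : WithTop ℕ∞) ≠ 0))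
      ((contMDiff_subtype_val (I := 𝓘(ℝ, E)) (n := ∞)).contMDiffAt.mdifferentiableAt
        (by simp) : MDifferentiableAt 𝓘(ℝ, E) 𝓘(ℝ, E) (Subtype.val : U → M) q) X
    rw [hX, map_zero] at this
    exact this
  obtain ⟨e, he⟩ := isInvertible_mfderiv_extChartAt (I := 𝓘(ℝ, E)) (mem_extChartAt_source q)
  refine e.injective (Eq.trans ?_ (h1.trans (map_zero e).symm))
  exact congrArg (fun L : TangentSpace 𝓘(ℝ, E) q →L[ℝ] E => L X) he

theorem isHopf_hopfDual : IsHopf (PseudoSphere.incl : PseudoSphere n ν → CSpace n)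
    (Subtype.val : CProjDual n ν → CProj n) (hopfDual n ν) where
  smooth_base := contMDiff_subtype_val
  immersion_base := injective_mfderiv_subtypeVal _
  smooth := by
    rw [← ContMDiff.subtypeVal_comp_iff]
    exact fun z => CProj.contMDiffAt_of_lift PseudoSphere.contMDiff_incl.contMDiffAt _ fun _ => rfl
  surjective p := by
    have hp : form n ν (p : CProj n).rep (p : CProj n).rep < 0 := p.2
    obtain ⟨z, a, ha, hz⟩ := (isQuadric_pseudoSphere n ν).exists_smul (by norm_num)
      (v := (p : CProj n).rep) (by linarith)
    refine ⟨z, Subtype.ext ?_⟩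
    rw [← (p : CProj n).mk_rep]
    exact (Projectivization.mk_eq_mk_iff' ℂ _ _ _ _).2 ⟨a, hz.symm⟩
  base_eq z := ⟨_, rfl⟩

theorem isOrbitProjection_hopfDual :
    IsOrbitProjection (inferInstance : MulAction Circle (PseudoSphere n ν)) (hopfDual n ν) :=
  (isHopf_hopfDual n ν).isOrbitProjection (isQuadric_pseudoSphere n ν) (by norm_num)
    Subtype.val_injective fun _ _ => rfl

end PseudoSphere

end AntiInvariant

/-! ### The six submersions: `c = 1, ν = 0` for spheres, `c = -1` for pseudo-spheres -/

theorem mainTheorem5 (ℓ : ℕ) [NeZero ℓ] :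
    -- The action of `S^1`, with `J` complex multiplication by `i` on `TM = M × ℂ^ℓ`
    (3 ≤ ℓ →
      XiIsometry (𝓡 (2 * ℓ - 1)) 0 (sphereIncl ℓ) (totalMetric ℓ) ∧
      XiIsometry (𝓡 (2 * ℓ - 1)) 1 (PseudoSphere.incl : PseudoSphere ℓ 1 → CSpace ℓ)
        (pseudoTotalMetric ℓ 1) ∧
      -- `S^1 × S^{2ℓ-1} → S^{2ℓ-1}`
      (IsOrbitProjection (actFirst (USphere ℓ)) Prod.snd ∧
        (∀ x, Module.finrank ℝ (vertical ((𝓡 1).prod (𝓡 (2 * ℓ - 1))) (𝓡 (2 * ℓ - 1))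
          (Prod.snd : Circle × USphere ℓ → USphere ℓ) x) = 1) ∧
        IsAntiInvariantHermitianSubmersion ((𝓡 1).prod (𝓡 (2 * ℓ - 1))) (𝓡 (2 * ℓ - 1))
          (totalMetric ℓ) (totalJ ℓ (mulI ℓ)) (sphereMetric ℓ)
          (Prod.snd : Circle × USphere ℓ → USphere ℓ)) ∧
      -- `S^1 × S^{2ℓ-1} → S^1 × ℂP^{ℓ-1}`
      (IsOrbitProjection (actSecond (USphere ℓ)) (Prod.map id (hopf ℓ)) ∧
        (∀ x, Module.finrank ℝ (vertical ((𝓡 1).prod (𝓡 (2 * ℓ - 1)))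
          ((𝓡 1).prod 𝓘(ℝ, CSpace (ℓ - 1)))
          (Prod.map id (hopf ℓ) : Circle × USphere ℓ → Circle × CProj ℓ) x) = 1) ∧
        IsAntiInvariantHermitianSubmersion ((𝓡 1).prod (𝓡 (2 * ℓ - 1)))
          ((𝓡 1).prod 𝓘(ℝ, CSpace (ℓ - 1)))
          (totalMetric ℓ) (totalJ ℓ (mulI ℓ))
          (prodMetric (𝓡 1) 𝓘(ℝ, CSpace (ℓ - 1)) (circleMetric 1) (CProj.fubiniStudy 1 0))
          (Prod.map id (hopf ℓ) : Circle × USphere ℓ → Circle × CProj ℓ)) ∧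
      -- the projection of `S^1 × (pseudo-sphere)` to the pseudo-sphere
      (IsOrbitProjection (actFirst (PseudoSphere ℓ 1)) Prod.snd ∧
        (∀ x, Module.finrank ℝ (vertical ((𝓡 1).prod (𝓡 (2 * ℓ - 1))) (𝓡 (2 * ℓ - 1))
          (Prod.snd : Circle × PseudoSphere ℓ 1 → PseudoSphere ℓ 1) x) = 1) ∧
        IsAntiInvariantPseudoHermitianSubmersion ((𝓡 1).prod (𝓡 (2 * ℓ - 1))) (𝓡 (2 * ℓ - 1))
          (pseudoTotalMetric ℓ 1) (pseudoTotalJ ℓ 1 (mulI ℓ)) (pseudoSphereMetric ℓ 1)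
          (Prod.snd : Circle × PseudoSphere ℓ 1 → PseudoSphere ℓ 1)) ∧
      -- the projection of `S^1 × (pseudo-sphere)` to `S^1 × (dual of ℂP^{ℓ-1})`
      (IsOrbitProjection (actSecond (PseudoSphere ℓ 1)) (Prod.map id (hopfDual ℓ 1)) ∧
        (∀ x, Module.finrank ℝ (vertical ((𝓡 1).prod (𝓡 (2 * ℓ - 1)))
          ((𝓡 1).prod 𝓘(ℝ, CSpace (ℓ - 1)))
          (Prod.map id (hopfDual ℓ 1) : Circle × PseudoSphere ℓ 1 → Circle × CProjDual ℓ 1) x)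
          = 1) ∧
        IsAntiInvariantPseudoHermitianSubmersion ((𝓡 1).prod (𝓡 (2 * ℓ - 1)))
          ((𝓡 1).prod 𝓘(ℝ, CSpace (ℓ - 1)))
          (pseudoTotalMetric ℓ 1) (pseudoTotalJ ℓ 1 (mulI ℓ))
          (prodMetric (𝓡 1) 𝓘(ℝ, CSpace (ℓ - 1)) (circleMetric (-1)) (dualFubiniStudy ℓ 1))
          (Prod.map id (hopfDual ℓ 1) : Circle × PseudoSphere ℓ 1 → Circle × CProjDual ℓ 1))) ∧
    -- The action of `S^1 × S^1`, with `J` quaternion multiplication by `j` on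
    -- `TM = M × ℍ^ℓ = M × ℂ^{2ℓ}`
    (2 ≤ ℓ →
      XiIsometry (𝓡 (2 * (2 * ℓ) - 1)) 0 (sphereIncl (2 * ℓ)) (totalMetric (2 * ℓ)) ∧
      XiIsometry (𝓡 (2 * (2 * ℓ) - 1)) 2
        (PseudoSphere.incl : PseudoSphere (2 * ℓ) 2 → CSpace (2 * ℓ))
        (pseudoTotalMetric (2 * ℓ) 2) ∧
      -- `S^1 × S^{4ℓ-1} → ℂP^{2ℓ-1}`
      (IsOrbitProjection (actProduct (USphere (2 * ℓ))) (fun x => hopf (2 * ℓ) x.2) ∧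
        (∀ x : Circle × USphere (2 * ℓ),
          (vertical ((𝓡 1).prod (𝓡 (2 * (2 * ℓ) - 1))) 𝓘(ℝ, CSpace (2 * ℓ - 1))
            (fun y : Circle × USphere (2 * ℓ) => hopf (2 * ℓ) y.2) x).map
            (Xi (𝓡 (2 * (2 * ℓ) - 1)) (sphereIncl (2 * ℓ)) x).toLinearMap =
          Submodule.span ℝ {sphereIncl (2 * ℓ) x.2, mulI (2 * ℓ) (sphereIncl (2 * ℓ) x.2)}) ∧
        IsAntiInvariantHermitianSubmersion ((𝓡 1).prod (𝓡 (2 * (2 * ℓ) - 1)))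
          𝓘(ℝ, CSpace (2 * ℓ - 1))
          (totalMetric (2 * ℓ)) (totalJ (2 * ℓ) (mulJ ℓ)) (CProj.fubiniStudy 1 0)
          (fun x : Circle × USphere (2 * ℓ) => hopf (2 * ℓ) x.2)) ∧
      -- the projection of `S^1 × (pseudo-sphere)` to the indefinite dual of `ℂP^{2ℓ-1}`
      (IsOrbitProjection (actProduct (PseudoSphere (2 * ℓ) 2)) (fun x => hopfDual (2 * ℓ) 2 x.2) ∧
        (∀ x : Circle × PseudoSphere (2 * ℓ) 2,
          (vertical ((𝓡 1).prod (𝓡 (2 * (2 * ℓ) - 1))) 𝓘(ℝ, CSpace (2 * ℓ - 1))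
            (fun y : Circle × PseudoSphere (2 * ℓ) 2 => hopfDual (2 * ℓ) 2 y.2) x).map
            (Xi (𝓡 (2 * (2 * ℓ) - 1)) PseudoSphere.incl x).toLinearMap =
          Submodule.span ℝ {x.2.incl, mulI (2 * ℓ) x.2.incl}) ∧
        IsAntiInvariantPseudoHermitianSubmersion ((𝓡 1).prod (𝓡 (2 * (2 * ℓ) - 1)))
          𝓘(ℝ, CSpace (2 * ℓ - 1))
          (pseudoTotalMetric (2 * ℓ) 2) (pseudoTotalJ (2 * ℓ) 2 (mulJ ℓ)) (dualFubiniStudy (2 * ℓ) 2)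
          (fun x : Circle × PseudoSphere (2 * ℓ) 2 => hopfDual (2 * ℓ) 2 x.2))) := by
  have h₁ : (1 : ℝ) * 1 = 1 := by norm_num
  have h₂ : (-1 : ℝ) * -1 = 1 := by norm_num
  refine ⟨fun _ => ?_, fun _ => ?_⟩
  · have hS := isQuadric_sphere ℓ
    have hP := isQuadric_pseudoSphere ℓ 1
    have kS := isHopf_hopf ℓ
    have kP := isHopf_hopfDual ℓ 1
    refine ⟨hS.xiIsometry h₁, hP.xiIsometry h₂,
      ⟨isOrbitProjection_snd _, hS.finrank_vertical_snd h₁,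
        hS.isAntiInvariant_snd h₁ mulI_mulI form_mulI_mulI, hS.isPosDef_quadricMetric,
        hS.isPosDef_induced⟩,
      ⟨(isOrbitProjection_hopf ℓ).prodMap, kS.finrank_vertical_prodMap hS h₁, ?_⟩,
      ⟨isOrbitProjection_snd _, hP.finrank_vertical_snd h₂,
        hP.isAntiInvariant_snd h₂ mulI_mulI form_mulI_mulI⟩,
      ⟨(isOrbitProjection_hopfDual ℓ 1).prodMap, kP.finrank_vertical_prodMap hP h₂,
        kP.isAntiInvariant_prodMap hP h₂ mulI_mulI form_mulI_mulI⟩⟩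
    rw [← pullback_id_fubiniStudy]
    exact ⟨kS.isAntiInvariant_prodMap hS h₁ mulI_mulI form_mulI_mulI, hS.isPosDef_quadricMetric,
      kS.isPosDef_prodBaseMetric hS⟩
  · have hS := isQuadric_sphere (2 * ℓ)
    have hP := isQuadric_pseudoSphere (2 * ℓ) 2
    have kS := isHopf_hopf (2 * ℓ)
    have kP := isHopf_hopfDual (2 * ℓ) 2
    refine ⟨hS.xiIsometry h₁, hP.xiIsometry h₂,
      ⟨(isOrbitProjection_hopf (2 * ℓ)).comp_snd,
        hS.map_vertical h₁ (kS.mfderiv_comp_snd_eq_zero_iff_Xi hS h₁), ?_⟩,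
      ⟨(isOrbitProjection_hopfDual (2 * ℓ) 2).comp_snd,
        hP.map_vertical h₂ (kP.mfderiv_comp_snd_eq_zero_iff_Xi hP h₂),
        kP.isAntiInvariant_comp_snd hP h₂ mulJ_mulJ (form_mulJ_mulJ even_two)
          (form_mulJ_mulI_self even_two)⟩⟩
    rw [← pullback_id_fubiniStudy]
    exact ⟨kS.isAntiInvariant_comp_snd hS h₁ mulJ_mulJ (form_mulJ_mulJ (by simp))
      (form_mulJ_mulI_self (by simp)), hS.isPosDef_quadricMetric, kS.metric_posDef hS⟩
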